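/- **Setting.** A walking robot with state $x=(q,\dot q)$ alternates between two phases $v\in\{\mathrm{ds},\mathrm{ss}\}$ (double and single support). In phase $v$ it obeys the constrained Euler–Lagrange equations $D\ddot q+H-B_vu-J_v^{T}\Lambda=0$, $J_v\ddot q+\dot J_v\dot q=0$, written $\dot x=f_v(x)+g_v(x)u$. It has relative-degree-one outputs $y_{1,v}(q,\dot q)=y^a_{1,v}-y^d_{1,v}$, relative-degree-two outputs $y_{2,v}(q)=y^a_{2,v}(q)-y^d_{2,v}(\tau_v(q))$ with invertible decoupling matrix, and coordinates $z_v$ with $L_{g_v}z_v=0$, such that $\Phi_v(x)=(y_{1,v},y_{2,v},\dot y_{2,v},z_v)=(\eta,z)$ is a diffeomorphism of the domain onto its image. The phase ends on a codimension-one guard $G_v\subset\{h_v=0\}$, where a switching map $\Delta_v$ leads to the other phase. Model functions are continuously differentiable sufficiently often. Let $\mathbb{PZ}_v=\{y_{2,v}=0,\ \dot y_{2,v}=0\}$ and assume hybrid invariance, $\Delta_v(G_v\cap\mathbb{PZ}_v)\subset\mathbb{PZ}_{v'}$, with $v'$ the other phase. For $\epsilon>0$ let $$u_{\rm IO}=\begin{bmatrix}L_gy_1\\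 L_gL_fy_2\end{bmatrix}^{-1}\left(-\begin{bmatrix}L_fy_1\\ L_f^2y_2\end{bmatrix}-\begin{bmatrix}\epsilon y_1\\ 2\epsilon L_fy_2+\epsilon^2y_2\end{bmatrix}\right).$$ The partial hybrid zero dynamics (PHZD) is the hybrid system with $u=u_{\rm IO}$ restricted to the surfaces $\mathbb{PZ}_v$. A periodic orbit $\mathcal O$ of the PHZD consists of one arc in each phase, of duration $T^*_v>0$, starting at the $\Delta$-image of the end point of the other arc, lying in $\mathbb{PZ}_v$, and reaching $G_v$ for the first time at time $T^*_v$, transversally, at a point $x^*_v$. Distances between states of phase $v$ are Euclidean in the coordinates $\Phi_v$. Let $\mathcal B_*$ be the intersection of $G_{\rm ss}$ with the ball of radius $r$ about $x^*_{\rm ss}$, whose coordinates are $(\eta^*,z^*)$. The Poincaré map $\mathbb P$ takes a point of $\mathcal B_*$ through $\Delta_{\rm ss}$, the ds flow, $\Delta_{\rm ds}$ and the ss flow; a phase ends when its trajectory first meets $G_v$ within distance $\rho$ of $x^*_v$. The orbit of the PHZD is exponentially stable if for all small $\rho>0$ there are $r,N>0$ and $\xi\in(0,1)$ such that all iterates of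 the restricted Poincaré map exist on $\mathcal B_*\cap\mathbb{PZ}_{\rm ss}$ and the $i$-th iterate of a point is at distance at most $N\xi^i$ times the initial distance from the fixed point. The applied control is the time-based PD law $u^t_{\rm PD}=-K_p(q-q_d^t)-K_d(\dot q-\dot q_d^t)$, where $(q_d^t,\dot q_d^t)=\Phi_{t,v}^{-1}(y_1^t,0,z^t)$ is reconstructed from the time-based outputs $y_2^t=y^a_{2}(q)-y^d_{2}(\tau(t))$, possibly with a further bounded measurable input disturbance. In each phase, $d_v$ is the deviation of the applied input from $u_{\rm IO}$ along the closed-loop trajectory; at each impact a disturbance $d_e$ is added to the post-impact state $(\eta,z)$; $\|d\|_{\max}$ is the supremum of $\|d_v\|_\infty$ and $|d_e|$ over all phases and impacts. **Theorem.** For $v\in\{\mathrm{ds},\mathrm{ss}\}$ let $C_v$ be a compact set of points of $G_v\cap\mathbb{PZ}_v$ at which $G_v$ is transversal to $\mathbb{PZ}_v$, and let $T_0>0$. There is $\epsilon_0>0$ such that the following holds for every $\epsilon\ge\epsilon_0$. Let $\mathcal O$ be an exponentially stable periodic orbit of the undisturbed PHZD with gain $\epsilon$, with $x^*_v\in C_v$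 and $T^*_v\ge T_0$ for both $v$. (If $\mathcal O$ does not depend on $\epsilon$, one may take $C_v=\{x_v^*\}$ and $T_0=\min_vT^*_v$, so that $\epsilon_0$ depends on the system and on $\mathcal O$ only.) Then, as a periodic orbit of the full-order system, $\mathcal O$ is e-ISS for small disturbances: for all small $\rho>0$ there are $r>0$, $\delta>0$, $N_p>0$, $\xi_p\in(0,1)$ and $\iota_p\in\mathcal K_\infty$ such that, for all time-based PD laws, all disturbances with $\|d\|_{\max}\le\delta$ and all initial conditions $(\eta,z)\in\mathcal B_*$, the iterates $\mathbb P^i(\eta,z)$ of the disturbed Poincaré map exist for all $i\ge0$ and $$|\mathbb P^i(\eta,z)-(\eta^*,z^*)|\le N_p\,\xi_p^{\,i}\,|(\eta,z)-(\eta^*,z^*)|+\iota_p(\|d\|_{\max}).$$ -/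

import Mathlib

open Set Filter Topology MeasureTheory

/-- Euclidean space `ℝⁿ`. -/
abbrev Vec (n : ℕ) : Type := EuclideanSpace ℝ (Fin n)

/-- The two continuous phases: double support and single support. -/
inductive Phase : Type
  | ds : Phase
  | ss : Phase

namespace Phase

/-- The two phases alternate: this is both the successor and the predecessor in the directed
cycle `ds → ss → ds`. -/
def other : Phase → Phase
  | ds => ss
  | ss => ds

end Phase

/-- The phase entered at the `k`-th impact, for a run that starts on the guard of single support:
`ds, ss, ds, ss, …`. -/
def phaseAt : ℕ → Phase
  | 0 => Phase.ds
  | k + 1 => (phaseAt k).other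

/-- Class `𝒦_∞`: continuous, strictly increasing, zero at zero and unbounded on `[0, ∞)`. -/
def IsClassKInf (ι : ℝ → ℝ) : Prop :=
  ContinuousOn ι (Ici 0) ∧ StrictMonoOn ι (Ici 0) ∧ ι 0 = 0 ∧ Tendsto ι atTop atTop

/-- The data of a two-phase walking robot, with state `x = (q, q̇)`. -/
structure Walker where
  /-- number of degrees of freedom -/
  n : ℕ
  /-- number of (independent) inputs, per phase -/
  m : Phase → ℕ
  /-- number of holonomic constraints, per phase -/
  nh : Phase → ℕ
  /-- number of relative degree one outputs -/
  k₁ : Phase → ℕ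
  /-- number of relative degree two outputs -/
  k₂ : Phase → ℕ
  /-- number of zero dynamics coordinates -/
  nz : Phase → ℕ
  /-- configuration space -/
  Q : Set (Vec n)
  /-- inertia matrix `D(q)` -/
  D : Vec n → Vec n →L[ℝ] Vec n
  /-- Coriolis-centrifugal-gravity vector `H(q, q̇)` -/
  H : Vec n × Vec n → Vec n
  /-- actuation matrix -/
  B : ∀ v : Phase, Vec (m v) →L[ℝ] Vec n
  /-- Jacobian of the holonomic constraints -/
  J : ∀ v : Phase, Vec n → Vec n →L[ℝ] Vec (nh v)
  /-- actual relative degree one output -/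
  y₁a : ∀ v : Phase, Vec n × Vec n → Vec (k₁ v)
  /-- desired (constant) relative degree one output -/
  y₁d : ∀ v : Phase, Vec (k₁ v)
  /-- actual relative degree two output -/
  y₂a : ∀ v : Phase, Vec n → Vec (k₂ v)
  /-- desired relative degree two output, as a function of the phase variable -/
  y₂d : ∀ v : Phase, ℝ → Vec (k₂ v)
  /-- state based phase variable -/
  tau : ∀ _ : Phase, Vec n → ℝ
  /-- zero dynamics coordinates -/
  z : ∀ v : Phase, Vec n × Vec n → Vec (nz v)
  /-- the states of each domain, with an open margin around the domain -/
  dom : Phase → Set (Vec n × Vec n)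
  /-- the open region of each domain in which the guard is active -/
  act : Phase → Set (Vec n × Vec n)
  /-- guard function: the transition is triggered when it vanishes -/
  h : ∀ _ : Phase, Vec n × Vec n → ℝ
  /-- switching function from the guard of a phase to the domain of the next one -/
  reset : ∀ _ : Phase, Vec n × Vec n → Vec n × Vec n

noncomputable section

namespace Walker

variable (W : Walker)

/-- The state space, with points `x = (q, q̇)`. -/
abbrev X : Type := Vec W.n × Vec W.n

/-- Transformed coordinates `(η, z) = (y₁, y₂, ẏ₂, z)`. -/
abbrev Coord (v : Phase) : Type := Vec (W.k₁ v) × Vec (W.k₂ v) × Vec (W.k₂ v) × Vec (W.nz v)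

/-- The Euclidean norm of `(y₁, y₂, ẏ₂, z)` (the built-in norm of a product is the maximum). -/
def coordNorm {v : Phase} (p : W.Coord v) : ℝ :=
  Real.sqrt (‖p.1‖ ^ 2 + ‖p.2.1‖ ^ 2 + ‖p.2.2.1‖ ^ 2 + ‖p.2.2.2‖ ^ 2)

/-! ### Constrained Euler-Lagrange dynamics `ẋ = f(x) + g(x) u` -/

/-- `J D⁻¹ Jᵀ`. -/
def JDJ (v : Phase) (q : Vec W.n) : Vec (W.nh v) →L[ℝ] Vec (W.nh v) :=
  W.J v q ∘L (W.D q).inverse ∘L ContinuousLinearMap.adjoint (W.J v q)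

/-- `Λ₁ = (J D⁻¹ Jᵀ)⁻¹ J D⁻¹`. -/
def Lam₁ (v : Phase) (q : Vec W.n) : Vec W.n →L[ℝ] Vec (W.nh v) :=
  (W.JDJ v q).inverse ∘L W.J v q ∘L (W.D q).inverse

/-- `Λ₂ = (J D⁻¹ Jᵀ)⁻¹ J̇ q̇`, where `J̇` is the derivative of `J` along `q̇`. -/
def Lam₂ (v : Phase) (x : W.X) : Vec (W.nh v) :=
  (W.JDJ v x.1).inverse ((fderiv ℝ (W.J v) x.1 x.2) x.2)

/-- `1 - Jᵀ Λ₁`. -/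
def proj (v : Phase) (q : Vec W.n) : Vec W.n →L[ℝ] Vec W.n :=
  ContinuousLinearMap.id ℝ (Vec W.n) - ContinuousLinearMap.adjoint (W.J v q) ∘L W.Lam₁ v q

/-- Drift of `D q̈ + (1 - Jᵀ Λ₁) H + Jᵀ Λ₂ = (1 - Jᵀ Λ₁) B u`. -/
def f (v : Phase) (x : W.X) : W.X :=
  (x.2, - (W.D x.1).inverse
    (W.proj v x.1 (W.H x) + ContinuousLinearMap.adjoint (W.J v x.1) (W.Lam₂ v x)))

/-- Input map of the same equation. -/
def g (v : Phase) (x : W.X) : Vec (W.m v) →L[ℝ] W.X :=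
  ContinuousLinearMap.prod 0 ((W.D x.1).inverse ∘L W.proj v x.1 ∘L W.B v)

/-! ### Outputs and transformed coordinates -/

/-- Relative degree one outputs. -/
def y₁ (v : Phase) (x : W.X) : Vec (W.k₁ v) := W.y₁a v x - W.y₁d v

/-- Relative degree two outputs. -/
def y₂ (v : Phase) (x : W.X) : Vec (W.k₂ v) := W.y₂a v x.1 - W.y₂d v (W.tau v x.1)

/-- `L_f y₁`. -/
def Lfy₁ (v : Phase) (x : W.X) : Vec (W.k₁ v) := fderiv ℝ (W.y₁ v) x (W.f v x)

/-- `L_f y₂`, which is `ẏ₂`. -/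
def Lfy₂ (v : Phase) (x : W.X) : Vec (W.k₂ v) := fderiv ℝ (W.y₂ v) x (W.f v x)

/-- `L_f² y₂`. -/
def Lffy₂ (v : Phase) (x : W.X) : Vec (W.k₂ v) := fderiv ℝ (W.Lfy₂ v) x (W.f v x)

/-- The decoupling matrix `(L_g y₁, L_g L_f y₂)`. -/
def decoupling (v : Phase) (x : W.X) : Vec (W.m v) →L[ℝ] Vec (W.k₁ v) × Vec (W.k₂ v) :=
  ContinuousLinearMap.prod (fderiv ℝ (W.y₁ v) x ∘L W.g v x) (fderiv ℝ (W.Lfy₂ v) x ∘L W.g v x)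

/-- The feedback linearizing control law `u_IO` (named `uFL`), with gain parameter `ε`. -/
def uFL (ε : ℝ) (v : Phase) (x : W.X) : Vec (W.m v) :=
  (W.decoupling v x).inverse
    (- (W.Lfy₁ v x, W.Lffy₂ v x)
      - (ε • W.y₁ v x, (2 * ε) • W.Lfy₂ v x + ε ^ 2 • W.y₂ v x))

/-- `η₂ = (y₂, ẏ₂)`. -/
def eta₂ (v : Phase) (x : W.X) : Vec (W.k₂ v) × Vec (W.k₂ v) := (W.y₂ v x, W.Lfy₂ v x)

/-- The change of coordinates `x ↦ (η, z) = (y₁, y₂, ẏ₂, z)`. -/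
def Phi (v : Phase) (x : W.X) : W.Coord v := (W.y₁ v x, W.y₂ v x, W.Lfy₂ v x, W.z v x)

/-- Euclidean distance of two states of phase `v` in the coordinates `(η, z)`. -/
def cdist (v : Phase) (x x' : W.X) : ℝ := W.coordNorm (W.Phi v x - W.Phi v x')

/-- The partial zero dynamics surface. -/
def PZ (v : Phase) : Set W.X := {x | x ∈ W.dom v ∧ W.y₂ v x = 0 ∧ W.Lfy₂ v x = 0}

/-- The guard. -/
def guard (v : Phase) : Set W.X := {x | x ∈ W.act v ∧ W.h v x = 0}

/-- The points at which the guard cuts the partial zero dynamics surface transversally. -/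
def guardPZ (v : Phase) : Set W.X :=
  {x | x ∈ W.guard v ∧ x ∈ W.PZ v ∧
    ∃ ξ : W.X, fderiv ℝ (W.eta₂ v) x ξ = 0 ∧ fderiv ℝ (W.h v) x ξ ≠ 0}

/-- The properties that make the data a two-phase walking model with hybrid invariant partial zero
dynamics. -/
structure IsModel : Prop where
  isOpen_Q : IsOpen W.Q
  contDiffOn_D : ContDiffOn ℝ 1 W.D W.Q
  /-- the inertia matrix is symmetric positive definite -/
  symm_D : ∀ q ∈ W.Q, ∀ a b : Vec W.n, inner ℝ (W.D q a) b = inner ℝ a (W.D q b)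
  pos_D : ∀ q ∈ W.Q, ∀ a : Vec W.n, a ≠ 0 → 0 < inner ℝ (W.D q a) a
  contDiffOn_H : ContDiffOn ℝ 1 W.H (W.Q ×ˢ univ)
  contDiffOn_J : ∀ v, ContDiffOn ℝ 2 (W.J v) W.Q
  isInvertible_JDJ : ∀ v, ∀ q ∈ W.Q, (W.JDJ v q).IsInvertible
  contDiffOn_y₁a : ∀ v, ContDiffOn ℝ 2 (W.y₁a v) (W.Q ×ˢ univ)
  contDiffOn_y₂a : ∀ v, ContDiffOn ℝ 3 (W.y₂a v) W.Q
  contDiff_y₂d : ∀ v, ContDiff ℝ 3 (W.y₂d v)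
  contDiffOn_tau : ∀ v, ContDiffOn ℝ 3 (W.tau v) W.Q
  contDiffOn_z : ∀ v, ContDiffOn ℝ 2 (W.z v) (W.Q ×ˢ univ)
  isOpen_dom : ∀ v, IsOpen (W.dom v)
  dom_subset : ∀ v, W.dom v ⊆ W.Q ×ˢ univ
  /-- the outputs have vector relative degree -/
  isInvertible_decoupling : ∀ v, ∀ x ∈ W.dom v, (W.decoupling v x).IsInvertible
  /-- the input does not enter the zero dynamics: `ż = Ψ(η, z)` -/
  Lg_z : ∀ v, ∀ x ∈ W.dom v, ∀ u : Vec (W.m v), fderiv ℝ (W.z v) x (W.g v x u) = 0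
  /-- `(η, z)` is a diffeomorphism of the domain onto its image -/
  injOn_Phi : ∀ v, InjOn (W.Phi v) (W.dom v)
  isInvertible_Phi : ∀ v, ∀ x ∈ W.dom v, (fderiv ℝ (W.Phi v) x).IsInvertible
  isOpen_act : ∀ v, IsOpen (W.act v)
  act_subset : ∀ v, W.act v ⊆ W.dom v
  contDiffOn_h : ∀ v, ContDiffOn ℝ 1 (W.h v) (W.act v)
  /-- the guard has codimension one -/
  guard_codim : ∀ v, ∀ x ∈ W.guard v, fderiv ℝ (W.h v) x ≠ 0
  contDiffOn_reset : ∀ v, ContDiffOn ℝ 1 (W.reset v) (W.act v)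
  reset_mem : ∀ v, ∀ x ∈ W.guard v, W.reset v x ∈ W.dom v.other
  /-- hybrid invariance of the partial zero dynamics -/
  reset_PZ : ∀ v, ∀ x ∈ W.guard v ∩ W.PZ v, W.reset v x ∈ W.PZ v.other

/-! ### Trajectories and hybrid runs -/

/-- `x` solves `ẋ = f(x) + g(x) u(t, x)` on `[0, S]` in the sense of Carathéodory (integral
equation), and stays in the set `Z`. -/
def IsTraj (v : Phase) (Z : Set W.X) (u : ℝ → W.X → Vec (W.m v)) (S : ℝ) (x : ℝ → W.X) : Prop :=
  0 ≤ S ∧ ContinuousOn x (Icc 0 S) ∧ (∀ t ∈ Icc 0 S, x t ∈ Z) ∧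
    ∀ t ∈ Icc 0 S, x t = x 0 + ∫ s in (0 : ℝ)..t, (W.f v (x s) + W.g v (x s) (u s (x s)))

/-- `Guard ∩ 𝔹_ρ(c)`, the part of the guard that is within distance `ρ` of the point `c`. -/
def guardBall (v : Phase) (c : W.X) (ρ : ℝ) : Set W.X := {y | y ∈ W.guard v ∧ W.cdist v y c < ρ}

/-- A trajectory in phase `v` that starts, at time zero of that phase, from the post-impact state
of the point `a` on the guard of the preceding phase, displaced by the impact disturbance `e`,
and that does not meet `Guard ∩ 𝔹_ρ(c)` before time `S`. -/
def IsArc (v : Phase) (Z : Set W.X) (u : ℝ → W.X → Vec (W.m v)) (e : W.Coord v) (c : W.X) (ρ : ℝ)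
    (a : W.X) (S : ℝ) (x : ℝ → W.X) : Prop :=
  W.IsTraj v Z u S x ∧ W.Phi v (x 0) = W.Phi v (W.reset v.other a) + e ∧
    ∀ t ∈ Ico 0 S, x t ∉ W.guardBall v c ρ

/-- A hybrid run through `K` phases, recorded by the points `p 0, p 1, …, p K` at which it meets
the guards. It starts on the guard of single support, so that `p (2 * i)` is the `i`-th iterate
of the Poincaré map at `p 0`. The duration `T` of each phase is the time to impact, that is, the
first time at which `Guard ∩ 𝔹_ρ(c)` is met. -/
def IsRun (Z : Phase → Set W.X) (u : ∀ k : ℕ, ℝ → W.X → Vec (W.m (phaseAt k)))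
    (e : ∀ k : ℕ, W.Coord (phaseAt k)) (c : Phase → W.X) (ρ : ℝ) (K : ℕ) (p : ℕ → W.X) : Prop :=
  ∀ k < K, ∃ (T : ℝ) (x : ℝ → W.X),
    W.IsArc (phaseAt k) (Z (phaseAt k)) (u k) (e k) (c (phaseAt k)) ρ (p k) T x ∧
      x T ∈ W.guardBall (phaseAt k) (c (phaseAt k)) ρ ∧ p (k + 1) = x T

/-! ### Periodic orbits of the partial hybrid zero dynamics -/

/-- A pair of arcs with their durations. -/
structure Orbit where
  γ : Phase → ℝ → W.X
  T : Phase → ℝ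

/-- The end point of the arc of phase `v`, where the orbit meets the guard. -/
def Orbit.pt {W : Walker} (O : W.Orbit) (v : Phase) : W.X := O.γ v (O.T v)

/-- `O` is a hybrid periodic orbit of the partial hybrid zero dynamics with gain parameter `ε`,
that is, of the undisturbed closed loop restricted to the partial zero dynamics surfaces. Each
`T v` is the time to reach the guard, and the guard is crossed transversally. -/
structure IsOrbitPZ (ε : ℝ) (O : W.Orbit) : Prop where
  pos_T : ∀ v, 0 < O.T v
  traj : ∀ v, W.IsTraj v (W.PZ v) (fun _ => W.uFL ε v) (O.T v) (O.γ v)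
  start : ∀ v, O.γ v 0 = W.reset v.other (O.pt v.other)
  not_guard : ∀ v, ∀ t ∈ Ico 0 (O.T v), O.γ v t ∉ W.guard v
  guard : ∀ v, O.pt v ∈ W.guard v
  transversal : ∀ v,
    fderiv ℝ (W.h v) (O.pt v) (W.f v (O.pt v) + W.g v (O.pt v) (W.uFL ε v (O.pt v))) ≠ 0

/-- Runs of the partial hybrid zero dynamics: no disturbance, on the surfaces `PZ`. -/
def IsRunPZ (ε : ℝ) (O : W.Orbit) (ρ : ℝ) (K : ℕ) (p : ℕ → W.X) : Prop :=
  W.IsRun W.PZ (fun k _ => W.uFL ε (phaseAt k)) (fun _ => 0) O.pt ρ K p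

/-- Exponential stability of a periodic orbit of the partial hybrid zero dynamics: the iterates of
the restricted Poincaré map are well defined near the orbit and converge geometrically. -/
def IsExpStablePZ (ε : ℝ) (O : W.Orbit) : Prop :=
  ∃ ρ₀ > 0, ∀ ρ, 0 < ρ → ρ ≤ ρ₀ → ∃ r > 0, ∃ N > 0, ∃ ξ : ℝ, 0 < ξ ∧ ξ < 1 ∧
    ∀ x₀ ∈ W.guardBall Phase.ss (O.pt Phase.ss) r ∩ W.PZ Phase.ss,
      (∃ p : ℕ → W.X, p 0 = x₀ ∧ ∀ K, W.IsRunPZ ε O ρ K p) ∧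
      ∀ (i : ℕ) (p : ℕ → W.X), p 0 = x₀ → W.IsRunPZ ε O ρ (2 * i) p →
        W.cdist Phase.ss (p (2 * i)) (O.pt Phase.ss) ≤
          N * ξ ^ i * W.cdist Phase.ss x₀ (O.pt Phase.ss)

/-! ### The time based PD law -/

/-- The velocity of the time based desired output `y₂d (τ(t))`. -/
def y₂dDot (v : Phase) (τt : ℝ → ℝ) (t : ℝ) : Vec (W.k₂ v) :=
  deriv (fun s => W.y₂d v (τt s)) t

/-- The time based change of coordinates `x ↦ (η_t, z_t) = (y₁, y₂ᵗ, ẏ₂ᵗ, z_t)`, where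
`y₂ᵗ = y₂a(q) - y₂d(τ(t))`. -/
def PhiT (v : Phase) (τt : ℝ → ℝ) (zt : ℝ → W.X → Vec (W.nz v)) (t : ℝ) (x : W.X) : W.Coord v :=
  (W.y₁ v x, W.y₂a v x.1 - W.y₂d v (τt t),
    fderiv ℝ (W.y₂a v) x.1 x.2 - W.y₂dDot v τt t, zt t x)

/-- A time based linear feedback law in phase `v`; time is counted from the start of the phase.
The reference values `y₁ref`, `zref` of the reconstruction may be functions of time alone, or
the current values of `y₁` and `z_t`. -/
structure PDLaw (v : Phase) where
  /-- time based phase variable -/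
  τt : ℝ → ℝ
  /-- zero dynamics coordinates of the time based outputs -/
  zt : ℝ → W.X → Vec (W.nz v)
  y₁ref : ℝ → W.X → Vec (W.k₁ v)
  zref : ℝ → W.X → Vec (W.nz v)
  /-- the desired state `(q_d, q̇_d)` -/
  xd : ℝ → W.X → W.X
  /-- proportional gain -/
  Kp : Vec W.n →L[ℝ] Vec (W.m v)
  /-- derivative gain -/
  Kd : Vec W.n →L[ℝ] Vec (W.m v)
  /-- the region on which `Φ_t = (η_t, z_t)` is a diffeomorphism onto its image -/
  U : ℝ → Set W.X
  contDiff_τt : ContDiff ℝ 2 τt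
  isOpen_U : ∀ t, 0 ≤ t → IsOpen (U t)
  U_subset : ∀ t, 0 ≤ t → U t ⊆ W.Q ×ˢ univ
  contDiffOn_PhiT : ∀ t, 0 ≤ t → ContDiffOn ℝ 1 (W.PhiT v τt zt t) (U t)
  injOn_PhiT : ∀ t, 0 ≤ t → InjOn (W.PhiT v τt zt t) (U t)
  isInvertible_PhiT : ∀ t, 0 ≤ t → ∀ x ∈ U t, (fderiv ℝ (W.PhiT v τt zt t) x).IsInvertible
  /-- reconstruction from the partial zero dynamics: `x_d = Φ_t⁻¹ (y₁ref, 0, zref)` -/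
  xd_mem : ∀ t, 0 ≤ t → ∀ x ∈ W.dom v, xd t x ∈ U t
  PhiT_xd : ∀ t, 0 ≤ t → ∀ x ∈ W.dom v,
    W.PhiT v τt zt t (xd t x) = (y₁ref t x, 0, 0, zref t x)
  /-- the desired state is continuous, and locally Lipschitz in the state -/
  continuousOn_xd : ContinuousOn (fun p : ℝ × W.X => xd p.1 p.2) (Ici 0 ×ˢ W.dom v)
  lipschitz_xd : ∀ S : ℝ, ∀ C ⊆ W.dom v, IsCompact C →
    ∃ L, ∀ t ∈ Icc 0 S, LipschitzOnWith L (xd t) C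

/-- `u_PD = - K_p (q - q_d) - K_d (q̇ - q̇_d)`. -/
def PDLaw.uPD {W : Walker} {v : Phase} (L : W.PDLaw v) (t : ℝ) (x : W.X) : Vec (W.m v) :=
  - L.Kp (x.1 - (L.xd t x).1) - L.Kd (x.2 - (L.xd t x).2)

/-- The applied input in the `k`-th phase: the PD law, plus a further input disturbance `w`
(which may be zero). -/
def appliedInput (L : ∀ v : Phase, W.PDLaw v) (w : ∀ k : ℕ, ℝ → Vec (W.m (phaseAt k))) (k : ℕ)
    (t : ℝ) (x : W.X) : Vec (W.m (phaseAt k)) :=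
  (L (phaseAt k)).uPD t x + w k t

/-! ### Input to state stability of the periodic orbit -/

/-- Runs of the full order closed loop under the PD law `L`, with the further input disturbances
`w` and the impact disturbances `e`. -/
def IsRunPD (L : ∀ v : Phase, W.PDLaw v) (w : ∀ k : ℕ, ℝ → Vec (W.m (phaseAt k)))
    (e : ∀ k : ℕ, W.Coord (phaseAt k)) (O : W.Orbit) (ρ : ℝ) (K : ℕ) (p : ℕ → W.X) : Prop :=
  W.IsRun W.dom (W.appliedInput L w) e O.pt ρ K p

/-- `‖d‖_max ≤ D` for the closed loop started at `x₀`: the impact disturbances are bounded by `D`,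
and so is, along every trajectory of the closed loop (through any number `K` of phases, and up to
any time `S` of the next phase), the continuous-phase disturbance `d`, which is the deviation of
the applied input from `u_IO`. -/
def DistBound (ε : ℝ) (L : ∀ v : Phase, W.PDLaw v) (w : ∀ k : ℕ, ℝ → Vec (W.m (phaseAt k)))
    (e : ∀ k : ℕ, W.Coord (phaseAt k)) (O : W.Orbit) (ρ : ℝ) (x₀ : W.X) (D : ℝ) : Prop :=
  (∀ k, W.coordNorm (e k) ≤ D) ∧
  ∀ (K : ℕ) (p : ℕ → W.X), p 0 = x₀ → W.IsRunPD L w e O ρ K p →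
    ∀ (S : ℝ) (x : ℝ → W.X),
      W.IsArc (phaseAt K) (W.dom (phaseAt K)) (W.appliedInput L w K) (e K) (O.pt (phaseAt K)) ρ
        (p K) S x →
      ∀ᵐ t ∂(volume.restrict (Icc 0 S)),
        ‖W.appliedInput L w K t (x t) - W.uFL ε (phaseAt K) (x t)‖ ≤ D

/-- Exponential input to state stability of the full order periodic orbit under time based PD laws,
for disturbances with `‖d‖_max ≤ δ` and initial conditions in `B_* = Guard ∩ 𝔹_r`, with impacts
detected within distance `ρ` of the orbit. The Poincaré iterates exist and satisfy
`|P^i(η,z) - (η*,z*)| ≤ N ξ^i |(η,z) - (η*,z*)| + ι(‖d‖_max)`. The constants are uniform over the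
PD laws and the disturbances. -/
def IsEISS (ε : ℝ) (O : W.Orbit) (ρ r δ : ℝ) : Prop :=
  ∃ N > 0, ∃ ξ : ℝ, 0 < ξ ∧ ξ < 1 ∧ ∃ ι : ℝ → ℝ, IsClassKInf ι ∧
    ∀ (L : ∀ v : Phase, W.PDLaw v) (w : ∀ k : ℕ, ℝ → Vec (W.m (phaseAt k)))
      (e : ∀ k : ℕ, W.Coord (phaseAt k)),
      (∀ k, Measurable (w k)) → (∀ k, ∃ C, ∀ t, ‖w k t‖ ≤ C) →
      ∀ x₀ ∈ W.guardBall Phase.ss (O.pt Phase.ss) r, ∀ D ≤ δ, W.DistBound ε L w e O ρ x₀ D →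
        (∃ p : ℕ → W.X, p 0 = x₀ ∧ ∀ K, W.IsRunPD L w e O ρ K p) ∧
        ∀ (i : ℕ) (p : ℕ → W.X), p 0 = x₀ → W.IsRunPD L w e O ρ (2 * i) p →
          W.cdist Phase.ss (p (2 * i)) (O.pt Phase.ss) ≤
            N * ξ ^ i * W.cdist Phase.ss x₀ (O.pt Phase.ss) + ι D

end Walker

end

/-!
The proof uses no linearisation of the Poincaré map. It combines Lipschitz estimates for one phase,
valid under disturbances, with a contraction argument for the iteration of the phases.

*One phase.* Whatever the applied control is, an arc of the walker is an approximate trajectory of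
the autonomous closed loop under `u_IO`, with an error of the size of the input deviation
(`IsApproxTraj`). Grönwall's inequality (`IsApproxTraj.dist_le`) keeps it in a tube around the
nominal arc. Near the end of the nominal arc transversality makes the guard function increase at a
rate bounded below along all these trajectories, so the guard is reached, once, at an impact point
that is a Lipschitz function of the initial point up to a multiple of the disturbance
(`exists_ball_crossing`, `exists_impact_estimates`). The first impact within distance `ρ` of the
nominal one is this one, because the nominal arc stays away from the guard before.

*The gain.* Under `u_IO` the outputs `y₂` satisfy `ÿ₂ + 2 ε ẏ₂ + ε² y₂ = 0`, so the transverse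
coordinates `η₂ = (y₂, ẏ₂)` decay over a phase by the factor `e^{-εt} (1 + t (1 + ε)²)`
(`Walker.IsModel.norm_eta₂_le`). Hybrid invariance and the transversality of guard and surface give
`‖η₂ ∘ Δ‖ ≤ K ‖η₂‖` near each point of the compact set `C_v`, with `K` independent of the gain
(`Walker.IsModel.exists_reset_bound`). As phases last at least `T₀ / 2` for nearby runs, every
`ε ≥ ε₀` makes the decay outweigh the switching maps: each phase at least halves `η₂`, up to a
multiple of the disturbance (`Walker.exists_gain`).

*Iteration.* Let `c` be the fixed point. A point `a` of the guard lies within a multiple of `‖η₂ a‖`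
of a point of the zero dynamics surface (`Walker.IsModel.exists_projection`), where the undisturbed
iteration converges by hypothesis. By the Lipschitz estimates, after sufficiently many cycles
`‖a - c‖ + W ‖η₂ a‖`, with a large weight `W`, is halved up to a multiple of the disturbance. This
is input to state stability (`exists_iss_of_transverse_contraction`).

*Existence of the iterates.* The input deviation is bounded only along arcs of the disturbed system,
so a trajectory is not known in advance to satisfy the bound that keeps it in the tube. The PD law
is Lipschitz in the state and measurable in time; Carathéodory solutions exist by Picard iteration
while they stay in a given set (`exists_integral_curve_while_mem`), and the bound is then applied to
the part of the trajectory that has been built, which is an arc as long as it has not met the guard.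
-/

/-! ### Integral inequalities and continuation arguments -/

/-- Grönwall's inequality in integral form. -/
theorem le_mul_exp_of_le_integral {u : ℝ → ℝ} {A L S : ℝ} (hu : ContinuousOn u (Icc 0 S))
    (hL : 0 ≤ L) (h : ∀ t ∈ Icc 0 S, u t ≤ A + L * ∫ s in (0 : ℝ)..t, u s) :
    ∀ t ∈ Icc 0 S, u t ≤ A * Real.exp (L * t) := by
  intro t ht
  have hS : 0 ≤ S := ht.1.trans ht.2
  have hint : IntervalIntegrable u volume 0 S := by
    apply ContinuousOn.intervalIntegrable
    rwa [uIcc_of_le hS]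
  set U : ℝ → ℝ := fun t => A + L * ∫ s in (0 : ℝ)..t, u s with hU
  have hUc : ContinuousOn U (Icc 0 S) := by
    have := intervalIntegral.continuousOn_primitive_interval (μ := volume) (f := u) (a := 0)
      (b := S) (by rw [uIcc_of_le hS]; exact hu.integrableOn_Icc)
    rw [uIcc_of_le hS] at this
    exact continuousOn_const.add (continuousOn_const.mul this)
  have hUd : ∀ s ∈ Ioo 0 S, HasDerivAt U (L * u s) s := by
    intro s hs
    have h1 : HasDerivAt (fun t => ∫ r in (0 : ℝ)..t, u r) (u s) s := by
      apply intervalIntegral.integral_hasDerivAt_right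
      · exact hint.mono_set (by
          rw [uIcc_of_le hS, uIcc_of_le hs.1.le]; exact Icc_subset_Icc le_rfl hs.2.le)
      · exact ContinuousOn.stronglyMeasurableAtFilter isOpen_Ioo (hu.mono Ioo_subset_Icc_self) s hs
      · exact hu.continuousAt (Icc_mem_nhds hs.1 hs.2)
    exact (h1.const_mul L).const_add A
  have hanti : AntitoneOn (fun t => U t * Real.exp (-(L * t))) (Icc 0 S) := by
    apply antitoneOn_of_deriv_nonpos (convex_Icc 0 S)
    · exact hUc.mul (by fun_prop)
    · intro s hs
      rw [interior_Icc] at hs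
      have h2 : HasDerivAt (fun t : ℝ => Real.exp (-(L * t)))
          (Real.exp (-(L * s)) * (-(L * 1))) s :=
        (((hasDerivAt_id s).const_mul L).neg).exp
      exact ((hUd s hs).mul h2).differentiableAt.differentiableWithinAt
    · intro s hs
      rw [interior_Icc] at hs
      have h2 : HasDerivAt (fun t : ℝ => Real.exp (-(L * t)))
          (Real.exp (-(L * s)) * (-(L * 1))) s :=
        (((hasDerivAt_id s).const_mul L).neg).exp
      rw [(show HasDerivAt (fun t => U t * Real.exp (-(L * t))) _ s from (hUd s hs).mul h2).deriv]
      have h3 := h s ⟨hs.1.le, hs.2.le⟩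
      have h4 : 0 ≤ L * (U s - u s) * Real.exp (-(L * s)) :=
        mul_nonneg (mul_nonneg hL (sub_nonneg.2 h3)) (Real.exp_pos _).le
      linarith
  have h5 := hanti (left_mem_Icc.2 hS) ht ht.1
  have h6 : U 0 = A := by simp [hU]
  simp only [h6, mul_zero, neg_zero, Real.exp_zero, mul_one] at h5
  rw [Real.exp_neg, ← div_eq_mul_inv, div_le_iff₀ (Real.exp_pos _)] at h5
  exact (h t ht).trans h5

/-- Continuous induction: a bound that improves itself to a strict one holds throughout. -/
theorem lt_of_forall_le_imp_lt {φ : ℝ → ℝ} {S b : ℝ} (hφ : ContinuousOn φ (Icc 0 S))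
    (h0 : φ 0 < b) (step : ∀ t ∈ Icc 0 S, (∀ s ∈ Icc 0 t, φ s ≤ b) → φ t < b) :
    ∀ t ∈ Icc 0 S, φ t < b := by
  by_contra! hcon
  obtain ⟨t, ht, hbt⟩ := hcon
  have hcl : IsClosed (Icc 0 S ∩ φ ⁻¹' Ici b) := hφ.preimage_isClosed_of_isClosed isClosed_Icc
    isClosed_Ici
  have hcp : IsCompact (Icc 0 S ∩ φ ⁻¹' Ici b) :=
    isCompact_Icc.of_isClosed_subset hcl inter_subset_left
  obtain ⟨m, ⟨hm, hbm⟩, hmin⟩ := hcp.exists_isLeast ⟨t, ht, hbt⟩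
  have hlt : ∀ s ∈ Ico 0 m, φ s < b := by
    intro s hs
    by_contra! hc
    exact absurd (hmin ⟨⟨hs.1, hs.2.le.trans hm.2⟩, hc⟩) (not_le.2 hs.2)
  have hm0 : 0 < m := by
    rcases hm.1.eq_or_lt with h | h
    · rw [← h] at hbm
      exact absurd h0 (not_lt.2 hbm)
    · exact h
  have hle : φ m ≤ b := by
    have hc : ContinuousWithinAt φ (Ico 0 m) m :=
      (hφ m hm).mono (fun s hs => ⟨hs.1, hs.2.le.trans hm.2⟩)
    refine closure_minimal (s := φ '' Ico 0 m) (t := Iic b) ?_ isClosed_Iic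
      (hc.mem_closure_image ?_)
    · rintro _ ⟨s, hs, rfl⟩
      exact (hlt s hs).le
    · rw [closure_Ico hm0.ne]
      exact ⟨hm0.le, le_rfl⟩
  refine absurd (step m hm ?_) (not_lt.2 hbm)
  intro s hs
  rcases hs.2.eq_or_lt with h | h
  · rw [h]; exact hle
  · exact (hlt s ⟨hs.1, h⟩).le

/-! ### Existence of Carathéodory solutions -/

section Picard

variable {E : Type*} [NormedAddCommGroup E] [NormedSpace ℝ E] [CompleteSpace E]

/-- Existence of Carathéodory solutions on `[0, S]` for a bounded right-hand side that is globally
Lipschitz in the state. In the variable `Y t = exp (-λ t) x t`, with `λ` large, the integral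
operator contracts the sup norm. -/
theorem exists_integral_curve {R : ℝ → E → E} {S L B : ℝ} (hS : 0 ≤ S) (hL : 0 ≤ L) (hB : 0 ≤ B)
    (hLip : ∀ t ∈ Icc 0 S, ∀ x y, ‖R t x - R t y‖ ≤ L * ‖x - y‖)
    (hbd : ∀ t ∈ Icc 0 S, ∀ x, ‖R t x‖ ≤ B)
    (hmeas : ∀ x : ℝ → E, Continuous x →
      AEStronglyMeasurable (fun t => R t (x t)) (volume.restrict (Icc 0 S))) (x₀ : E) :
    ∃ x : ℝ → E, Continuous x ∧ x 0 = x₀ ∧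
      ∀ t ∈ Icc 0 S, x t = x₀ + ∫ s in (0 : ℝ)..t, R s (x s) := by
  set l : ℝ := 2 * L + 1 with hl
  have hl0 : 0 < l := by positivity
  set τ : ℝ → ℝ := fun t => max 0 (min S t) with hτ
  have hτc : Continuous τ := by fun_prop
  have hτm : ∀ t, τ t ∈ Icc 0 S := fun t => ⟨le_max_left _ _, max_le hS (min_le_left _ _)⟩
  have hτid : ∀ t ∈ Icc 0 S, τ t = t := by
    intro t ht
    simp only [hτ]
    rw [min_eq_right ht.2, max_eq_right ht.1]
  have hint : ∀ x : ℝ → E, Continuous x → IntegrableOn (fun t => R t (x t)) (Icc 0 S) := by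
    intro x hx
    refine Integrable.of_bound (hmeas x hx) B ?_
    filter_upwards [ae_restrict_mem measurableSet_Icc] with t ht
    exact hbd t ht _
  have hintv : ∀ x : ℝ → E, Continuous x → ∀ t ∈ Icc 0 S,
      IntervalIntegrable (fun t => R t (x t)) volume 0 t := by
    intro x hx t ht
    rw [intervalIntegrable_iff_integrableOn_Icc_of_le ht.1]
    exact (hint x hx).mono_set (Icc_subset_Icc le_rfl ht.2)
  have hprim : ∀ x : ℝ → E, Continuous x →
      Continuous (fun t => ∫ s in (0 : ℝ)..(τ t), R s (x s)) := by
    intro x hx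
    have h1 := intervalIntegral.continuousOn_primitive_interval (μ := volume)
      (f := fun t => R t (x t)) (a := 0) (b := S) (by rw [uIcc_of_le hS]; exact hint x hx)
    rw [uIcc_of_le hS] at h1
    exact h1.comp_continuous hτc hτm
  have hcurve : ∀ Y : BoundedContinuousFunction ℝ E,
      Continuous fun s : ℝ => Real.exp (l * s) • Y s := fun Y => by
    have := Y.continuous
    fun_prop
  have hex : ∀ t, Real.exp (-(l * τ t)) ≤ 1 := fun t =>
    Real.exp_le_one_iff.2 (neg_nonpos.2 (mul_nonneg hl0.le (hτm t).1))
  let Ψ : BoundedContinuousFunction ℝ E → BoundedContinuousFunction ℝ E := fun Y =>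
    BoundedContinuousFunction.ofNormedAddCommGroup
      (fun t => Real.exp (-(l * τ t)) •
        (x₀ + ∫ s in (0 : ℝ)..(τ t), R s (Real.exp (l * s) • Y s)))
      (by
        have h1 := hprim _ (hcurve Y)
        fun_prop)
      (‖x₀‖ + B * S) (by
        intro t
        rw [norm_smul, Real.norm_of_nonneg (Real.exp_pos _).le]
        have h2 : ‖∫ s in (0 : ℝ)..(τ t), R s (Real.exp (l * s) • Y s)‖ ≤ B * |τ t - 0| := by
          apply intervalIntegral.norm_integral_le_of_norm_le_const
          intro s hs
          rw [uIoc_of_le (hτm t).1] at hs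
          exact hbd s ⟨hs.1.le, hs.2.trans (hτm t).2⟩ _
        rw [sub_zero, abs_of_nonneg (hτm t).1] at h2
        have h3 : B * τ t ≤ B * S := mul_le_mul_of_nonneg_left (hτm t).2 hB
        calc _ ≤ 1 * ‖x₀ + ∫ s in (0 : ℝ)..(τ t), R s (Real.exp (l * s) • Y s)‖ :=
              mul_le_mul_of_nonneg_right (hex t) (norm_nonneg _)
          _ ≤ ‖x₀‖ + B * S := by
              rw [one_mul]
              exact (norm_add_le _ _).trans (by linarith))
  have hΨ : ∀ Y t, Ψ Y t = Real.exp (-(l * τ t)) •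
      (x₀ + ∫ s in (0 : ℝ)..(τ t), R s (Real.exp (l * s) • Y s)) := fun Y t => rfl
  have hcontr : ContractingWith (1 / 2 : NNReal) Ψ := by
    refine ⟨by norm_num, LipschitzWith.of_dist_le_mul fun Y Z => ?_⟩
    have hd0 : 0 ≤ dist Y Z := dist_nonneg
    rw [BoundedContinuousFunction.dist_le (by positivity)]
    intro t
    rw [hΨ, hΨ, dist_eq_norm, ← smul_sub, norm_smul, Real.norm_of_nonneg (Real.exp_pos _).le,
      add_sub_add_left_eq_sub,
      ← intervalIntegral.integral_sub (hintv _ (hcurve Y) _ (hτm t)) (hintv _ (hcurve Z) _ (hτm t))]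
    have h1 : ‖∫ s in (0 : ℝ)..(τ t),
        (R s (Real.exp (l * s) • Y s) - R s (Real.exp (l * s) • Z s))‖ ≤
        ∫ s in (0 : ℝ)..(τ t), (L * dist Y Z) * Real.exp (l * s) := by
      apply intervalIntegral.norm_integral_le_of_norm_le (hτm t).1
      · refine Eventually.of_forall fun s hs => ?_
        refine (hLip s ⟨hs.1.le, hs.2.trans (hτm t).2⟩ _ _).trans ?_
        rw [← smul_sub, norm_smul, Real.norm_of_nonneg (Real.exp_pos _).le, ← dist_eq_norm]
        have h2 := BoundedContinuousFunction.dist_coe_le_dist (f := Y) (g := Z) s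
        have h3 := mul_le_mul_of_nonneg_left h2 (Real.exp_pos (l * s)).le
        have h4 := mul_le_mul_of_nonneg_left h3 hL
        linarith
      · exact (by fun_prop : Continuous fun s : ℝ =>
          (L * dist Y Z) * Real.exp (l * s)).intervalIntegrable _ _
    have h5 : ∫ s in (0 : ℝ)..(τ t), (L * dist Y Z) * Real.exp (l * s) =
        (L * dist Y Z) * ((Real.exp (l * τ t) - 1) / l) := by
      rw [intervalIntegral.integral_const_mul, intervalIntegral.integral_comp_mul_left _ hl0.ne',
        integral_exp]
      simp [div_eq_inv_mul]
    rw [h5] at h1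
    calc _ ≤ Real.exp (-(l * τ t)) * ((L * dist Y Z) * ((Real.exp (l * τ t) - 1) / l)) :=
          mul_le_mul_of_nonneg_left h1 (Real.exp_pos _).le
      _ = (L / l) * dist Y Z * (1 - Real.exp (-(l * τ t))) := by
          have : Real.exp (-(l * τ t)) * Real.exp (l * τ t) = 1 := by
            rw [← Real.exp_add]; simp
          field_simp
          linear_combination (L * dist Y Z) * this
      _ ≤ (L / l) * dist Y Z * 1 := by
          apply mul_le_mul_of_nonneg_left _ (by positivity)
          linarith [Real.exp_pos (-(l * τ t))]
      _ ≤ _ := by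
          rw [mul_one]
          apply mul_le_mul_of_nonneg_right _ hd0
          rw [div_le_iff₀ hl0]
          push_cast
          linarith
  obtain ⟨Y, hY⟩ : ∃ Y, Ψ Y = Y := ⟨_, hcontr.fixedPoint_isFixedPt⟩
  have hx : ∀ t ∈ Icc 0 S, Real.exp (l * t) • Y t =
      x₀ + ∫ s in (0 : ℝ)..t, R s (Real.exp (l * s) • Y s) := by
    intro t ht
    have h1 := hΨ Y t
    rw [hY, hτid t ht] at h1
    conv_lhs => rw [h1]
    rw [smul_smul, ← Real.exp_add]
    simp
  refine ⟨fun t => Real.exp (l * t) • Y t, hcurve Y, ?_, hx⟩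
  have h0 := hx 0 ⟨le_rfl, hS⟩
  simpa using h0

/-- Existence of Carathéodory solutions for a right-hand side that is well-behaved near a set `K`
only: a curve which solves the equation for as long as it remains in `K`. The right-hand side is
cut off outside a neighbourhood of `K`. -/
theorem exists_integral_curve_while_mem {R : ℝ → E → E} {S L B r : ℝ} {K : Set E} (hS : 0 ≤ S)
    (hr : 0 < r) (hL : 0 ≤ L) (hB : 0 ≤ B)
    (hLip : ∀ t ∈ Icc 0 S, ∀ x ∈ Metric.cthickening r K, ∀ y ∈ Metric.cthickening r K,
      ‖R t x - R t y‖ ≤ L * ‖x - y‖)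
    (hbd : ∀ t ∈ Icc 0 S, ∀ x ∈ Metric.cthickening r K, ‖R t x‖ ≤ B)
    (hmeas : ∀ x : ℝ → E, Continuous x → AEStronglyMeasurable (fun t => R t (x t))
      (volume.restrict (Icc 0 S ∩ x ⁻¹' Metric.cthickening r K)))
    (x₀ : E) (hx₀ : x₀ ∈ K) :
    ∃ x : ℝ → E, Continuous x ∧ x 0 = x₀ ∧ ∀ S' ∈ Icc 0 S, (∀ t ∈ Icc 0 S', x t ∈ K) →
      ∀ t ∈ Icc 0 S', x t = x₀ + ∫ s in (0 : ℝ)..t, R s (x s) := by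
  have hKne : K.Nonempty := ⟨x₀, hx₀⟩
  set φ : E → ℝ := fun x => max 0 (1 - Metric.infDist x K / r) with hφ
  have hφ0 : ∀ x, 0 ≤ φ x := fun x => le_max_left _ _
  have hφ1 : ∀ x, φ x ≤ 1 := fun x => max_le zero_le_one (by
    have : 0 ≤ Metric.infDist x K / r := div_nonneg Metric.infDist_nonneg hr.le
    linarith)
  have hφK : ∀ x ∈ K, φ x = 1 := fun x hx => by
    simp [hφ, Metric.infDist_zero_of_mem hx]
  have hφout : ∀ x, x ∉ Metric.cthickening r K → φ x = 0 := by
    intro x hx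
    have h1 : r < Metric.infDist x K := by
      by_contra! hc
      exact hx (Metric.mem_cthickening_iff.2
        ((ENNReal.le_ofReal_iff_toReal_le (Metric.infEDist_ne_top hKne) hr.le).2 hc))
    simp only [hφ]
    apply max_eq_left
    rw [sub_nonpos, le_div_iff₀ hr]
    linarith
  have hφL : ∀ x y, |φ x - φ y| ≤ (1 / r) * ‖x - y‖ := by
    intro x y
    have h1 := abs_max_sub_max_le_abs (1 - Metric.infDist x K / r) (1 - Metric.infDist y K / r) 0
    have h2 := (Metric.lipschitz_infDist_pt K).dist_le_mul x y
    rw [Real.dist_eq, NNReal.coe_one, one_mul, dist_eq_norm] at h2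
    have h3 : |1 - Metric.infDist x K / r - (1 - Metric.infDist y K / r)| =
        (1 / r) * |Metric.infDist x K - Metric.infDist y K| := by
      rw [show 1 - Metric.infDist x K / r - (1 - Metric.infDist y K / r) =
        -((1 / r) * (Metric.infDist x K - Metric.infDist y K)) by ring, abs_neg, abs_mul,
        abs_of_pos (by positivity : 0 < 1 / r)]
    simp only [hφ]
    rw [max_comm 0, max_comm 0]
    rw [h3] at h1
    exact h1.trans (mul_le_mul_of_nonneg_left h2 (by positivity))
  have hφc : Continuous φ := by
    have : Continuous fun x => Metric.infDist x K := Metric.continuous_infDist_pt K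
    fun_prop
  have key : ∀ t ∈ Icc 0 S, ∀ x y, x ∈ Metric.cthickening r K →
      ‖φ x • R t x - φ y • R t y‖ ≤ (L + B / r) * ‖x - y‖ := by
    intro t ht x y hx
    by_cases hy : y ∈ Metric.cthickening r K
    · have e : φ x • R t x - φ y • R t y = (φ x - φ y) • R t x + φ y • (R t x - R t y) := by
        rw [sub_smul, smul_sub]; abel
      rw [e]
      refine (norm_add_le _ _).trans ?_
      rw [norm_smul, norm_smul, Real.norm_eq_abs, Real.norm_of_nonneg (hφ0 y)]
      have h1 : |φ x - φ y| * ‖R t x‖ ≤ ((1 / r) * ‖x - y‖) * B :=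
        mul_le_mul (hφL x y) (hbd t ht x hx) (norm_nonneg _) (by positivity)
      have h2 : φ y * ‖R t x - R t y‖ ≤ 1 * (L * ‖x - y‖) :=
        mul_le_mul (hφ1 y) (hLip t ht x hx y hy) (norm_nonneg _) zero_le_one
      calc _ ≤ ((1 / r) * ‖x - y‖) * B + 1 * (L * ‖x - y‖) := add_le_add h1 h2
        _ = _ := by ring
    · rw [hφout y hy, zero_smul, sub_zero, norm_smul, Real.norm_of_nonneg (hφ0 x)]
      have h3 : φ x ≤ (1 / r) * ‖x - y‖ := by
        have := hφL x y
        rwa [hφout y hy, sub_zero, abs_of_nonneg (hφ0 x)] at this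
      have h1 : φ x * ‖R t x‖ ≤ ((1 / r) * ‖x - y‖) * B :=
        mul_le_mul h3 (hbd t ht x hx) (norm_nonneg _) (by positivity)
      have h4 : 0 ≤ L * ‖x - y‖ := by positivity
      calc _ ≤ ((1 / r) * ‖x - y‖) * B := h1
        _ ≤ (L + B / r) * ‖x - y‖ := by
          rw [add_mul]
          have : ((1 / r) * ‖x - y‖) * B = B / r * ‖x - y‖ := by ring
          linarith
  obtain ⟨x, hxc, hx0, hx⟩ := exists_integral_curve (R := fun t x => φ x • R t x) (S := S)
    (L := L + B / r) (B := B) hS (by positivity) hB (by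
      intro t ht x y
      by_cases hx : x ∈ Metric.cthickening r K
      · exact key t ht x y hx
      · by_cases hy : y ∈ Metric.cthickening r K
        · rw [norm_sub_rev, norm_sub_rev x y]
          exact key t ht y x hy
        · simp only [hφout x hx, hφout y hy, zero_smul, sub_self, norm_zero]
          positivity) (by
      intro t ht x
      rw [norm_smul, Real.norm_of_nonneg (hφ0 x)]
      by_cases hx : x ∈ Metric.cthickening r K
      · calc _ ≤ 1 * ‖R t x‖ := mul_le_mul_of_nonneg_right (hφ1 x) (norm_nonneg _)
          _ ≤ B := by rw [one_mul]; exact hbd t ht x hx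
      · rw [hφout x hx, zero_mul]; exact hB) (by
      intro x hx
      have hm : MeasurableSet (x ⁻¹' Metric.cthickening r K) :=
        (Metric.isClosed_cthickening.preimage hx).measurableSet
      have e : (fun t => φ (x t) • R t (x t)) =
          (x ⁻¹' Metric.cthickening r K).indicator (fun t => φ (x t) • R t (x t)) := by
        ext t
        by_cases ht : t ∈ x ⁻¹' Metric.cthickening r K
        · rw [indicator_of_mem ht]
        · rw [indicator_of_notMem ht, hφout _ ht, zero_smul]
      rw [e, aestronglyMeasurable_indicator_iff hm, Measure.restrict_restrict hm, inter_comm]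
      exact (hφc.comp hx).aestronglyMeasurable.smul (hmeas x hx)) x₀
  refine ⟨x, hxc, hx0, fun S' hS' hK t ht => ?_⟩
  rw [hx t ⟨ht.1, ht.2.trans hS'.2⟩]
  congr 1
  apply intervalIntegral.integral_congr
  intro s hs
  rw [uIcc_of_le ht.1] at hs
  simp only [hφK _ (hK s ⟨hs.1, hs.2.trans ht.2⟩), one_smul]

end Picard

/-! ### Approximate trajectories -/

section ApproxTraj

theorem intervalIntegrable_comp_of_continuousOn {E G : Type*} [NormedAddCommGroup E]
    [NormedAddCommGroup G] {U : Set E} {f : E → G} {S t₁ t₂ : ℝ} {x : ℝ → E}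
    (hf : ContinuousOn f U) (hx : ContinuousOn x (Icc 0 S))
    (hU : ∀ t ∈ Icc 0 S, x t ∈ U) (h1 : 0 ≤ t₁) (h2 : t₁ ≤ t₂) (h3 : t₂ ≤ S) :
    IntervalIntegrable (fun s => f (x s)) volume t₁ t₂ := by
  apply ContinuousOn.intervalIntegrable
  rw [uIcc_of_le h2]
  exact (hf.comp hx hU).mono (Icc_subset_Icc h1 h3)

variable {E : Type*} [NormedAddCommGroup E] [NormedSpace ℝ E]

/-- `x` solves `ẋ = F x` on `[0, S]` inside `U`, up to a disturbance of size at most `D * w x`. The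
disturbance is recorded only through its effect on the increments of `x`, so that no measurability
is involved; for `D = 0` this is the integral equation. -/
structure IsApproxTraj (F : E → E) (w : E → ℝ) (U : Set E) (D S : ℝ) (x : ℝ → E) : Prop where
  nonneg : 0 ≤ S
  continuousOn : ContinuousOn x (Icc 0 S)
  mem : ∀ t ∈ Icc 0 S, x t ∈ U
  norm_le : ∀ t₁ t₂, 0 ≤ t₁ → t₁ ≤ t₂ → t₂ ≤ S →
    ‖x t₂ - x t₁ - ∫ s in t₁..t₂, F (x s)‖ ≤ D * ∫ s in t₁..t₂, w (x s)

variable {F : E → E} {w : E → ℝ} {U : Set E}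

theorem IsApproxTraj.mono {D S S' : ℝ} {x : ℝ → E} (h : IsApproxTraj F w U D S x) (h0 : 0 ≤ S')
    (hS : S' ≤ S) : IsApproxTraj F w U D S' x :=
  ⟨h0, h.continuousOn.mono (Icc_subset_Icc le_rfl hS), fun t ht => h.mem t ⟨ht.1, ht.2.trans hS⟩,
    fun t₁ t₂ h1 h2 h3 => h.norm_le t₁ t₂ h1 h2 (h3.trans hS)⟩

/-- Two approximate trajectories in a region where `F` is Lipschitz stay close together. -/
theorem IsApproxTraj.dist_le {K : Set E} {L : NNReal} {W D D' S : ℝ} {x x' : ℝ → E}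
    (hF : LipschitzOnWith L F K) (hFU : ContinuousOn F U) (hw : ContinuousOn w U)
    (hW : ∀ y ∈ K, w y ≤ W) (hD : 0 ≤ D) (hD' : 0 ≤ D')
    (hx : IsApproxTraj F w U D S x) (hx' : IsApproxTraj F w U D' S x')
    (hK : ∀ t ∈ Icc 0 S, x t ∈ K) (hK' : ∀ t ∈ Icc 0 S, x' t ∈ K) (hW0 : 0 ≤ W) :
    ∀ t ∈ Icc 0 S, ‖x t - x' t‖ ≤ (‖x 0 - x' 0‖ + (D + D') * (W * S)) * Real.exp (L * S) := by
  intro t ht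
  have hA : 0 ≤ ‖x 0 - x' 0‖ + (D + D') * (W * S) := by
    have := hx.nonneg
    positivity
  have hwb : ∀ {y : ℝ → E}, IsApproxTraj F w U D S y ∨ IsApproxTraj F w U D' S y →
      (∀ t ∈ Icc 0 S, y t ∈ K) → ∀ t ∈ Icc 0 S, ∫ s in (0 : ℝ)..t, w (y s) ≤ W * S := by
    intro y hy hyK t ht
    have hyc : ContinuousOn y (Icc 0 S) := by
      rcases hy with h | h <;> exact h.continuousOn
    have hyU : ∀ t ∈ Icc 0 S, y t ∈ U := by
      rcases hy with h | h <;> exact h.mem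
    have h1 : ∫ s in (0 : ℝ)..t, w (y s) ≤ ∫ s in (0 : ℝ)..t, W := by
      apply intervalIntegral.integral_mono_on ht.1
        (intervalIntegrable_comp_of_continuousOn hw hyc hyU le_rfl ht.1 ht.2) (by simp)
      intro s hs
      exact hW _ (hyK s ⟨hs.1, hs.2.trans ht.2⟩)
    rw [intervalIntegral.integral_const, sub_zero, smul_eq_mul] at h1
    nlinarith [mul_le_mul_of_nonneg_right ht.2 hW0]
  have hu : ∀ t ∈ Icc 0 S, ‖x t - x' t‖ ≤ (‖x 0 - x' 0‖ + (D + D') * (W * S)) +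
      L * ∫ s in (0 : ℝ)..t, ‖x s - x' s‖ := by
    intro t ht
    have i1 := intervalIntegrable_comp_of_continuousOn hFU hx.continuousOn hx.mem le_rfl ht.1 ht.2
    have i2 := intervalIntegrable_comp_of_continuousOn hFU hx'.continuousOn hx'.mem le_rfl ht.1 ht.2
    have a1 := hx.norm_le 0 t le_rfl ht.1 ht.2
    have a2 := hx'.norm_le 0 t le_rfl ht.1 ht.2
    have b1 := mul_le_mul_of_nonneg_left (hwb (Or.inl hx) hK t ht) hD
    have b2 := mul_le_mul_of_nonneg_left (hwb (Or.inr hx') hK' t ht) hD'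
    have a3 : ‖∫ s in (0 : ℝ)..t, (F (x s) - F (x' s))‖ ≤
        ∫ s in (0 : ℝ)..t, L * ‖x s - x' s‖ := by
      apply intervalIntegral.norm_integral_le_of_norm_le ht.1
      · refine Eventually.of_forall fun s hs => ?_
        have hs' : s ∈ Icc 0 S := ⟨hs.1.le, hs.2.trans ht.2⟩
        have := hF.dist_le_mul _ (hK s hs') _ (hK' s hs')
        rwa [dist_eq_norm, dist_eq_norm] at this
      · apply ContinuousOn.intervalIntegrable
        rw [uIcc_of_le ht.1]
        exact (continuousOn_const.mul (hx.continuousOn.sub hx'.continuousOn).norm).mono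
          (Icc_subset_Icc le_rfl ht.2)
    rw [intervalIntegral.integral_const_mul, intervalIntegral.integral_sub i1 i2] at a3
    have e : x t - x' t = (x t - x 0 - ∫ s in (0 : ℝ)..t, F (x s)) -
        (x' t - x' 0 - ∫ s in (0 : ℝ)..t, F (x' s)) + (x 0 - x' 0) +
        ((∫ s in (0 : ℝ)..t, F (x s)) - ∫ s in (0 : ℝ)..t, F (x' s)) := by abel
    rw [e]
    refine (norm_add_le _ _).trans ?_
    refine (add_le_add (norm_add_le _ _) a3).trans ?_
    have := norm_sub_le (x t - x 0 - ∫ s in (0 : ℝ)..t, F (x s))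
      (x' t - x' 0 - ∫ s in (0 : ℝ)..t, F (x' s))
    linarith
  have h1 := le_mul_exp_of_le_integral (hx.continuousOn.sub hx'.continuousOn).norm L.coe_nonneg hu
    t ht
  refine h1.trans (mul_le_mul_of_nonneg_left ?_ hA)
  exact Real.exp_le_exp.2 (mul_le_mul_of_nonneg_left ht.2 L.coe_nonneg)

theorem isApproxTraj_zero_of_integral (hFU : ContinuousOn F U) {S : ℝ} {x : ℝ → E} (hS : 0 ≤ S)
    (hx : ContinuousOn x (Icc 0 S)) (hU : ∀ t ∈ Icc 0 S, x t ∈ U)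
    (h : ∀ t ∈ Icc 0 S, x t = x 0 + ∫ s in (0 : ℝ)..t, F (x s)) :
    IsApproxTraj F w U 0 S x := by
  refine ⟨hS, hx, hU, fun t₁ t₂ h1 h2 h3 => ?_⟩
  have i1 := intervalIntegrable_comp_of_continuousOn hFU hx hU le_rfl h1 (h2.trans h3)
  have i2 := intervalIntegrable_comp_of_continuousOn hFU hx hU h1 h2 h3
  rw [h t₁ ⟨h1, h2.trans h3⟩, h t₂ ⟨h1.trans h2, h3⟩,
    ← intervalIntegral.integral_add_adjacent_intervals i1 i2]
  simp

/-- Undisturbed trajectories solve the differential equation in the classical sense. -/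
theorem IsApproxTraj.hasDerivWithinAt [CompleteSpace E] (hFU : ContinuousOn F U) {S : ℝ} {x : ℝ → E}
    (hx : IsApproxTraj F w U 0 S x) {t : ℝ} (ht : t ∈ Icc 0 S) :
    HasDerivWithinAt x (F (x t)) (Icc 0 S) t := by
  have hc : ContinuousOn (fun s => F (x s)) (Icc 0 S) := hFU.comp hx.continuousOn hx.mem
  have e : ∀ s ∈ Icc 0 S, x s = x 0 + ∫ r in (0 : ℝ)..s, F (x r) := by
    intro s hs
    have := hx.norm_le 0 s le_rfl hs.1 hs.2
    rw [zero_mul, norm_le_zero_iff, sub_sub, sub_eq_zero] at this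
    exact this
  have : Fact (t ∈ Icc 0 S) := ⟨ht⟩
  have h1 : HasDerivWithinAt (fun u => ∫ r in (0 : ℝ)..u, F (x r)) (F (x t)) (Icc 0 S) t := by
    apply intervalIntegral.integral_hasDerivWithinAt_right
    · exact intervalIntegrable_comp_of_continuousOn hFU hx.continuousOn hx.mem le_rfl ht.1 ht.2
    · exact hc.stronglyMeasurableAtFilter_nhdsWithin measurableSet_Icc t
    · exact hc t ht
  exact (h1.const_add (x 0)).congr e (e t ht)

variable [FiniteDimensional ℝ E]

/-- Trajectories that start near a reference trajectory stay in a prescribed tube around it, and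
depend in a Lipschitz way on initial state and disturbance. -/
theorem exists_tube (hF : LocallyLipschitzOn U F) (hw : ContinuousOn w U) {S₀ : ℝ}
    {γ : ℝ → E} (hγ : IsApproxTraj F w U 0 S₀ γ) {r : ℝ} (hr : 0 < r)
    (hK : Metric.cthickening r (γ '' Icc 0 S₀) ⊆ U) :
    ∃ C ≥ 1, ∃ ω > 0, ω < r ∧
      (∀ (D S : ℝ) (x : ℝ → E), 0 ≤ D → D ≤ ω → S ≤ S₀ → IsApproxTraj F w U D S x →
        ‖x 0 - γ 0‖ ≤ ω → ∀ t ∈ Icc 0 S, ‖x t - γ t‖ < r) ∧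
      ∀ (D D' S : ℝ) (x x' : ℝ → E), 0 ≤ D → D ≤ ω → 0 ≤ D' → D' ≤ ω → S ≤ S₀ →
        IsApproxTraj F w U D S x → IsApproxTraj F w U D' S x' →
        ‖x 0 - γ 0‖ ≤ ω → ‖x' 0 - γ 0‖ ≤ ω →
        ∀ t ∈ Icc 0 S, ‖x t - x' t‖ ≤ C * (‖x 0 - x' 0‖ + D + D') := by
  have hS₀ := hγ.nonneg
  have hcomp : IsCompact (Metric.cthickening r (γ '' Icc 0 S₀)) :=
    (isCompact_Icc.image_of_continuousOn hγ.continuousOn).cthickening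
  obtain ⟨L, hL⟩ := (hF.mono hK).exists_lipschitzOnWith_of_compact hcomp
  obtain ⟨W₀, hW₀⟩ := (hcomp.image_of_continuousOn (hw.mono hK)).bddAbove
  set W := max W₀ 0
  have hW0 : 0 ≤ W := le_max_right _ _
  have hW : ∀ y ∈ Metric.cthickening r (γ '' Icc 0 S₀), w y ≤ W := fun y hy =>
    (hW₀ (mem_image_of_mem _ hy)).trans (le_max_left _ _)
  set e := Real.exp (L * S₀) with he
  have he1 : 1 ≤ e := Real.one_le_exp (by positivity)
  set C := (1 + W * S₀) * e with hC
  have hWS : 0 ≤ W * S₀ := mul_nonneg hW0 hS₀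
  have hC1 : 1 ≤ C := by nlinarith
  have mem_of : ∀ (S : ℝ) (x : ℝ → E), S ≤ S₀ → ∀ t ∈ Icc 0 S, ‖x t - γ t‖ ≤ r →
      x t ∈ Metric.cthickening r (γ '' Icc 0 S₀) := by
    intro S x hS t ht h
    refine Metric.mem_cthickening_of_dist_le _ (γ t) _ _ ⟨t, ⟨ht.1, ht.2.trans hS⟩, rfl⟩ ?_
    rwa [dist_eq_norm]
  have pair : ∀ (D D' S : ℝ) (x x' : ℝ → E), 0 ≤ D → 0 ≤ D' → S ≤ S₀ →
      IsApproxTraj F w U D S x → IsApproxTraj F w U D' S x' →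
      (∀ t ∈ Icc 0 S, ‖x t - γ t‖ ≤ r) → (∀ t ∈ Icc 0 S, ‖x' t - γ t‖ ≤ r) →
      ∀ t ∈ Icc 0 S, ‖x t - x' t‖ ≤ C * (‖x 0 - x' 0‖ + D + D') := by
    intro D D' S x x' hD hD' hS hx hx' hr1 hr2 t ht
    have h1 := hx.dist_le hL hF.continuousOn hw hW hD hD' hx'
      (fun t ht => mem_of S x hS t ht (hr1 t ht)) (fun t ht => mem_of S x' hS t ht (hr2 t ht)) hW0
      t ht
    have h2 : Real.exp (L * S) ≤ e :=
      Real.exp_le_exp.2 (mul_le_mul_of_nonneg_left hS L.coe_nonneg)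
    have h3 : W * S ≤ W * S₀ := mul_le_mul_of_nonneg_left hS hW0
    have h4 : 0 ≤ ‖x 0 - x' 0‖ := norm_nonneg _
    have h5 : ‖x 0 - x' 0‖ + (D + D') * (W * S) ≤
        (1 + W * S₀) * (‖x 0 - x' 0‖ + D + D') := by
      nlinarith [mul_le_mul_of_nonneg_left h3 (add_nonneg hD hD'), mul_nonneg hWS h4]
    refine h1.trans ?_
    calc _ ≤ ((1 + W * S₀) * (‖x 0 - x' 0‖ + D + D')) * e :=
          mul_le_mul h5 h2 (Real.exp_pos _).le (by positivity)
      _ = _ := by rw [hC]; ring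
  set ω := r / (4 * C) with hω
  have hC0 : 0 < C := by linarith
  have hω0 : 0 < ω := by positivity
  have hωC : C * (2 * ω) = r / 2 := by rw [hω]; field_simp; ring
  have hωr : ω < r := by nlinarith
  have single : ∀ (D S : ℝ) (x : ℝ → E), 0 ≤ D → D ≤ ω → S ≤ S₀ → IsApproxTraj F w U D S x →
      ‖x 0 - γ 0‖ ≤ ω → ∀ t ∈ Icc 0 S, ‖x t - γ t‖ < r := by
    intro D S x hD hDω hS hx h0
    apply lt_of_forall_le_imp_lt (φ := fun t => ‖x t - γ t‖) (hx.continuousOn.sub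
      (hγ.continuousOn.mono (Icc_subset_Icc le_rfl hS))).norm (h0.trans_lt hωr)
    intro t ht hle
    have h1 := pair D 0 t x γ hD le_rfl (ht.2.trans hS) (hx.mono ht.1 ht.2)
      (hγ.mono ht.1 (ht.2.trans hS)) hle (by simp [hr.le]) t ⟨ht.1, le_rfl⟩
    have h2 : C * (‖x 0 - γ 0‖ + D + 0) ≤ C * (2 * ω) :=
      mul_le_mul_of_nonneg_left (by linarith) hC0.le
    linarith
  refine ⟨C, hC1, ω, hω0, hωr, single, ?_⟩
  intro D D' S x x' hD hDω hD' hDω' hS hx hx' h0 h0' t ht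
  exact pair D D' S x x' hD hD' hS hx hx' (fun t ht => (single D S x hD hDω hS hx h0 t ht).le)
    (fun t ht => (single D' S x' hD' hDω' hS hx' h0' t ht).le) t ht

/-- Near an undisturbed trajectory, undisturbed trajectories exist for all initial states. -/
theorem exists_isApproxTraj_zero (hU : IsOpen U) (hF : LocallyLipschitzOn U F)
    (hw : ContinuousOn w U) {S₀ : ℝ} {γ : ℝ → E} (hγ : IsApproxTraj F w U 0 S₀ γ) :
    ∃ ω > 0, ∀ x₀, ‖x₀ - γ 0‖ ≤ ω → ∃ x : ℝ → E, x 0 = x₀ ∧ IsApproxTraj F w U 0 S₀ x := by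
  have hcp : IsCompact (γ '' Icc 0 S₀) := isCompact_Icc.image_of_continuousOn hγ.continuousOn
  obtain ⟨r, hr, hrU⟩ := hcp.exists_cthickening_subset_open hU
    (by rintro _ ⟨t, ht, rfl⟩; exact hγ.mem t ht)
  set K := Metric.cthickening (r / 2) (γ '' Icc 0 S₀) with hKdef
  have hr2 : 0 < r / 2 := by positivity
  have hKK : Metric.cthickening (r / 2) K ⊆ Metric.cthickening r (γ '' Icc 0 S₀) := by
    have := Metric.cthickening_cthickening_subset hr2.le hr2.le (γ '' Icc 0 S₀)
    rwa [add_halves] at this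
  have hKU : K ⊆ U := (Metric.self_subset_cthickening K).trans (hKK.trans hrU)
  have hKcp : IsCompact (Metric.cthickening (r / 2) K) := hcp.cthickening.cthickening
  obtain ⟨L, hL⟩ := (hF.mono (hKK.trans hrU)).exists_lipschitzOnWith_of_compact hKcp
  obtain ⟨B, hB⟩ := hKcp.exists_bound_of_continuousOn (hF.continuousOn.mono (hKK.trans hrU))
  obtain ⟨C, -, ω, hω, hωr, htube, -⟩ := exists_tube hF hw hγ hr2 hKU
  refine ⟨ω, hω, fun x₀ hx₀ => ?_⟩
  have memK : ∀ t ∈ Icc 0 S₀, ∀ y, ‖y - γ t‖ ≤ r / 2 → y ∈ K := by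
    intro t ht y hy
    refine Metric.mem_cthickening_of_dist_le _ (γ t) _ _ ⟨t, ht, rfl⟩ ?_
    rwa [dist_eq_norm]
  obtain ⟨x, hxc, hx0, hx⟩ := exists_integral_curve_while_mem (R := fun _ => F) (S := S₀) (L := L)
    (B := max B 0) hγ.nonneg hr2 L.coe_nonneg (le_max_right _ _)
    (fun t _ x hx y hy => by
      have := hL.dist_le_mul x hx y hy
      rwa [dist_eq_norm, dist_eq_norm] at this)
    (fun t _ x hx => (hB x hx).trans (le_max_left _ _))
    (fun x hx => by
      apply ContinuousOn.aestronglyMeasurable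
      · exact hF.continuousOn.comp hx.continuousOn fun t ht => hrU (hKK ht.2)
      · exact measurableSet_Icc.inter (Metric.isClosed_cthickening.preimage hx).measurableSet)
    x₀ (memK 0 ⟨le_rfl, hγ.nonneg⟩ _ (hx₀.trans hωr.le))
  have traj : ∀ t ∈ Icc 0 S₀, (∀ s ∈ Icc 0 t, ‖x s - γ s‖ ≤ r / 2) →
      IsApproxTraj F w U 0 t x := by
    intro t ht hle
    have hK' : ∀ s ∈ Icc 0 t, x s ∈ K := fun s hs => memK s ⟨hs.1, hs.2.trans ht.2⟩ _ (hle s hs)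
    apply isApproxTraj_zero_of_integral hF.continuousOn ht.1 hxc.continuousOn
      (fun s hs => hKU (hK' s hs))
    rw [hx0]
    exact hx t ht hK'
  have hall : ∀ t ∈ Icc 0 S₀, ‖x t - γ t‖ < r / 2 := by
    apply lt_of_forall_le_imp_lt (φ := fun t => ‖x t - γ t‖)
      (hxc.continuousOn.sub hγ.continuousOn).norm
    · rw [hx0]; exact hx₀.trans_lt hωr
    · intro t ht hle
      exact htube 0 t x le_rfl hω.le ht.2 (traj t ht hle) (by rw [hx0]; exact hx₀) t ⟨ht.1, le_rfl⟩
  exact ⟨x, hx0, traj S₀ ⟨hγ.nonneg, le_rfl⟩ fun s hs => (hall s hs).le⟩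

/-- An undisturbed trajectory in an open set extends beyond its final time. -/
theorem IsApproxTraj.exists_extension (hU : IsOpen U) (hF : LocallyLipschitzOn U F)
    (hw : ContinuousOn w U) {T : ℝ} {γ : ℝ → E} (hγ : IsApproxTraj F w U 0 T γ) :
    ∃ S₀ > T, ∃ γ' : ℝ → E, IsApproxTraj F w U 0 S₀ γ' ∧ EqOn γ' γ (Icc 0 T) := by
  have hT := hγ.nonneg
  have hcp : IsCompact (γ '' Icc 0 T) := isCompact_Icc.image_of_continuousOn hγ.continuousOn
  obtain ⟨r, hr, hrU⟩ := hcp.exists_cthickening_subset_open hU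
    (by rintro _ ⟨t, ht, rfl⟩; exact hγ.mem t ht)
  set K := Metric.cthickening (r / 2) (γ '' Icc 0 T) with hKdef
  have hr2 : 0 < r / 2 := by positivity
  have hKK : Metric.cthickening (r / 2) K ⊆ Metric.cthickening r (γ '' Icc 0 T) := by
    have := Metric.cthickening_cthickening_subset hr2.le hr2.le (γ '' Icc 0 T)
    rwa [add_halves] at this
  have hKU : K ⊆ U := (Metric.self_subset_cthickening K).trans (hKK.trans hrU)
  have hKcp : IsCompact (Metric.cthickening (r / 2) K) := hcp.cthickening.cthickening
  obtain ⟨L, hL⟩ := (hF.mono (hKK.trans hrU)).exists_lipschitzOnWith_of_compact hKcp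
  obtain ⟨B, hB⟩ := hKcp.exists_bound_of_continuousOn (hF.continuousOn.mono (hKK.trans hrU))
  obtain ⟨C, -, ω, hω, hωr, htube, hpair⟩ := exists_tube hF hw hγ hr2 hKU
  have memK : ∀ t ∈ Icc 0 T, ∀ y, ‖y - γ t‖ ≤ r / 2 → y ∈ K := by
    intro t ht y hy
    refine Metric.mem_cthickening_of_dist_le _ (γ t) _ _ ⟨t, ht, rfl⟩ ?_
    rwa [dist_eq_norm]
  obtain ⟨x, hxc, hx0, hx⟩ := exists_integral_curve_while_mem (R := fun _ => F)
    (S := T + 1) (L := L)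
    (B := max B 0) (by linarith) hr2 L.coe_nonneg (le_max_right _ _)
    (fun t _ x hx y hy => by
      have := hL.dist_le_mul x hx y hy
      rwa [dist_eq_norm, dist_eq_norm] at this)
    (fun t _ x hx => (hB x hx).trans (le_max_left _ _))
    (fun x hx => by
      apply ContinuousOn.aestronglyMeasurable
      · exact hF.continuousOn.comp hx.continuousOn fun t ht => hrU (hKK ht.2)
      · exact measurableSet_Icc.inter (Metric.isClosed_cthickening.preimage hx).measurableSet)
    (γ 0) (memK 0 ⟨le_rfl, hT⟩ _ (by simp [hr2.le]))
  have traj : ∀ t ∈ Icc 0 (T + 1), (∀ s ∈ Icc 0 t, x s ∈ K) → IsApproxTraj F w U 0 t x := by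
    intro t ht hK'
    apply isApproxTraj_zero_of_integral hF.continuousOn ht.1 hxc.continuousOn
      (fun s hs => hKU (hK' s hs))
    rw [hx0]
    exact hx t ht hK'
  have hall : ∀ t ∈ Icc 0 T, ‖x t - γ t‖ < r / 2 := by
    apply lt_of_forall_le_imp_lt (φ := fun t => ‖x t - γ t‖)
      (hxc.continuousOn.sub hγ.continuousOn).norm
    · rw [hx0]; simpa using hr2
    · intro t ht hle
      exact htube 0 t x le_rfl hω.le ht.2 (traj t ⟨ht.1, by linarith [ht.2]⟩
        fun s hs => memK s ⟨hs.1, hs.2.trans ht.2⟩ _ (hle s hs)) (by rw [hx0]; simp [hω.le])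
        t ⟨ht.1, le_rfl⟩
  have hKT : ∀ s ∈ Icc 0 T, x s ∈ K := fun s hs => memK s hs _ (hall s hs).le
  have heq : EqOn x γ (Icc 0 T) := by
    intro t ht
    have h1 := hpair 0 0 T x γ le_rfl hω.le le_rfl hω.le le_rfl
      (traj T ⟨hT, by linarith⟩ hKT) hγ (by rw [hx0]; simp [hω.le]) (by simp [hω.le]) t ht
    rw [hx0] at h1
    simp only [sub_self, norm_zero, add_zero, mul_zero, norm_le_zero_iff] at h1
    exact sub_eq_zero.1 h1
  have hnhds : ∀ᶠ s in 𝓝 T, x s ∈ K := by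
    have h1 : Metric.thickening (r / 2) (γ '' Icc 0 T) ∈ 𝓝 (x T) := by
      apply Metric.isOpen_thickening.mem_nhds
      rw [heq ⟨hT, le_rfl⟩]
      exact Metric.self_subset_thickening hr2 _ ⟨T, ⟨hT, le_rfl⟩, rfl⟩
    filter_upwards [hxc.continuousAt h1] with s hs
    exact Metric.thickening_subset_cthickening _ _ hs
  obtain ⟨τ, hτ, hball⟩ := Metric.eventually_nhds_iff.1 hnhds
  set σ := min (τ / 2) 1
  have hσ0 : 0 < σ := lt_min (by positivity) one_pos
  have hσ1 : σ ≤ 1 := min_le_right _ _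
  have hστ : σ ≤ τ / 2 := min_le_left _ _
  refine ⟨T + σ, by linarith, x, traj _ ⟨by linarith, by linarith⟩ ?_, heq⟩
  intro s hs
  rcases le_total s T with h | h
  · exact hKT s ⟨hs.1, h⟩
  · apply hball
    rw [Real.dist_eq, abs_of_nonneg (by linarith)]
    linarith [hs.2]

end ApproxTraj

/-! ### Crossing a guard -/

section Crossing

variable {E : Type*} [NormedAddCommGroup E] [NormedSpace ℝ E]

/-- Near a point `c` where the vector field is transversal to the guard `h = 0`, the guard function,
divided by its rate of change at `c`, increases at least at rate `1 / 2` along all trajectories with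
small disturbance. -/
theorem exists_ball_crossing [CompleteSpace E] {F : E → E} {w : E → ℝ} {U : Set E}
    (hFU : ContinuousOn F U)
    (hw : ContinuousOn w U) (hU : IsOpen U) {h : E → ℝ} {h' : E →L[ℝ] ℝ} {c : E}
    {A : Set E} (hA : A ∈ 𝓝 c) (hcU : c ∈ U) (hh : HasStrictFDerivAt h h' c) (hne : h' (F c) ≠ 0) :
    ∃ r > 0, ∃ ω > 0, ∃ B > 0, Metric.closedBall c r ⊆ A ∧
      (∀ a ∈ Metric.ball c r, ∀ b ∈ Metric.ball c r,
        |h a / h' (F c) - h b / h' (F c)| ≤ B * ‖a - b‖) ∧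
      ∀ (D S : ℝ) (x : ℝ → E), 0 ≤ D → D ≤ ω → IsApproxTraj F w U D S x →
        ∀ t₁ t₂, 0 ≤ t₁ → t₁ ≤ t₂ → t₂ ≤ S → (∀ s ∈ Icc t₁ t₂, x s ∈ Metric.ball c r) →
          (t₂ - t₁) / 2 ≤ h (x t₂) / h' (F c) - h (x t₁) / h' (F c) ∧
          ‖x t₂ - x t₁‖ ≤ B * (t₂ - t₁) := by
  set ψ' : E →L[ℝ] ℝ := (h' (F c))⁻¹ • h' with hψ'
  have hψ : HasStrictFDerivAt (fun y => h y / h' (F c)) ψ' c := by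
    simpa [div_eq_inv_mul] using hh.const_mul (h' (F c))⁻¹
  have hψF : ψ' (F c) = 1 := by simp [hψ', hne]
  set η : ℝ := 1 / (2 * (‖ψ'‖ + ‖F c‖ + 1)) with hη
  have hp : 0 < ‖ψ'‖ + ‖F c‖ + 1 := by positivity
  have hη0 : 0 < η := by positivity
  have hηm : η * (‖ψ'‖ + ‖F c‖ + 1) = 1 / 2 := by rw [hη]; field_simp
  have hη1 : η ≤ 1 := by nlinarith [norm_nonneg ψ', norm_nonneg (F c)]
  obtain ⟨r₀, hr₀, hapx⟩ : ∃ r > 0, ∀ a ∈ Metric.ball c r, ∀ b ∈ Metric.ball c r,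
      ‖h a / h' (F c) - h b / h' (F c) - ψ' (a - b)‖ ≤ η * ‖a - b‖ := by
    have h1 := hψ.isLittleO.def hη0
    rw [nhds_prod_eq, ((Metric.nhds_basis_ball (x := c)).prod_self).eventually_iff] at h1
    obtain ⟨r, hr, h2⟩ := h1
    exact ⟨r, hr, fun a ha b hb => h2 (show (a, b) ∈ _ from ⟨ha, hb⟩)⟩
  have hev : ∀ᶠ y in 𝓝 c, y ∈ A ∧ y ∈ U ∧ ‖F y - F c‖ < η / 2 ∧ w y < w c + 1 := by
    have c1 : ContinuousAt F c := hFU.continuousAt (hU.mem_nhds hcU)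
    have c2 : ContinuousAt w c := hw.continuousAt (hU.mem_nhds hcU)
    have c3 : ∀ᶠ y in 𝓝 c, ‖F y - F c‖ < η / 2 := by
      have := c1 (Metric.ball_mem_nhds (F c) (by positivity : 0 < η / 2))
      filter_upwards [this] with y hy
      rwa [mem_preimage, Metric.mem_ball, dist_eq_norm] at hy
    have c4 : ∀ᶠ y in 𝓝 c, w y < w c + 1 := c2 (Iio_mem_nhds (by linarith))
    filter_upwards [hA, hU.mem_nhds hcU, c3, c4] with y h1 h2 h3 h4
    exact ⟨h1, h2, h3, h4⟩
  obtain ⟨r₁, hr₁, hball⟩ := Metric.eventually_nhds_iff_ball.1 hev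
  set r := min r₀ (r₁ / 2) with hr
  have hr0 : 0 < r := lt_min hr₀ (by positivity)
  have hrr₀ : r ≤ r₀ := min_le_left _ _
  have hrr₁ : r < r₁ := (min_le_right _ _).trans_lt (by linarith)
  set ω := η / (2 * (|w c| + 1)) with hω
  have hω0 : 0 < ω := by positivity
  set B := ‖ψ'‖ + ‖F c‖ + 1 with hB
  refine ⟨r, hr0, ω, hω0, B, hp, ?_, ?_, ?_⟩
  · intro y hy
    exact (hball y (Metric.closedBall_subset_ball hrr₁ hy)).1
  · intro a ha b hb
    have h1 := hapx a (Metric.ball_subset_ball hrr₀ ha) b (Metric.ball_subset_ball hrr₀ hb)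
    have h2 := ψ'.le_opNorm (a - b)
    rw [← Real.norm_eq_abs]
    have h3 := norm_le_norm_add_norm_sub' (h a / h' (F c) - h b / h' (F c)) (ψ' (a - b))
    nlinarith [norm_nonneg (a - b), norm_nonneg (F c)]
  · intro D S x hD hDω hx t₁ t₂ h1 h2 h3 hin
    have hinU : ∀ s ∈ Icc t₁ t₂, x s ∈ Metric.ball c r₁ := fun s hs =>
      Metric.ball_subset_ball hrr₁.le (hin s hs)
    have iF := intervalIntegrable_comp_of_continuousOn hFU hx.continuousOn hx.mem h1 h2 h3
    have iw := intervalIntegrable_comp_of_continuousOn hw hx.continuousOn hx.mem h1 h2 h3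
    have e1 : ‖(∫ s in t₁..t₂, F (x s)) - (t₂ - t₁) • F c‖ ≤ η / 2 * (t₂ - t₁) := by
      rw [← intervalIntegral.integral_const, ← intervalIntegral.integral_sub iF (by simp)]
      have := intervalIntegral.norm_integral_le_of_norm_le_const (a := t₁) (b := t₂) (C := η / 2)
        (f := fun s => F (x s) - F c) (by
          intro s hs
          rw [uIoc_of_le h2] at hs
          exact (hball _ (hinU s ⟨hs.1.le, hs.2⟩)).2.2.1.le)
      rwa [abs_of_nonneg (by linarith)] at this
    have e2 : D * ∫ s in t₁..t₂, w (x s) ≤ η / 2 * (t₂ - t₁) := by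
      have g1 : ∫ s in t₁..t₂, w (x s) ≤ ∫ s in t₁..t₂, (|w c| + 1) := by
        apply intervalIntegral.integral_mono_on h2 iw (by simp)
        intro s hs
        have := (hball _ (hinU s hs)).2.2.2
        linarith [le_abs_self (w c)]
      rw [intervalIntegral.integral_const, smul_eq_mul] at g1
      have g2 : ω * (|w c| + 1) = η / 2 := by rw [hω]; field_simp
      have hw0 : 0 ≤ (t₂ - t₁) * (|w c| + 1) := mul_nonneg (by linarith) (by positivity)
      calc _ ≤ D * ((t₂ - t₁) * (|w c| + 1)) := mul_le_mul_of_nonneg_left g1 hD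
        _ ≤ ω * ((t₂ - t₁) * (|w c| + 1)) := mul_le_mul_of_nonneg_right hDω hw0
        _ = ω * (|w c| + 1) * (t₂ - t₁) := by ring
        _ = _ := by rw [g2]
    have e3 : ‖x t₂ - x t₁ - (t₂ - t₁) • F c‖ ≤ η * (t₂ - t₁) := by
      have e : x t₂ - x t₁ - (t₂ - t₁) • F c = (x t₂ - x t₁ - ∫ s in t₁..t₂, F (x s)) +
        ((∫ s in t₁..t₂, F (x s)) - (t₂ - t₁) • F c) := by abel
      rw [e]
      refine (norm_add_le _ _).trans ?_
      have := hx.norm_le t₁ t₂ h1 h2 h3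
      linarith
    have hd : 0 ≤ t₂ - t₁ := by linarith
    have e4 : ‖x t₂ - x t₁‖ ≤ (‖F c‖ + η) * (t₂ - t₁) := by
      have := norm_le_norm_add_norm_sub' (x t₂ - x t₁) ((t₂ - t₁) • F c)
      rw [norm_smul, Real.norm_of_nonneg hd] at this
      nlinarith
    refine ⟨?_, ?_⟩
    · have k1 := hapx _ (Metric.ball_subset_ball hrr₀ (hin t₂ ⟨h2, le_rfl⟩)) _
        (Metric.ball_subset_ball hrr₀ (hin t₁ ⟨le_rfl, h2⟩))
      have k2 := ψ'.le_opNorm (x t₂ - x t₁ - (t₂ - t₁) • F c)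
      rw [map_sub, map_smul, hψF, smul_eq_mul, mul_one] at k2
      rw [Real.norm_eq_abs] at k1 k2
      have k3 := (abs_le.1 k1).1
      have k4 := (abs_le.1 k2).1
      have k5 : ‖ψ'‖ * ‖x t₂ - x t₁ - (t₂ - t₁) • F c‖ ≤ ‖ψ'‖ * (η * (t₂ - t₁)) :=
        mul_le_mul_of_nonneg_left e3 (norm_nonneg _)
      have k6 : η * ‖x t₂ - x t₁‖ ≤ η * ((‖F c‖ + η) * (t₂ - t₁)) :=
        mul_le_mul_of_nonneg_left e4 hη0.le
      have k7 : ‖ψ'‖ * (η * (t₂ - t₁)) + η * ((‖F c‖ + η) * (t₂ - t₁)) ≤ (t₂ - t₁) / 2 := by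
        have : η * (‖ψ'‖ + ‖F c‖ + η) ≤ 1 / 2 := by
          rw [← hηm]
          exact mul_le_mul_of_nonneg_left (by linarith) hη0.le
        nlinarith
      linarith
    · refine e4.trans (mul_le_mul_of_nonneg_right ?_ hd)
      linarith [norm_nonneg ψ']

variable [FiniteDimensional ℝ E]

/-- The guard `h = 0` in the region `A`, within distance `ρ` of the reference point as measured by
the function `ϑ`. -/
def sectionBall (A : Set E) (h ϑ : E → ℝ) (ρ : ℝ) : Set E := {y | (y ∈ A ∧ h y = 0) ∧ ϑ y < ρ}

/-- The impact map near a trajectory `γ` that meets the guard for the first time, and transversally,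
at time `T₀`: impact times are close to `T₀`, impact points depend in a Lipschitz way on initial
state and disturbance, and a curve meets the guard provided that it is a trajectory for as long as
it stays in a compact tube `K` around `γ` and has not met the guard. -/
theorem exists_impact_estimates {F : E → E} {w : E → ℝ} {U : Set E} (hU : IsOpen U)
    (hF : LocallyLipschitzOn U F) (hw : ContinuousOn w U) {γ : ℝ → E} {S₀ T₀ : ℝ}
    (hγ : IsApproxTraj F w U 0 S₀ γ) (hT₀ : 0 < T₀) (hTS : T₀ < S₀) {A : Set E} (hA : IsOpen A)
    (hAU : A ⊆ U) {h ϑ : E → ℝ} {h' : E →L[ℝ] ℝ} (hhA : ContinuousOn h A)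
    (hcA : γ T₀ ∈ A) (hc0 : h (γ T₀) = 0) (hh : HasStrictFDerivAt h h' (γ T₀))
    (hne : h' (F (γ T₀)) ≠ 0) (hnot : ∀ t ∈ Ico 0 T₀, ¬ (γ t ∈ A ∧ h (γ t) = 0))
    (hϑ : ContinuousOn ϑ U) (hϑ0 : ϑ (γ T₀) = 0)
    (hϑs : ∀ V ∈ 𝓝 (γ T₀), ∃ ρ > 0, ∀ y ∈ U, ϑ y < ρ → y ∈ V) {K : Set E} {rK : ℝ} (hrK : 0 < rK)
    (hK : K = Metric.cthickening rK (γ '' Icc 0 S₀)) (hKU : K ⊆ U) :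
    ∃ ρ₀ > 0, ∀ ρ, 0 < ρ → ρ ≤ ρ₀ → ∀ τ₀ > 0, ∃ C ≥ 1, ∃ ω > 0,
      (∀ (D T : ℝ) (x : ℝ → E), 0 ≤ D → D ≤ ω → ‖x 0 - γ 0‖ ≤ ω →
        IsApproxTraj F w U D T x → (∀ t ∈ Ico 0 T, x t ∉ sectionBall A h ϑ ρ) →
        x T ∈ sectionBall A h ϑ ρ → T₀ - τ₀ < T ∧ T < S₀) ∧
      (∀ (D D' T T' : ℝ) (x x' : ℝ → E), 0 ≤ D → D ≤ ω → ‖x 0 - γ 0‖ ≤ ω →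
        IsApproxTraj F w U D T x → (∀ t ∈ Ico 0 T, x t ∉ sectionBall A h ϑ ρ) →
        x T ∈ sectionBall A h ϑ ρ →
        0 ≤ D' → D' ≤ ω → ‖x' 0 - γ 0‖ ≤ ω →
        IsApproxTraj F w U D' T' x' → (∀ t ∈ Ico 0 T', x' t ∉ sectionBall A h ϑ ρ) →
        x' T' ∈ sectionBall A h ϑ ρ →
        ‖x T - x' T'‖ ≤ C * (‖x 0 - x' 0‖ + D + D')) ∧
      (∀ (D : ℝ) (x : ℝ → E), 0 ≤ D → D ≤ ω → ‖x 0 - γ 0‖ ≤ ω → ContinuousOn x (Icc 0 S₀) →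
        (∀ S ∈ Icc 0 S₀, (∀ t ∈ Icc 0 S, x t ∈ K) →
          (∀ t ∈ Ico 0 S, x t ∉ sectionBall A h ϑ ρ) → IsApproxTraj F w U D S x) →
        ∃ T ∈ Icc 0 S₀, (∀ t ∈ Icc 0 T, x t ∈ K) ∧
          (∀ t ∈ Ico 0 T, x t ∉ sectionBall A h ϑ ρ) ∧ x T ∈ sectionBall A h ϑ ρ) := by
  set c := γ T₀ with hc
  have hS₀ : 0 ≤ S₀ := hγ.nonneg
  have hcU : c ∈ U := hAU hcA
  obtain ⟨r₁, hr₁, ω₁, hω₁, B, hB, hballA, hψL, hcross⟩ :=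
    exists_ball_crossing hF.continuousOn hw hU
    (hA.mem_nhds hcA) hcU hh hne
  set l := h' (F c) with hl
  obtain ⟨ρ₀, hρ₀, hρball⟩ := hϑs _ (Metric.ball_mem_nhds c hr₁)
  refine ⟨ρ₀, hρ₀, fun ρ hρ hρρ₀ τ₀ hτ₀ => ?_⟩
  -- a ball around `c` on which `ϑ < ρ`
  obtain ⟨r₂, hr₂, hr₂₁, hϑr₂⟩ : ∃ r₂ > 0, r₂ ≤ r₁ ∧ ∀ y ∈ Metric.ball c r₂, ϑ y < ρ := by
    have h1 : ∀ᶠ y in 𝓝 c, ϑ y < ρ := by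
      have h2 : ContinuousAt ϑ c := hϑ.continuousAt (hU.mem_nhds hcU)
      exact h2 (by rw [hϑ0]; exact Iio_mem_nhds hρ)
    obtain ⟨r, hr, h2⟩ := Metric.eventually_nhds_iff_ball.1 h1
    exact ⟨min r r₁, lt_min hr hr₁, min_le_right _ _,
      fun y hy => h2 y (Metric.ball_subset_ball (min_le_left _ _) hy)⟩
  -- a time span around `T₀` during which `γ` is close to `c`
  obtain ⟨τ, hτ0, hττ₀, hτT, hτS, hγτ⟩ : ∃ τ > 0, τ ≤ τ₀ ∧ τ < T₀ ∧ T₀ + τ < S₀ ∧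
      ∀ t ∈ Icc (T₀ - τ) (T₀ + τ), ‖γ t - c‖ < r₂ / 2 := by
    have h1 : ∀ᶠ t in 𝓝 T₀, ‖γ t - c‖ < r₂ / 2 := by
      have h2 := (hγ.continuousOn.continuousAt (Icc_mem_nhds hT₀ hTS))
        (Metric.ball_mem_nhds c (by positivity : 0 < r₂ / 2))
      filter_upwards [h2] with t ht
      rwa [mem_preimage, Metric.mem_ball, dist_eq_norm] at ht
    obtain ⟨τ, hτ, h2⟩ := Metric.eventually_nhds_iff.1 h1
    set σ := min (min (τ / 2) τ₀) (min (T₀ / 2) ((S₀ - T₀) / 2))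
    have s1 : σ ≤ τ / 2 := (min_le_left _ _).trans (min_le_left _ _)
    have s2 : σ ≤ τ₀ := (min_le_left _ _).trans (min_le_right _ _)
    have s3 : σ ≤ T₀ / 2 := (min_le_right _ _).trans (min_le_left _ _)
    have s4 : σ ≤ (S₀ - T₀) / 2 := (min_le_right _ _).trans (min_le_right _ _)
    have s0 : 0 < σ := lt_min (lt_min (by positivity) hτ₀) (lt_min (by positivity) (by linarith))
    refine ⟨σ, s0, s2, by linarith, by linarith, fun t ht => h2 ?_⟩
    rw [Real.dist_eq, abs_lt]
    constructor <;> linarith [ht.1, ht.2]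
  -- a tube that does not meet the guard near `c` before `T₀ - τ`
  have hhB : ContinuousOn h (Metric.closedBall c r₁) := hhA.mono hballA
  obtain ⟨r₃, hr₃, hearly⟩ : ∃ r₃ > 0, ∀ t ∈ Icc 0 (T₀ - τ), ∀ y, ‖y - γ t‖ < r₃ →
      ¬ (y ∈ Metric.closedBall c r₁ ∧ h y = 0) := by
    have k1 : IsCompact (γ '' Icc 0 (T₀ - τ)) := isCompact_Icc.image_of_continuousOn
      (hγ.continuousOn.mono (Icc_subset_Icc le_rfl (by linarith)))
    have k2 : IsClosed (Metric.closedBall c r₁ ∩ h ⁻¹' {0}) :=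
      hhB.preimage_isClosed_of_isClosed Metric.isClosed_closedBall isClosed_singleton
    have k3 : Disjoint (γ '' Icc 0 (T₀ - τ)) (Metric.closedBall c r₁ ∩ h ⁻¹' {0}) := by
      rw [Set.disjoint_left]
      rintro _ ⟨t, ht, rfl⟩ ⟨h1, h2⟩
      exact hnot t ⟨ht.1, by linarith [ht.2]⟩ ⟨hballA h1, h2⟩
    obtain ⟨d, hd, hdis⟩ := k3.exists_thickenings k1 k2
    refine ⟨d, hd, fun t ht y hy hyG => ?_⟩
    have hy' : y ∈ Metric.thickening d (γ '' Icc 0 (T₀ - τ)) :=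
      Metric.mem_thickening_iff.2 ⟨γ t, ⟨t, ht, rfl⟩, by rwa [dist_eq_norm]⟩
    exact Set.disjoint_left.1 hdis hy' (Metric.self_subset_thickening hd _ hyG)
  -- the guard function before and after the impact
  have hγball : ∀ t ∈ Icc (T₀ - τ) (T₀ + τ), γ t ∈ Metric.ball c r₁ := fun t ht => by
    rw [Metric.mem_ball, dist_eq_norm]
    linarith [hγτ t ht]
  have hψneg : h (γ (T₀ - τ)) / l < 0 := by
    have := (hcross 0 S₀ γ le_rfl hω₁.le hγ (T₀ - τ) T₀ (by linarith) (by linarith) hTS.le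
      (fun s hs => hγball s ⟨hs.1, by linarith [hs.2]⟩)).1
    rw [hc0, zero_div] at this
    linarith
  have hψpos : 0 < h (γ (T₀ + τ)) / l := by
    have := (hcross 0 S₀ γ le_rfl hω₁.le hγ T₀ (T₀ + τ) hT₀.le (by linarith) hτS.le
      (fun s hs => hγball s ⟨by linarith [hs.1], hs.2⟩)).1
    rw [hc0, zero_div] at this
    linarith
  have hψc : ∀ t ∈ Icc (T₀ - τ) (T₀ + τ), ContinuousAt (fun y => h y / l) (γ t) := fun t ht =>
    (hhA.continuousAt (hA.mem_nhds
      (hballA (Metric.ball_subset_closedBall (hγball t ht))))).div_const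
      l
  obtain ⟨r₄, hr₄, hneg, hpos⟩ : ∃ r₄ > 0, (∀ y, ‖y - γ (T₀ - τ)‖ < r₄ → h y / l < 0) ∧
      ∀ y, ‖y - γ (T₀ + τ)‖ < r₄ → 0 < h y / l := by
    obtain ⟨a, ha, h1⟩ := Metric.eventually_nhds_iff.1
      ((hψc (T₀ - τ) ⟨le_rfl, by linarith⟩) (Iio_mem_nhds hψneg))
    obtain ⟨b, hb, h2⟩ := Metric.eventually_nhds_iff.1
      ((hψc (T₀ + τ) ⟨by linarith, le_rfl⟩) (Ioi_mem_nhds hψpos))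
    refine ⟨min a b, lt_min ha hb, fun y hy => h1 ?_, fun y hy => h2 ?_⟩
    · rw [dist_eq_norm]; exact hy.trans_le (min_le_left _ _)
    · rw [dist_eq_norm]; exact hy.trans_le (min_le_right _ _)
  set r₅ := min (min rK (r₂ / 2)) (min r₃ r₄) with hr₅
  have hr₅0 : 0 < r₅ := lt_min (lt_min hrK (by positivity)) (lt_min hr₃ hr₄)
  have q1 : r₅ ≤ rK := (min_le_left _ _).trans (min_le_left _ _)
  have q2 : r₅ ≤ r₂ / 2 := (min_le_left _ _).trans (min_le_right _ _)
  have q3 : r₅ ≤ r₃ := (min_le_right _ _).trans (min_le_left _ _)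
  have q4 : r₅ ≤ r₄ := (min_le_right _ _).trans (min_le_right _ _)
  obtain ⟨C, hC, ω₂, hω₂, hω₂r, htube, hpair⟩ := exists_tube hF hw hγ hr₅0
    ((Metric.cthickening_mono q1 _).trans (hK ▸ hKU))
  set ω := min ω₁ ω₂
  have hω : 0 < ω := lt_min hω₁ hω₂
  have ho1 : ω ≤ ω₁ := min_le_left _ _
  have ho2 : ω ≤ ω₂ := min_le_right _ _
  -- within the tube
  have near : ∀ t ∈ Icc (T₀ - τ) (T₀ + τ), ∀ y, ‖y - γ t‖ < r₅ → y ∈ Metric.ball c r₂ := by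
    intro t ht y hy
    rw [Metric.mem_ball, dist_eq_norm]
    have := norm_sub_le_norm_sub_add_norm_sub y (γ t) c
    linarith [hγτ t ht]
  have mem_sec : ∀ y, y ∈ Metric.ball c r₂ → h y = 0 → y ∈ sectionBall A h ϑ ρ := fun y hy h0 =>
    ⟨⟨hballA (Metric.ball_subset_closedBall (Metric.ball_subset_ball hr₂₁ hy)), h0⟩, hϑr₂ y hy⟩
  have sec_mem : ∀ y ∈ sectionBall A h ϑ ρ, y ∈ Metric.closedBall c r₁ ∧ h y = 0 := fun y hy =>
    ⟨Metric.ball_subset_closedBall (hρball y (hAU hy.1.1) (hy.2.trans_le hρρ₀)), hy.1.2⟩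
  have hl0 : l ≠ 0 := hne
  -- trajectories in the tube meet the guard between `T₀ - τ` and `T₀ + τ`
  have hit : ∀ (D : ℝ) (x : ℝ → E), 0 ≤ D → D ≤ ω → ‖x 0 - γ 0‖ ≤ ω →
      IsApproxTraj F w U D (T₀ + τ) x →
      ∃ t ∈ Ioo (T₀ - τ) (T₀ + τ), x t ∈ Metric.ball c r₂ ∧ h (x t) = 0 := by
    intro D x hD hDω hx0 hx
    have ht := htube D (T₀ + τ) x hD (hDω.trans ho2) hτS.le hx (hx0.trans ho2)
    have hb : ∀ t ∈ Icc (T₀ - τ) (T₀ + τ), x t ∈ Metric.ball c r₂ := fun t h1 =>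
      near t h1 _ (ht t ⟨by linarith [h1.1], h1.2⟩)
    have hcont : ContinuousOn (fun t => h (x t) / l) (Icc (T₀ - τ) (T₀ + τ)) := by
      refine (hhB.comp (hx.continuousOn.mono (Icc_subset_Icc (by linarith) le_rfl)) ?_).div_const l
      intro t h1
      exact Metric.ball_subset_closedBall (Metric.ball_subset_ball hr₂₁ (hb t h1))
    have v1 := hneg _ ((ht (T₀ - τ) ⟨by linarith, by linarith⟩).trans_le q4)
    have v2 := hpos _ ((ht (T₀ + τ) ⟨by linarith, le_rfl⟩).trans_le q4)
    obtain ⟨t, ht1, ht2⟩ := intermediate_value_Ioo (by linarith) hcont ⟨v1, v2⟩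
    exact ⟨t, ht1, hb t ⟨ht1.1.le, ht1.2.le⟩, by simpa [hl0] using ht2⟩
  have late : ∀ (D T t : ℝ) (x : ℝ → E), 0 ≤ D → D ≤ ω → ‖x 0 - γ 0‖ ≤ ω → T ≤ S₀ →
      IsApproxTraj F w U D T x → t ∈ Icc 0 T → x t ∈ Metric.closedBall c r₁ ∧ h (x t) = 0 →
      T₀ - τ < t := by
    intro D T t x hD hDω hx0 hTS hx ht hxt
    by_contra! hlt
    exact hearly t ⟨ht.1, hlt⟩ (x t) ((htube D T x hD (hDω.trans ho2) hTS hx (hx0.trans ho2) t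
      ht).trans_le q3) hxt
  have times : ∀ (D T : ℝ) (x : ℝ → E), 0 ≤ D → D ≤ ω → ‖x 0 - γ 0‖ ≤ ω →
      IsApproxTraj F w U D T x → (∀ t ∈ Ico 0 T, x t ∉ sectionBall A h ϑ ρ) →
      x T ∈ sectionBall A h ϑ ρ → T₀ - τ < T ∧ T < T₀ + τ := by
    intro D T x hD hDω hx0 hx hno hxT
    have h1 : T < T₀ + τ := by
      by_contra! hge
      obtain ⟨t, ht, hb, h0⟩ := hit D x hD hDω hx0 (hx.mono (by linarith) hge)
      exact hno t ⟨by linarith [ht.1], by linarith [ht.2]⟩ (mem_sec _ hb h0)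
    exact ⟨late D T T x hD hDω hx0 (by linarith) hx ⟨hx.nonneg, le_rfl⟩ (sec_mem _ hxT), h1⟩
  have lip : ∀ (D D' T T' : ℝ) (x x' : ℝ → E), T ≤ T' → 0 ≤ D → D ≤ ω → ‖x 0 - γ 0‖ ≤ ω →
      IsApproxTraj F w U D T x → (∀ t ∈ Ico 0 T, x t ∉ sectionBall A h ϑ ρ) →
      x T ∈ sectionBall A h ϑ ρ →
      0 ≤ D' → D' ≤ ω → ‖x' 0 - γ 0‖ ≤ ω →
      IsApproxTraj F w U D' T' x' → (∀ t ∈ Ico 0 T', x' t ∉ sectionBall A h ϑ ρ) →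
      x' T' ∈ sectionBall A h ϑ ρ →
      ‖x T - x' T'‖ ≤ (1 + 2 * B * B) * C * (‖x 0 - x' 0‖ + D + D') := by
    intro D D' T T' x x' hTT hD hDω hx0 hx hno hxT hD' hDω' hx0' hx' hno' hxT'
    obtain ⟨t1, t2⟩ := times D T x hD hDω hx0 hx hno hxT
    obtain ⟨t1', t2'⟩ := times D' T' x' hD' hDω' hx0' hx' hno' hxT'
    have p1 := hpair D D' T x x' hD (hDω.trans ho2) hD' (hDω'.trans ho2) (by linarith) hx
      (hx'.mono hx.nonneg hTT) (hx0.trans ho2) (hx0'.trans ho2) T ⟨hx.nonneg, le_rfl⟩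
    have tb' := htube D' T' x' hD' (hDω'.trans ho2) (by linarith) hx' (hx0'.trans ho2)
    have tb := htube D T x hD (hDω.trans ho2) (by linarith) hx (hx0.trans ho2)
    have hb' : ∀ s ∈ Icc T T', x' s ∈ Metric.ball c r₁ := fun s hs =>
      Metric.ball_subset_ball hr₂₁ (near s ⟨by linarith [hs.1], by linarith [hs.2]⟩ _
        (tb' s ⟨hx.nonneg.trans hs.1, hs.2⟩))
    have hb : x T ∈ Metric.ball c r₁ := Metric.ball_subset_ball hr₂₁ (near T ⟨t1.le, t2.le⟩ _
        (tb T ⟨hx.nonneg, le_rfl⟩))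
    obtain ⟨c1, c2⟩ := hcross D' T' x' hD' (hDω'.trans ho1) hx' T T' hx.nonneg hTT le_rfl hb'
    have c3 := hψL _ hb _ (hb' T ⟨le_rfl, hTT⟩)
    rw [hxT.1.2, zero_div, zero_sub, abs_neg] at c3
    rw [hxT'.1.2, zero_div, zero_sub] at c1
    have c4 : (T' - T) / 2 ≤ B * ‖x T - x' T‖ := c1.trans ((neg_le_abs _).trans c3)
    have c5 : ‖x' T' - x' T‖ ≤ 2 * B * B * ‖x T - x' T‖ :=
      c2.trans (by nlinarith [mul_le_mul_of_nonneg_left c4 hB.le])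
    have c6 := norm_sub_le_norm_sub_add_norm_sub (x T) (x' T) (x' T')
    rw [norm_sub_rev (x' T) (x' T')] at c6
    calc ‖x T - x' T'‖ ≤ (1 + 2 * B * B) * ‖x T - x' T‖ := by linarith
      _ ≤ (1 + 2 * B * B) * (C * (‖x 0 - x' 0‖ + D + D')) :=
        mul_le_mul_of_nonneg_left p1 (by positivity)
      _ = _ := by ring
  refine ⟨(1 + 2 * B * B) * C, by nlinarith [mul_pos hB hB], ω, hω, ?_, ?_, ?_⟩
  · intro D T x hD hDω hx0 hx hno hxT
    obtain ⟨h1, h2⟩ := times D T x hD hDω hx0 hx hno hxT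
    exact ⟨by linarith, by linarith⟩
  · intro D D' T T' x x' hD hDω hx0 hx hno hxT hD' hDω' hx0' hx' hno' hxT'
    rcases le_total T T' with hTT | hTT
    · exact lip D D' T T' x x' hTT hD hDω hx0 hx hno hxT hD' hDω' hx0' hx' hno' hxT'
    · have := lip D' D T' T x' x hTT hD' hDω' hx0' hx' hno' hxT' hD hDω hx0 hx hno hxT
      rw [norm_sub_rev, norm_sub_rev (x 0)]
      linarith
  · intro D x hD hDω hx0 hxc hxt
    -- as long as the guard has not been met, the curve remains in the tube
    have stay : ∀ S ∈ Icc 0 S₀, (∀ t ∈ Ico 0 S, x t ∉ sectionBall A h ϑ ρ) →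
        (∀ t ∈ Icc 0 S, x t ∈ K) ∧ IsApproxTraj F w U D S x := by
      intro S hS hno
      have memK : ∀ t ∈ Icc 0 S₀, ‖x t - γ t‖ ≤ r₅ → x t ∈ K := by
        intro t ht hle
        rw [hK]
        refine Metric.mem_cthickening_of_dist_le _ (γ t) _ _ ⟨t, ht, rfl⟩ ?_
        rw [dist_eq_norm]
        exact hle.trans q1
      have hlt : ∀ t ∈ Icc 0 S, ‖x t - γ t‖ < r₅ := by
        apply lt_of_forall_le_imp_lt (φ := fun t => ‖x t - γ t‖)
          ((hxc.sub hγ.continuousOn).norm.mono (Icc_subset_Icc le_rfl hS.2))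
          ((hx0.trans ho2).trans_lt hω₂r)
        intro t ht hle
        have hx := hxt t ⟨ht.1, ht.2.trans hS.2⟩
          (fun s hs => memK s ⟨hs.1, hs.2.trans (ht.2.trans hS.2)⟩ (hle s hs))
          (fun s hs => hno s ⟨hs.1, hs.2.trans_le ht.2⟩)
        exact htube D t x hD (hDω.trans ho2) (ht.2.trans hS.2) hx (hx0.trans ho2) t ⟨ht.1, le_rfl⟩
      have hKt : ∀ t ∈ Icc 0 S, x t ∈ K := fun t ht =>
        memK t ⟨ht.1, ht.2.trans hS.2⟩ (hlt t ht).le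
      exact ⟨hKt, hxt S hS hKt hno⟩
    -- the first time on the guard, taken on a compact piece of it
    set G : Set E := Metric.closedBall c r₁ ∩ h ⁻¹' {0} with hG
    have hGcl : IsClosed G := hhB.preimage_isClosed_of_isClosed Metric.isClosed_closedBall
      isClosed_singleton
    have hϑB : ContinuousOn ϑ G := hϑ.mono fun y hy => hAU (hballA hy.1)
    have hGϑ : IsClosed (G ∩ ϑ ⁻¹' Iic ρ) := hϑB.preimage_isClosed_of_isClosed hGcl isClosed_Iic
    have hHcp : IsCompact (Icc 0 S₀ ∩ x ⁻¹' (G ∩ ϑ ⁻¹' Iic ρ)) :=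
      isCompact_Icc.of_isClosed_subset
        (hxc.preimage_isClosed_of_isClosed isClosed_Icc hGϑ) inter_subset_left
    have secG : ∀ y ∈ sectionBall A h ϑ ρ, y ∈ G ∩ ϑ ⁻¹' Iic ρ := fun y hy =>
      ⟨sec_mem y hy, hy.2.le⟩
    have hHne : (Icc 0 S₀ ∩ x ⁻¹' (G ∩ ϑ ⁻¹' Iic ρ)).Nonempty := by
      by_contra hemp
      rw [Set.not_nonempty_iff_eq_empty] at hemp
      have hno : ∀ t ∈ Ico 0 S₀, x t ∉ sectionBall A h ϑ ρ := by
        intro t ht hxt'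
        exact (hemp ▸ (⟨⟨ht.1, ht.2.le⟩, secG _ hxt'⟩ :
          t ∈ Icc 0 S₀ ∩ x ⁻¹' (G ∩ ϑ ⁻¹' Iic ρ)) : t ∈ (∅ : Set ℝ))
      obtain ⟨-, hx⟩ := stay S₀ ⟨hS₀, le_rfl⟩ hno
      obtain ⟨t, ht, hb, h0⟩ := hit D x hD hDω hx0 (hx.mono (by linarith) hτS.le)
      exact hno t ⟨by linarith [ht.1], by linarith [ht.2]⟩ (mem_sec _ hb h0)
    obtain ⟨T, ⟨hT, hxT⟩, hmin⟩ := hHcp.exists_isLeast hHne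
    have hno : ∀ t ∈ Ico 0 T, x t ∉ sectionBall A h ϑ ρ := by
      intro t ht hxt'
      exact absurd (hmin ⟨⟨ht.1, ht.2.le.trans hT.2⟩, secG _ hxt'⟩) (not_le.2 ht.2)
    obtain ⟨hKT, hx⟩ := stay T hT hno
    have l1 : T₀ - τ < T := late D T T x hD hDω hx0 hT.2 hx ⟨hT.1, le_rfl⟩ hxT.1
    have l2 : T ≤ T₀ + τ := by
      by_contra! hgt
      obtain ⟨t, ht, hb, h0⟩ := hit D x hD hDω hx0 (hx.mono (by linarith) hgt.le)
      exact hno t ⟨by linarith [ht.1], by linarith [ht.2]⟩ (mem_sec _ hb h0)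
    refine ⟨T, hT, hKT, hno, mem_sec _ (near T ⟨l1.le, l2⟩ _ ?_) hxT.1.2⟩
    exact htube D T x hD (hDω.trans ho2) hT.2 hx (hx0.trans ho2) T ⟨hT.1, le_rfl⟩

end Crossing

noncomputable section

/-! ### Regularity of the closed loop -/

theorem ContDiffOn.locallyLipschitzOn_of_isOpen {E G : Type*} [NormedAddCommGroup E]
    [NormedSpace ℝ E] [NormedAddCommGroup G] [NormedSpace ℝ G] {f : E → G} {s : Set E}
    (hf : ContDiffOn ℝ 1 f s) (hs : IsOpen s) : LocallyLipschitzOn s f := by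
  intro x hx
  obtain ⟨K, t, ht, hL⟩ := (hf.contDiffAt (hs.mem_nhds hx)).exists_lipschitzOnWith
  exact ⟨K, t, mem_nhdsWithin_of_mem_nhds ht, hL⟩

theorem ContDiffOn.clm_inverse {E F G : Type*} [NormedAddCommGroup E] [NormedSpace ℝ E]
    [NormedAddCommGroup F] [NormedSpace ℝ F] [CompleteSpace F]
    [NormedAddCommGroup G] [NormedSpace ℝ G] {n : WithTop ℕ∞} {A : E → F →L[ℝ] G} {s : Set E}
    (hA : ContDiffOn ℝ n A s) (hinv : ∀ x ∈ s, (A x).IsInvertible) :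
    ContDiffOn ℝ n (fun x => (A x).inverse) s := fun x hx =>
  (hinv x hx).contDiffAt_map_inverse.comp_contDiffWithinAt x (hA x hx)

theorem contDiff_adjoint {a b : ℕ} {n : WithTop ℕ∞} :
    ContDiff ℝ n (fun A : Vec a →L[ℝ] Vec b => ContinuousLinearMap.adjoint A) := by
  have h : IsBoundedLinearMap ℝ
      (fun A : Vec a →L[ℝ] Vec b => ContinuousLinearMap.adjoint A) :=
    { map_add := fun A B => map_add _ A B
      map_smul := fun c A => by simp
      bound := ⟨1, one_pos, fun A => by simp⟩ }
  exact h.contDiff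

namespace Walker

variable {W : Walker}

theorem IsModel.isOpen_QX (hW : W.IsModel) : IsOpen (W.Q ×ˢ (univ : Set (Vec W.n))) :=
  hW.isOpen_Q.prod isOpen_univ

theorem IsModel.isInvertible_D (hW : W.IsModel) {q : Vec W.n} (hq : q ∈ W.Q) :
    (W.D q).IsInvertible := by
  have hinj : Function.Injective (W.D q) := by
    rw [injective_iff_map_eq_zero]
    intro a ha
    by_contra hne
    have := hW.pos_D q hq a hne
    rw [ha, inner_zero_left] at this
    exact lt_irrefl _ this
  refine ⟨(LinearEquiv.ofInjectiveEndo (W.D q : Vec W.n →ₗ[ℝ] Vec W.n)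
    hinj).toContinuousLinearEquiv, ?_⟩
  ext1 x
  rfl

theorem IsModel.contDiffOn_inverse_D (hW : W.IsModel) :
    ContDiffOn ℝ 1 (fun q => (W.D q).inverse) W.Q :=
  hW.contDiffOn_D.clm_inverse fun _ hq => hW.isInvertible_D hq

theorem IsModel.contDiffOn_adjoint_J (hW : W.IsModel) (v : Phase) :
    ContDiffOn ℝ 1 (fun q => ContinuousLinearMap.adjoint (W.J v q)) W.Q :=
  contDiff_adjoint.comp_contDiffOn ((hW.contDiffOn_J v).of_le (by norm_num))

theorem IsModel.contDiffOn_inverse_JDJ (hW : W.IsModel) (v : Phase) :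
    ContDiffOn ℝ 1 (fun q => (W.JDJ v q).inverse) W.Q := by
  apply ContDiffOn.clm_inverse _ (hW.isInvertible_JDJ v)
  exact ((hW.contDiffOn_J v).of_le (by norm_num)).clm_comp
    (hW.contDiffOn_inverse_D.clm_comp (hW.contDiffOn_adjoint_J v))

theorem IsModel.contDiffOn_proj (hW : W.IsModel) (v : Phase) : ContDiffOn ℝ 1 (W.proj v) W.Q := by
  apply contDiffOn_const.sub
  exact (hW.contDiffOn_adjoint_J v).clm_comp ((hW.contDiffOn_inverse_JDJ v).clm_comp
    (((hW.contDiffOn_J v).of_le (by norm_num)).clm_comp hW.contDiffOn_inverse_D))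

theorem contDiffOn_comp_fst {G : Type*} [NormedAddCommGroup G] [NormedSpace ℝ G]
    {n : WithTop ℕ∞} {A : Vec W.n → G} (hA : ContDiffOn ℝ n A W.Q) :
    ContDiffOn ℝ n (fun x : W.X => A x.1) (W.Q ×ˢ univ) :=
  hA.comp contDiff_fst.contDiffOn fun _ hx => hx.1

theorem IsModel.contDiffOn_Lam₂ (hW : W.IsModel) (v : Phase) :
    ContDiffOn ℝ 1 (W.Lam₂ v) (W.Q ×ˢ univ) := by
  have h1 : ContDiffOn ℝ 1 (fderiv ℝ (W.J v)) W.Q :=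
    (hW.contDiffOn_J v).fderiv_of_isOpen hW.isOpen_Q (by norm_num)
  exact (contDiffOn_comp_fst (hW.contDiffOn_inverse_JDJ v)).clm_apply
    (((contDiffOn_comp_fst h1).clm_apply contDiff_snd.contDiffOn).clm_apply
      contDiff_snd.contDiffOn)

theorem IsModel.contDiffOn_f (hW : W.IsModel) (v : Phase) :
    ContDiffOn ℝ 1 (W.f v) (W.Q ×ˢ univ) := by
  refine contDiff_snd.contDiffOn.prodMk (ContDiffOn.neg ?_)
  exact (contDiffOn_comp_fst hW.contDiffOn_inverse_D).clm_apply
    (((contDiffOn_comp_fst (hW.contDiffOn_proj v)).clm_apply hW.contDiffOn_H).add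
      ((contDiffOn_comp_fst (hW.contDiffOn_adjoint_J v)).clm_apply (hW.contDiffOn_Lam₂ v)))

theorem IsModel.contDiffOn_g (hW : W.IsModel) (v : Phase) :
    ContDiffOn ℝ 1 (W.g v) (W.Q ×ˢ univ) := by
  have e : W.g v = fun x => (ContinuousLinearMap.inr ℝ (Vec W.n) (Vec W.n)).comp
      ((W.D x.1).inverse ∘L W.proj v x.1 ∘L W.B v) := by
    funext x
    ext u <;> simp [Walker.g]
  rw [e]
  exact contDiffOn_const.clm_comp ((contDiffOn_comp_fst hW.contDiffOn_inverse_D).clm_comp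
    ((contDiffOn_comp_fst (hW.contDiffOn_proj v)).clm_comp contDiffOn_const))

theorem IsModel.contDiffOn_y₁ (hW : W.IsModel) (v : Phase) :
    ContDiffOn ℝ 2 (W.y₁ v) (W.Q ×ˢ univ) := (hW.contDiffOn_y₁a v).sub contDiffOn_const

/-- The relative degree two outputs as a function of the configuration. -/
def outputConf (W : Walker) (v : Phase) (q : Vec W.n) : Vec (W.k₂ v) :=
  W.y₂a v q - W.y₂d v (W.tau v q)

theorem IsModel.contDiffOn_outputConf (hW : W.IsModel) (v : Phase) :
    ContDiffOn ℝ 3 (W.outputConf v) W.Q :=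
  (hW.contDiffOn_y₂a v).sub ((hW.contDiff_y₂d v).comp_contDiffOn (hW.contDiffOn_tau v))

theorem IsModel.contDiffOn_y₂ (hW : W.IsModel) (v : Phase) :
    ContDiffOn ℝ 3 (W.y₂ v) (W.Q ×ˢ univ) :=
  contDiffOn_comp_fst (hW.contDiffOn_outputConf v)

theorem IsModel.fderiv_y₂ (hW : W.IsModel) (v : Phase) {x : W.X} (hx : x ∈ W.Q ×ˢ univ)
    (ξ : W.X) : fderiv ℝ (W.y₂ v) x ξ = fderiv ℝ (W.outputConf v) x.1 ξ.1 := by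
  have h1 : DifferentiableAt ℝ (W.outputConf v) x.1 :=
    ((hW.contDiffOn_outputConf v).contDiffAt (hW.isOpen_Q.mem_nhds hx.1)).differentiableAt
      (by norm_num)
  have h2 : HasFDerivAt (W.y₂ v) ((fderiv ℝ (W.outputConf v) x.1).comp
      (ContinuousLinearMap.fst ℝ (Vec W.n) (Vec W.n))) x :=
    HasFDerivAt.comp x h1.hasFDerivAt (hasFDerivAt_fst)
  rw [h2.fderiv]
  rfl

theorem IsModel.Lfy₂_eq (hW : W.IsModel) (v : Phase) {x : W.X} (hx : x ∈ W.Q ×ˢ univ) :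
    W.Lfy₂ v x = fderiv ℝ (W.outputConf v) x.1 x.2 := hW.fderiv_y₂ v hx _

theorem IsModel.contDiffOn_Lfy₂ (hW : W.IsModel) (v : Phase) :
    ContDiffOn ℝ 2 (W.Lfy₂ v) (W.Q ×ˢ univ) := by
  have h1 : ContDiffOn ℝ 2 (fderiv ℝ (W.outputConf v)) W.Q :=
    (hW.contDiffOn_outputConf v).fderiv_of_isOpen hW.isOpen_Q (by norm_num)
  exact ((contDiffOn_comp_fst h1).clm_apply contDiff_snd.contDiffOn).congr
    fun x hx => hW.Lfy₂_eq v hx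

theorem IsModel.contDiffOn_decoupling (hW : W.IsModel) (v : Phase) :
    ContDiffOn ℝ 1 (W.decoupling v) (W.Q ×ˢ univ) := by
  have h1 : ContDiffOn ℝ 1 (fderiv ℝ (W.y₁ v)) (W.Q ×ˢ univ) :=
    (hW.contDiffOn_y₁ v).fderiv_of_isOpen hW.isOpen_QX (by norm_num)
  have h2 : ContDiffOn ℝ 1 (fderiv ℝ (W.Lfy₂ v)) (W.Q ×ˢ univ) :=
    (hW.contDiffOn_Lfy₂ v).fderiv_of_isOpen hW.isOpen_QX (by norm_num)
  have e : W.decoupling v = fun x =>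
      (ContinuousLinearMap.inl ℝ (Vec (W.k₁ v)) (Vec (W.k₂ v))).comp
        (fderiv ℝ (W.y₁ v) x ∘L W.g v x) +
      (ContinuousLinearMap.inr ℝ (Vec (W.k₁ v)) (Vec (W.k₂ v))).comp
        (fderiv ℝ (W.Lfy₂ v) x ∘L W.g v x) := by
    funext x
    ext u <;> simp [Walker.decoupling]
  rw [e]
  exact (contDiffOn_const.clm_comp (h1.clm_comp (hW.contDiffOn_g v))).add
    (contDiffOn_const.clm_comp (h2.clm_comp (hW.contDiffOn_g v)))

theorem IsModel.contDiffOn_uFL (hW : W.IsModel) (ε : ℝ) (v : Phase) :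
    ContDiffOn ℝ 1 (W.uFL ε v) (W.dom v) := by
  have hs := hW.dom_subset v
  have h1 : ContDiffOn ℝ 1 (fderiv ℝ (W.y₁ v)) (W.Q ×ˢ univ) :=
    (hW.contDiffOn_y₁ v).fderiv_of_isOpen hW.isOpen_QX (by norm_num)
  have h2 : ContDiffOn ℝ 1 (fderiv ℝ (W.Lfy₂ v)) (W.Q ×ˢ univ) :=
    (hW.contDiffOn_Lfy₂ v).fderiv_of_isOpen hW.isOpen_QX (by norm_num)
  have h3 : ContDiffOn ℝ 1 (W.Lfy₁ v) (W.Q ×ˢ univ) := h1.clm_apply (hW.contDiffOn_f v)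
  have h4 : ContDiffOn ℝ 1 (W.Lffy₂ v) (W.Q ×ˢ univ) := h2.clm_apply (hW.contDiffOn_f v)
  have h5 : ContDiffOn ℝ 1 (W.y₁ v) (W.Q ×ˢ univ) := (hW.contDiffOn_y₁ v).of_le (by norm_num)
  have h6 : ContDiffOn ℝ 1 (W.y₂ v) (W.Q ×ˢ univ) := (hW.contDiffOn_y₂ v).of_le (by norm_num)
  have h7 : ContDiffOn ℝ 1 (W.Lfy₂ v) (W.Q ×ˢ univ) := (hW.contDiffOn_Lfy₂ v).of_le (by norm_num)
  have h8 : ContDiffOn ℝ 1 (fun x => - (W.Lfy₁ v x, W.Lffy₂ v x)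
      - (ε • W.y₁ v x, (2 * ε) • W.Lfy₂ v x + ε ^ 2 • W.y₂ v x)) (W.Q ×ˢ univ) :=
    (h3.prodMk h4).neg.sub
      ((h5.const_smul ε).prodMk ((h7.const_smul (2 * ε)).add (h6.const_smul (ε ^ 2))))
  exact (((hW.contDiffOn_decoupling v).mono hs).clm_inverse
    (hW.isInvertible_decoupling v)).clm_apply (h8.mono hs)

/-- The undisturbed closed loop vector field. -/
def closedLoop (W : Walker) (ε : ℝ) (v : Phase) (x : W.X) : W.X :=
  W.f v x + W.g v x (W.uFL ε v x)

theorem IsModel.contDiffOn_closedLoop (hW : W.IsModel) (ε : ℝ) (v : Phase) :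
    ContDiffOn ℝ 1 (W.closedLoop ε v) (W.dom v) :=
  ((hW.contDiffOn_f v).mono (hW.dom_subset v)).add
    (((hW.contDiffOn_g v).mono (hW.dom_subset v)).clm_apply (hW.contDiffOn_uFL ε v))

theorem IsModel.contDiffOn_eta₂ (hW : W.IsModel) (v : Phase) :
    ContDiffOn ℝ 1 (W.eta₂ v) (W.dom v) :=
  (((hW.contDiffOn_y₂ v).of_le (by norm_num)).prodMk
    ((hW.contDiffOn_Lfy₂ v).of_le (by norm_num))).mono (hW.dom_subset v)

theorem IsModel.contDiffOn_Phi (hW : W.IsModel) (v : Phase) :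
    ContDiffOn ℝ 1 (W.Phi v) (W.dom v) :=
  (((hW.contDiffOn_y₁ v).of_le (by norm_num)).prodMk
    (((hW.contDiffOn_y₂ v).of_le (by norm_num)).prodMk
      (((hW.contDiffOn_Lfy₂ v).of_le (by norm_num)).prodMk
        ((hW.contDiffOn_z v).of_le (by norm_num))))).mono (hW.dom_subset v)

/-- The relative degree two outputs do not see the input at first order: `Lfy₂` is `ẏ₂`. -/
theorem IsModel.fderiv_y₂_closedLoop (hW : W.IsModel) (ε : ℝ) (v : Phase) {x : W.X}
    (hx : x ∈ W.dom v) : fderiv ℝ (W.y₂ v) x (W.closedLoop ε v x) = W.Lfy₂ v x := by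
  rw [hW.fderiv_y₂ v (hW.dom_subset v hx), hW.Lfy₂_eq v (hW.dom_subset v hx)]
  simp [closedLoop, Walker.f, Walker.g]

/-- Feedback linearization: under the control law `uFL`, the relative degree two outputs obey
`ÿ₂ = -2 ε ẏ₂ - ε² y₂`. -/
theorem IsModel.fderiv_Lfy₂_closedLoop (hW : W.IsModel) (ε : ℝ) (v : Phase) {x : W.X}
    (hx : x ∈ W.dom v) : fderiv ℝ (W.Lfy₂ v) x (W.closedLoop ε v x) =
      -((2 * ε) • W.Lfy₂ v x + ε ^ 2 • W.y₂ v x) := by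
  have h1 : W.decoupling v x (W.uFL ε v x) = - (W.Lfy₁ v x, W.Lffy₂ v x)
      - (ε • W.y₁ v x, (2 * ε) • W.Lfy₂ v x + ε ^ 2 • W.y₂ v x) :=
    (hW.isInvertible_decoupling v x hx).self_apply_inverse _
  have h2 := congrArg Prod.snd h1
  have h3 : (W.decoupling v x (W.uFL ε v x)).2 =
      fderiv ℝ (W.Lfy₂ v) x (W.g v x (W.uFL ε v x)) := rfl
  rw [h3] at h2
  rw [closedLoop, map_add, h2]
  simp only [Prod.snd_sub, Prod.snd_neg]
  change W.Lffy₂ v x + _ = _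
  abel

end Walker

end

noncomputable section

namespace Walker

variable {W : Walker}

/-! ### The coordinates `(η, z)` -/

theorem coordNorm_nonneg {v : Phase} (p : W.Coord v) : 0 ≤ W.coordNorm p := Real.sqrt_nonneg _

theorem norm_le_coordNorm {v : Phase} (p : W.Coord v) : ‖p‖ ≤ W.coordNorm p := by
  simp only [Prod.norm_def, coordNorm]
  refine max_le ?_ (max_le ?_ (max_le ?_ ?_)) <;>
  · apply Real.le_sqrt_of_sq_le
    nlinarith [sq_nonneg ‖p.1‖, sq_nonneg ‖p.2.1‖, sq_nonneg ‖p.2.2.1‖, sq_nonneg ‖p.2.2.2‖]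

theorem coordNorm_le {v : Phase} (p : W.Coord v) : W.coordNorm p ≤ 2 * ‖p‖ := by
  have h1 : ‖p.1‖ ≤ ‖p‖ := norm_fst_le p
  have h2 : ‖p.2.1‖ ≤ ‖p‖ := (norm_fst_le p.2).trans (norm_snd_le p)
  have h3 : ‖p.2.2.1‖ ≤ ‖p‖ := (norm_fst_le p.2.2).trans ((norm_snd_le p.2).trans (norm_snd_le p))
  have h4 : ‖p.2.2.2‖ ≤ ‖p‖ := (norm_snd_le p.2.2).trans ((norm_snd_le p.2).trans (norm_snd_le p))
  apply Real.sqrt_le_iff.2 ⟨by positivity, ?_⟩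
  have := norm_nonneg p.1
  have := norm_nonneg p.2.1
  have := norm_nonneg p.2.2.1
  have := norm_nonneg p.2.2.2
  nlinarith

theorem continuous_coordNorm {v : Phase} : Continuous (W.coordNorm (v := v)) := by
  unfold coordNorm
  fun_prop

theorem IsModel.continuousOn_cdist (hW : W.IsModel) (v : Phase) (c : W.X) :
    ContinuousOn (fun x => W.cdist v x c) (W.dom v) :=
  continuous_coordNorm.comp_continuousOn
    ((hW.contDiffOn_Phi v).continuousOn.sub continuousOn_const)

theorem cdist_self (v : Phase) (c : W.X) : W.cdist v c c = 0 := by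
  simp [cdist, coordNorm]

theorem IsModel.hasStrictFDerivAt_Phi (hW : W.IsModel) (v : Phase) {c : W.X} (hc : c ∈ W.dom v) :
    HasStrictFDerivAt (W.Phi v) (fderiv ℝ (W.Phi v) c) c :=
  ((hW.contDiffOn_Phi v).contDiffAt ((hW.isOpen_dom v).mem_nhds hc)).hasStrictFDerivAt (by norm_num)

/-- `Φ` is locally onto: nearby coordinates are those of nearby states. -/
theorem IsModel.exists_Phi_eq (hW : W.IsModel) (v : Phase) {c : W.X} (hc : c ∈ W.dom v)
    {V : Set W.X} (hV : V ∈ 𝓝 c) :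
    ∃ ρ > 0, ∀ p : W.Coord v, W.coordNorm (p - W.Phi v c) < ρ →
      ∃ x ∈ V, x ∈ W.dom v ∧ W.Phi v x = p := by
  obtain ⟨M, hM⟩ := hW.isInvertible_Phi v c hc
  have hs := hW.hasStrictFDerivAt_Phi v hc
  rw [← hM] at hs
  have h1 : W.Phi v '' (V ∩ W.dom v) ∈ 𝓝 (W.Phi v c) := by
    rw [← hs.map_nhds_eq_of_equiv]
    exact image_mem_map (inter_mem hV ((hW.isOpen_dom v).mem_nhds hc))
  obtain ⟨ρ, hρ, hball⟩ := Metric.mem_nhds_iff.1 h1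
  refine ⟨ρ, hρ, fun p hp => ?_⟩
  obtain ⟨x, hx, hxp⟩ := hball (show p ∈ Metric.ball (W.Phi v c) ρ by
    rw [Metric.mem_ball, dist_eq_norm]
    exact (norm_le_coordNorm _).trans_lt hp)
  exact ⟨x, hx.1, hx.2, hxp⟩

/-- States whose coordinates are close are close, wherever in the domain they lie. -/
theorem IsModel.exists_mem_of_cdist_lt (hW : W.IsModel) (v : Phase) {c : W.X} (hc : c ∈ W.dom v)
    {V : Set W.X} (hV : V ∈ 𝓝 c) : ∃ ρ > 0, ∀ y ∈ W.dom v, W.cdist v y c < ρ → y ∈ V := by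
  obtain ⟨ρ, hρ, h⟩ := hW.exists_Phi_eq v hc hV
  refine ⟨ρ, hρ, fun y hy hyc => ?_⟩
  obtain ⟨x, hxV, hx, hxy⟩ := h _ hyc
  rwa [← hW.injOn_Phi v hx hy hxy]

/-- Near a given state, the distance in the coordinates `(η, z)` is equivalent to the norm. -/
theorem IsModel.exists_cdist_equiv (hW : W.IsModel) (v : Phase) {c : W.X} (hc : c ∈ W.dom v) :
    ∃ C ≥ 1, ∃ r > 0, Metric.ball c r ⊆ W.dom v ∧ ∀ a ∈ Metric.ball c r, ∀ b ∈ Metric.ball c r,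
      W.cdist v a b ≤ C * ‖a - b‖ ∧ ‖a - b‖ ≤ C * W.cdist v a b := by
  obtain ⟨M, hM⟩ := hW.isInvertible_Phi v c hc
  have hs := hW.hasStrictFDerivAt_Phi v hc
  obtain ⟨K₁, s₁, hs₁, hL₁⟩ := hs.exists_lipschitzOnWith
  rw [← hM] at hs
  obtain ⟨K₂, s₂, hs₂, hL₂⟩ := hs.to_localInverse.exists_lipschitzOnWith
  have h1 : ∀ᶠ x in 𝓝 c, hs.localInverse (W.Phi v) M c (W.Phi v x) = x :=
    hs.eventually_left_inverse
  have h2 : ∀ᶠ x in 𝓝 c, W.Phi v x ∈ s₂ := hs.continuousAt hs₂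
  obtain ⟨r, hr, hball⟩ := Metric.mem_nhds_iff.1
    (inter_mem (inter_mem hs₁ ((hW.isOpen_dom v).mem_nhds hc)) (inter_mem h1 h2))
  refine ⟨1 + 2 * K₁ + K₂, ?_, r, hr, fun x hx => (hball hx).1.2, fun a ha b hb => ⟨?_, ?_⟩⟩
  · have := K₁.coe_nonneg
    have := K₂.coe_nonneg
    linarith
  · have h3 := hL₁.dist_le_mul a (hball ha).1.1 b (hball hb).1.1
    rw [dist_eq_norm, dist_eq_norm] at h3
    have h4 := coordNorm_le (W.Phi v a - W.Phi v b)
    have h5 := norm_nonneg (a - b)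
    have h6 := K₂.coe_nonneg
    rw [cdist]
    nlinarith
  · have h3 := hL₂.dist_le_mul _ (hball ha).2.2 _ (hball hb).2.2
    have e1 : hs.localInverse (W.Phi v) M c (W.Phi v a) = a := (hball ha).2.1
    have e2 : hs.localInverse (W.Phi v) M c (W.Phi v b) = b := (hball hb).2.1
    rw [e1, e2, dist_eq_norm, dist_eq_norm] at h3
    have h4 := norm_le_coordNorm (W.Phi v a - W.Phi v b)
    have h5 := K₁.coe_nonneg
    have h6 := K₂.coe_nonneg
    have h7 : 0 ≤ W.cdist v a b := coordNorm_nonneg _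
    rw [cdist] at h7 ⊢
    nlinarith [mul_le_mul_of_nonneg_left h4 h6]

/-! ### Decay of the transverse coordinates -/

/-- Along the undisturbed closed loop, the transverse coordinates contract at the rate `ε`, with an
overshoot that is polynomial in `ε`. -/
theorem IsModel.norm_eta₂_le (hW : W.IsModel) {ε : ℝ} (hε : 0 ≤ ε) (v : Phase) {w : W.X → ℝ}
    {S : ℝ} {x : ℝ → W.X} (hx : IsApproxTraj (W.closedLoop ε v) w (W.dom v) 0 S x) {t : ℝ}
    (ht : t ∈ Icc 0 S) :
    ‖W.eta₂ v (x t)‖ ≤ Real.exp (-(ε * t)) * (1 + t * (1 + ε) ^ 2) * ‖W.eta₂ v (x 0)‖ := by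
  have hFc := (hW.contDiffOn_closedLoop ε v).continuousOn
  have hy : ∀ s ∈ Icc 0 S,
      HasDerivWithinAt (fun s => W.y₂ v (x s)) (W.Lfy₂ v (x s)) (Icc 0 S) s := by
    intro s hs
    have h1 : HasFDerivAt (W.y₂ v) (fderiv ℝ (W.y₂ v) (x s)) (x s) :=
      (((hW.contDiffOn_y₂ v).contDiffAt
        (hW.isOpen_QX.mem_nhds (hW.dom_subset v (hx.mem s hs)))).differentiableAt
        (by norm_num)).hasFDerivAt
    have h2 := h1.comp_hasDerivWithinAt s (hx.hasDerivWithinAt hFc hs)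
    rwa [hW.fderiv_y₂_closedLoop ε v (hx.mem s hs)] at h2
  have hp : ∀ s ∈ Icc 0 S, HasDerivWithinAt (fun s => W.Lfy₂ v (x s))
      (-((2 * ε) • W.Lfy₂ v (x s) + ε ^ 2 • W.y₂ v (x s))) (Icc 0 S) s := by
    intro s hs
    have h1 : HasFDerivAt (W.Lfy₂ v) (fderiv ℝ (W.Lfy₂ v) (x s)) (x s) :=
      (((hW.contDiffOn_Lfy₂ v).contDiffAt
        (hW.isOpen_QX.mem_nhds (hW.dom_subset v (hx.mem s hs)))).differentiableAt
        (by norm_num)).hasFDerivAt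
    have h2 := h1.comp_hasDerivWithinAt s (hx.hasDerivWithinAt hFc hs)
    rwa [hW.fderiv_Lfy₂_closedLoop ε v (hx.mem s hs)] at h2
  have hexp : ∀ s : ℝ, HasDerivWithinAt (fun s : ℝ => Real.exp (ε * s)) (ε * Real.exp (ε * s))
      (Icc 0 S) s := by
    intro s
    have h1 : HasDerivAt (fun s : ℝ => Real.exp (ε * s)) (Real.exp (ε * s) * (ε * 1)) s :=
      ((hasDerivAt_id s).const_mul ε).exp
    rw [mul_one, mul_comm] at h1
    exact h1.hasDerivWithinAt
  have const : ∀ q : ℝ → Vec (W.k₂ v), (∀ s ∈ Icc 0 S, HasDerivWithinAt q 0 (Icc 0 S) s) →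
      ∀ s ∈ Icc 0 S, q s = q 0 := by
    intro q hq
    apply constant_of_has_deriv_right_zero (fun s hs => (hq s hs).continuousWithinAt)
    intro s hs
    exact (hq s ⟨hs.1, hs.2.le⟩).mono_of_mem_nhdsWithin
      (mem_of_superset (Icc_mem_nhdsGE hs.2) (Icc_subset_Icc hs.1 le_rfl))
  set y₀ := W.y₂ v (x 0)
  set p₀ := W.Lfy₂ v (x 0)
  -- `exp (ε t) (ẏ₂ + ε y₂)` is constant
  have c1 : ∀ s ∈ Icc 0 S, Real.exp (ε * s) • (W.Lfy₂ v (x s) + ε • W.y₂ v (x s)) =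
      p₀ + ε • y₀ := by
    intro s hs
    have := const (fun s => Real.exp (ε * s) • (W.Lfy₂ v (x s) + ε • W.y₂ v (x s))) (by
      intro s hs
      refine ((hexp s).smul ((hp s hs).add ((hy s hs).const_smul ε))).congr_deriv ?_
      simp only [Pi.add_apply, Pi.smul_apply]
      module) s hs
    simpa using this
  -- hence so is `exp (ε t) y₂ - t (ẏ₂(0) + ε y₂(0))`
  have c2 : ∀ s ∈ Icc 0 S, Real.exp (ε * s) • W.y₂ v (x s) - s • (p₀ + ε • y₀) = y₀ := by
    intro s hs
    have := const (fun s => Real.exp (ε * s) • W.y₂ v (x s) - s • (p₀ + ε • y₀)) (by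
      intro s hs
      refine (((hexp s).smul (hy s hs)).sub
        ((hasDerivWithinAt_id s (Icc 0 S)).smul_const (p₀ + ε • y₀))).congr_deriv ?_
      rw [← c1 s hs]
      module) s hs
    simpa using this
  have hE : Real.exp (-(ε * t)) * Real.exp (ε * t) = 1 := by rw [← Real.exp_add]; simp
  have e1 : W.y₂ v (x t) = Real.exp (-(ε * t)) • (y₀ + t • (p₀ + ε • y₀)) := by
    rw [← sub_eq_iff_eq_add.1 (c2 t ht), smul_smul, hE, one_smul]
  have e2 : W.Lfy₂ v (x t) = Real.exp (-(ε * t)) • (p₀ - (ε * t) • (p₀ + ε • y₀)) := by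
    have h1 : W.Lfy₂ v (x t) + ε • W.y₂ v (x t) = Real.exp (-(ε * t)) • (p₀ + ε • y₀) := by
      rw [← c1 t ht, smul_smul, hE, one_smul]
    rw [eq_sub_of_add_eq h1, e1]
    module
  set n := ‖W.eta₂ v (x 0)‖
  have hn : 0 ≤ n := norm_nonneg _
  have n1 : ‖y₀‖ ≤ n := norm_fst_le (W.eta₂ v (x 0))
  have n2 : ‖p₀‖ ≤ n := norm_snd_le (W.eta₂ v (x 0))
  have n3 : ‖p₀ + ε • y₀‖ ≤ (1 + ε) * n := by
    refine (norm_add_le _ _).trans ?_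
    rw [norm_smul, Real.norm_of_nonneg hε]
    nlinarith
  have ht0 := ht.1
  have b1 : ‖y₀ + t • (p₀ + ε • y₀)‖ ≤ (1 + t * (1 + ε) ^ 2) * n := by
    refine (norm_add_le _ _).trans ?_
    rw [norm_smul, Real.norm_of_nonneg ht0]
    have := mul_le_mul_of_nonneg_left n3 ht0
    have h2 : 0 ≤ t * n * (ε + ε ^ 2) := by positivity
    nlinarith
  have b2 : ‖p₀ - (ε * t) • (p₀ + ε • y₀)‖ ≤ (1 + t * (1 + ε) ^ 2) * n := by
    refine (norm_sub_le _ _).trans ?_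
    rw [norm_smul, Real.norm_of_nonneg (by positivity)]
    have := mul_le_mul_of_nonneg_left n3 (by positivity : 0 ≤ ε * t)
    have h2 : 0 ≤ t * n * (1 + ε) := by positivity
    nlinarith
  rw [mul_assoc]
  refine max_le ?_ ?_
  · change ‖W.y₂ v (x t)‖ ≤ _
    rw [e1, norm_smul, Real.norm_of_nonneg (Real.exp_pos _).le]
    exact mul_le_mul_of_nonneg_left b1 (Real.exp_pos _).le
  · change ‖W.Lfy₂ v (x t)‖ ≤ _
    rw [e2, norm_smul, Real.norm_of_nonneg (Real.exp_pos _).le]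
    exact mul_le_mul_of_nonneg_left b2 (Real.exp_pos _).le

/-- A high gain makes the transverse contraction over a time bounded below as strong as desired:
the exponential beats the polynomial overshoot. -/
theorem exists_gain {κ T : ℝ} (hκ : 0 < κ) (hT : 0 < T) :
    ∃ ε₀ ≥ 1, ∀ ε ≥ ε₀, ∀ t ≥ T, Real.exp (-(ε * t)) * (1 + t * (1 + ε) ^ 2) ≤ κ := by
  refine ⟨max 1 ((1 / T + 24 / T ^ 2) / κ), le_max_left _ _, fun ε hε t ht => ?_⟩
  have hε1 : 1 ≤ ε := (le_max_left _ _).trans hε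
  have hε2 : 1 / T + 24 / T ^ 2 ≤ ε * κ := (div_le_iff₀ hκ).1 ((le_max_right _ _).trans hε)
  have hε0 : 0 < ε := by linarith
  have ht0 : 0 < t := by linarith
  set s := ε * t with hs
  have hs0 : 0 < s := by positivity
  have hsT : ε * T ≤ s := mul_le_mul_of_nonneg_left ht hε0.le
  have a1 : s ≤ Real.exp s := by linarith [Real.add_one_le_exp s]
  have a2 : s ^ 3 / 6 ≤ Real.exp s := by
    have := Real.pow_div_factorial_le_exp s hs0.le 3
    norm_num [Nat.factorial] at this
    exact this
  have b1 : Real.exp (-s) ≤ 1 / (ε * T) := by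
    rw [Real.exp_neg, ← one_div]
    exact one_div_le_one_div_of_le (by positivity) (hsT.trans a1)
  have b2 : Real.exp (-s) ≤ 6 / s ^ 3 := by
    rw [Real.exp_neg, inv_le_comm₀ (Real.exp_pos _) (by positivity), inv_div]
    exact a2
  have b3 : Real.exp (-s) * (t * (1 + ε) ^ 2) ≤ 24 / (ε * T ^ 2) := by
    have c1 : t * (1 + ε) ^ 2 ≤ 4 * ε * s := by
      rw [hs]
      nlinarith [mul_nonneg ht0.le (by nlinarith : 0 ≤ 4 * ε ^ 2 - (1 + ε) ^ 2)]
    calc _ ≤ 6 / s ^ 3 * (4 * ε * s) :=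
          mul_le_mul b2 c1 (by positivity) (by positivity)
      _ = 24 * ε / s ^ 2 := by field_simp; norm_num
      _ ≤ 24 * ε / (ε * T) ^ 2 := by
          apply div_le_div_of_nonneg_left (by positivity) (by positivity)
          exact pow_le_pow_left₀ (by positivity) hsT 2
      _ = _ := by field_simp
  have b4 : 1 / (ε * T) + 24 / (ε * T ^ 2) ≤ κ := by
    have : 1 / (ε * T) + 24 / (ε * T ^ 2) = (1 / T + 24 / T ^ 2) / ε := by field_simp
    rw [this, div_le_iff₀ hε0]
    linarith
  calc _ = Real.exp (-s) + Real.exp (-s) * (t * (1 + ε) ^ 2) := by ring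
    _ ≤ _ := by linarith

/-! ### The switching map and the zero dynamics surface -/

theorem IsModel.surjective_fderiv_eta₂_h (hW : W.IsModel) (v : Phase) {c : W.X}
    (hc : c ∈ W.guardPZ v) :
    ((fderiv ℝ (W.eta₂ v) c).prod (fderiv ℝ (W.h v) c)).range = ⊤ := by
  obtain ⟨hg, hz, ξ, hξ1, hξ2⟩ := hc
  obtain ⟨M, hM⟩ := hW.isInvertible_Phi v c hz.1
  have hd : HasFDerivAt (W.Phi v) (fderiv ℝ (W.Phi v) c) c :=
    (hW.hasStrictFDerivAt_Phi v hz.1).hasFDerivAt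
  have he : ∀ u, fderiv ℝ (W.eta₂ v) c u =
      ((fderiv ℝ (W.Phi v) c u).2.1, (fderiv ℝ (W.Phi v) c u).2.2.1) := by
    intro u
    have h1 : HasFDerivAt (W.eta₂ v) _ c := (hd.snd.fst).prodMk (hd.snd.snd.fst)
    rw [h1.fderiv]
    rfl
  rw [LinearMap.range_eq_top]
  rintro ⟨⟨a, b⟩, s⟩
  set u := M.symm (0, a, b, 0) with hu
  have hu1 : fderiv ℝ (W.eta₂ v) c u = (a, b) := by
    rw [he, ← hM]
    simp [hu]
  refine ⟨u + ((s - fderiv ℝ (W.h v) c u) / fderiv ℝ (W.h v) c ξ) • ξ, ?_⟩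
  refine Prod.ext ?_ ?_
  · change fderiv ℝ (W.eta₂ v) c (u + _) = (a, b)
    rw [map_add, map_smul, hξ1, hu1, smul_zero, add_zero]
  · change fderiv ℝ (W.h v) c (u + _) = s
    rw [map_add, map_smul, smul_eq_mul, div_mul_cancel₀ _ hξ2]
    ring

theorem IsModel.hasStrictFDerivAt_h (hW : W.IsModel) (v : Phase) {c : W.X} (hc : c ∈ W.act v) :
    HasStrictFDerivAt (W.h v) (fderiv ℝ (W.h v) c) c :=
  ((hW.contDiffOn_h v).contDiffAt ((hW.isOpen_act v).mem_nhds hc)).hasStrictFDerivAt (by norm_num)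

theorem IsModel.hasStrictFDerivAt_eta₂ (hW : W.IsModel) (v : Phase) {c : W.X} (hc : c ∈ W.dom v) :
    HasStrictFDerivAt (W.eta₂ v) (fderiv ℝ (W.eta₂ v) c) c :=
  ((hW.contDiffOn_eta₂ v).contDiffAt ((hW.isOpen_dom v).mem_nhds hc)).hasStrictFDerivAt
    (by norm_num)

theorem eta₂_eq_zero {v : Phase} {c : W.X} (hc : c ∈ W.PZ v) : W.eta₂ v c = 0 :=
  Prod.ext hc.2.1 hc.2.2

/-- Points of the guard project to the zero dynamics surface within the guard, at a distance
controlled by the transverse coordinates: `(η₂, h)` is a submersion where the guard and the surface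
are transversal. -/
theorem IsModel.exists_projection (hW : W.IsModel) (v : Phase) {c : W.X} (hc : c ∈ W.guardPZ v)
    {V : Set W.X} (hV : V ∈ 𝓝 c) :
    ∃ K ≥ 0, ∃ r > 0, ∀ a ∈ W.guard v, ‖a - c‖ < r →
      ∃ a' ∈ V, a' ∈ W.guard v ∧ a' ∈ W.PZ v ∧ ‖a' - a‖ ≤ K * ‖W.eta₂ v a‖ := by
  have hsurj := hW.surjective_fderiv_eta₂_h v hc
  set A := (fderiv ℝ (W.eta₂ v) c).prod (fderiv ℝ (W.h v) c)
  have hs : HasStrictFDerivAt (fun x => (W.eta₂ v x, W.h v x)) A c :=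
    (hW.hasStrictFDerivAt_eta₂ v hc.2.1.1).prodMk (hW.hasStrictFDerivAt_h v hc.1.1)
  set R := A.nonlinearRightInverseOfSurjective hsurj
  have hR : 0 < R.nnnorm := A.nonlinearRightInverseOfSurjective_nnnorm_pos hsurj
  set k : NNReal := R.nnnorm⁻¹ / 2 with hk
  have hk0 : 0 < k := by positivity
  obtain ⟨s, hs1, hs2⟩ := hs.approximates_deriv_on_nhds (c := k) (Or.inr hk0)
  obtain ⟨r, hr, hball⟩ := Metric.mem_nhds_iff.1
    (inter_mem (inter_mem hs1 hV) ((hW.isOpen_act v).mem_nhds hc.1.1))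
  have hη : ∀ᶠ x in 𝓝 c, ‖W.eta₂ v x‖ < k * (r / 2) := by
    have h1 : ContinuousAt (fun x => ‖W.eta₂ v x‖) c :=
      (hW.hasStrictFDerivAt_eta₂ v hc.2.1.1).continuousAt.norm
    refine h1 (Iio_mem_nhds ?_)
    simp only [eta₂_eq_zero hc.2.1, norm_zero]
    positivity
  obtain ⟨r', hr', hball'⟩ := Metric.eventually_nhds_iff_ball.1 hη
  refine ⟨(k : ℝ)⁻¹, by positivity, min r' (r / 2), lt_min hr' (by positivity), ?_⟩
  intro a ha hac
  have hη' := hball' a (by rw [Metric.mem_ball, dist_eq_norm]; exact hac.trans_le (min_le_left _ _))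
  have hac' : ‖a - c‖ < r / 2 := hac.trans_le (min_le_right _ _)
  set d := (k : ℝ)⁻¹ * ‖W.eta₂ v a‖ with hd
  have hk0' : (0 : ℝ) < k := hk0
  have hd0 : 0 ≤ d := by positivity
  have hdr : d < r / 2 := by
    rw [hd, inv_mul_lt_iff₀ hk0']
    exact hη'
  have hsub : Metric.closedBall a d ⊆ Metric.ball c r := by
    intro y hy
    rw [Metric.mem_closedBall, dist_eq_norm] at hy
    rw [Metric.mem_ball, dist_eq_norm]
    have := norm_sub_le_norm_sub_add_norm_sub y a c
    linarith
  have h1 := hs2.surjOn_closedBall_of_nonlinearRightInverse R hd0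
    (fun y hy => (hball (hsub hy)).1.1)
  have h2 : ((0, 0) : (Vec (W.k₂ v) × Vec (W.k₂ v)) × ℝ) ∈
      Metric.closedBall (W.eta₂ v a, W.h v a) (((R.nnnorm : ℝ)⁻¹ - k) * d) := by
    rw [Metric.mem_closedBall, dist_eq_norm, ha.2]
    have h3 : ((R.nnnorm : ℝ)⁻¹ - k) = k := by
      rw [hk]; push_cast; ring
    rw [h3, hd, ← mul_assoc, mul_inv_cancel₀ hk0'.ne', one_mul]
    simp
  obtain ⟨a', ha', hz⟩ := h1 h2
  have hb := hball (hsub ha')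
  have z1 : W.eta₂ v a' = 0 := congrArg Prod.fst hz
  refine ⟨a', hb.1.2, ⟨hb.2, congrArg Prod.snd hz⟩, ⟨hW.act_subset v hb.2, congrArg Prod.fst z1,
    congrArg Prod.snd z1⟩, ?_⟩
  rw [Metric.mem_closedBall, dist_eq_norm] at ha'
  exact ha'

theorem other_other (v : Phase) : v.other.other = v := by cases v <;> rfl

/-- By hybrid invariance, the transverse coordinates after an impact are controlled by those before
it; the constant is uniform over compact sets of transversal points. -/
theorem IsModel.exists_reset_bound (hW : W.IsModel) (v : Phase) {C : Set W.X} (hC : IsCompact C)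
    (hCg : C ⊆ W.guardPZ v) :
    ∃ K ≥ 0, ∀ c ∈ C, ∃ r > 0, ∀ a ∈ W.guard v, ‖a - c‖ < r →
      ‖W.eta₂ v.other (W.reset v a)‖ ≤ K * ‖W.eta₂ v a‖ := by
  refine hC.induction_on (p := fun C => ∃ K ≥ 0, ∀ c ∈ C, ∃ r > 0, ∀ a ∈ W.guard v, ‖a - c‖ < r →
      ‖W.eta₂ v.other (W.reset v a)‖ ≤ K * ‖W.eta₂ v a‖) ?_ ?_ ?_ ?_
  · exact ⟨0, le_rfl, fun c hc => absurd hc (Set.notMem_empty c)⟩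
  · rintro s t hst ⟨K, hK, h⟩
    exact ⟨K, hK, fun c hc => h c (hst hc)⟩
  · rintro s t ⟨K₁, hK₁, h₁⟩ ⟨K₂, hK₂, h₂⟩
    refine ⟨max K₁ K₂, hK₁.trans (le_max_left _ _), fun c hc => ?_⟩
    rcases hc with hc | hc
    · obtain ⟨r, hr, h⟩ := h₁ c hc
      exact ⟨r, hr, fun a ha hac => (h a ha hac).trans
        (mul_le_mul_of_nonneg_right (le_max_left _ _) (norm_nonneg _))⟩
    · obtain ⟨r, hr, h⟩ := h₂ c hc
      exact ⟨r, hr, fun a ha hac => (h a ha hac).trans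
        (mul_le_mul_of_nonneg_right (le_max_right _ _) (norm_nonneg _))⟩
  · intro c hc
    have hcg := hCg hc
    have hr1 : ContDiffAt ℝ 1 (W.reset v) c :=
      (hW.contDiffOn_reset v).contDiffAt ((hW.isOpen_act v).mem_nhds hcg.1.1)
    have hr2 : ContDiffAt ℝ 1 (W.eta₂ v.other) (W.reset v c) :=
      (hW.contDiffOn_eta₂ v.other).contDiffAt
        ((hW.isOpen_dom v.other).mem_nhds (hW.reset_mem v c hcg.1))
    obtain ⟨L, V, hV, hL⟩ := (hr2.comp c hr1).exists_lipschitzOnWith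
    obtain ⟨K, hK, r, hr, hproj⟩ := hW.exists_projection v hcg hV
    obtain ⟨r', hr', hball⟩ := Metric.mem_nhds_iff.1 hV
    have key : ∀ a ∈ W.guard v, ‖a - c‖ < min r r' →
        ‖W.eta₂ v.other (W.reset v a)‖ ≤ L * K * ‖W.eta₂ v a‖ := by
      intro a ha hac
      obtain ⟨a', haV', hag', haz', haa'⟩ := hproj a ha (hac.trans_le (min_le_left _ _))
      have haV : a ∈ V := hball (by
        rw [Metric.mem_ball, dist_eq_norm]; exact hac.trans_le (min_le_right _ _))
      have h1 := hL.dist_le_mul a haV a' haV'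
      simp only [Function.comp_apply] at h1
      rw [eta₂_eq_zero (hW.reset_PZ v a' ⟨hag', haz'⟩), dist_zero_right, dist_comm,
        dist_eq_norm] at h1
      calc _ ≤ L * ‖a' - a‖ := h1
        _ ≤ L * (K * ‖W.eta₂ v a‖) := mul_le_mul_of_nonneg_left haa' L.coe_nonneg
        _ = _ := by ring
    have hm : 0 < min r r' := lt_min hr hr'
    refine ⟨Metric.ball c (min r r' / 2),
      mem_nhdsWithin_of_mem_nhds (Metric.ball_mem_nhds c (by positivity)), L * K, by positivity,
      fun c' hc' => ⟨min r r' / 2, by positivity, fun a ha hac => key a ha ?_⟩⟩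
    rw [Metric.mem_ball, dist_eq_norm] at hc'
    have := norm_sub_le_norm_sub_add_norm_sub a c' c
    linarith

end Walker

end

/-! ### Iterating the impact maps -/

theorem phaseAt_two_mul_add (m k : ℕ) : phaseAt (2 * m + k) = phaseAt k := by
  induction m with
  | zero => simp
  | succ m ih =>
    have e : 2 * (m + 1) + k = (2 * m + k) + 1 + 1 := by ring
    rw [e, phaseAt, phaseAt, Walker.other_other, ih]

theorem phaseAt_other_two_mul (i : ℕ) : (phaseAt (2 * i)).other = Phase.ss := by
  have := phaseAt_two_mul_add i 0
  rw [add_zero] at this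
  rw [this]
  rfl

section Iteration

variable {E : Type*} [NormedAddCommGroup E]

set_option maxHeartbeats 1000000 in
/-- Exponential input to state stability of an iterated relation `R D v a b` ("phase `v` can lead
from the guard point `a` to the guard point `b` under disturbances of size `D`"). Steps depend in a
Lipschitz way on initial point and disturbance, the transverse size `η` is halved by each step, and
the undisturbed iteration on the invariant set `Z`, to which all points of `G` project, converges
geometrically. After a number of cycles that makes the restricted map contract by `1 / 4`, the
function `‖a - c‖ + W * η a`, with `W` large, is halved up to a multiple of the disturbance. -/
theorem exists_iss_of_transverse_contraction {R : ℝ → Phase → E → E → Prop} {G : Phase → Set E}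
    {Z : Set E} {c : Phase → E} {η : Phase → E → ℝ} {r₁ δ₁ L K N ξ : ℝ} (hr₁ : 0 < r₁)
    (hδ₁ : 0 < δ₁) (hL : 1 ≤ L) (hK : 0 ≤ K) (hN : 0 < N) (hξ0 : 0 < ξ) (hξ1 : ξ < 1)
    (hη0 : ∀ v a, 0 ≤ η v a) (hR : ∀ D v a b, R D v a b → b ∈ G v)
    (hcG : ∀ v, c v ∈ G v) (hfix : ∀ v, R 0 v (c v.other) (c v))
    (hLip : ∀ v D D' a a' b b', 0 ≤ D → D ≤ δ₁ → 0 ≤ D' → D' ≤ δ₁ → a ∈ G v.other →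
      ‖a - c v.other‖ < r₁ → a' ∈ G v.other → ‖a' - c v.other‖ < r₁ → R D v a b → R D' v a' b' →
      ‖b - b'‖ ≤ L * (‖a - a'‖ + D + D'))
    (hη : ∀ v D a b, 0 ≤ D → D ≤ δ₁ → a ∈ G v.other → ‖a - c v.other‖ < r₁ → R D v a b →
      η v b ≤ η v.other a / 2 + L * D)
    (hZG : Z ⊆ G Phase.ss)
    (hproj : ∀ a ∈ G Phase.ss, ‖a - c Phase.ss‖ < r₁ → ∃ a' ∈ Z, ‖a - a'‖ ≤ K * η Phase.ss a)
    (hηK : ∀ a ∈ G Phase.ss, ‖a - c Phase.ss‖ < r₁ → η Phase.ss a ≤ K * ‖a - c Phase.ss‖)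
    (hstab : ∀ a ∈ Z, ‖a - c Phase.ss‖ < r₁ → ∃ p : ℕ → E, p 0 = a ∧
      (∀ k, R 0 (phaseAt k) (p k) (p (k + 1))) ∧
      ∀ i, ‖p (2 * i) - c Phase.ss‖ ≤ N * ξ ^ i * ‖a - c Phase.ss‖) :
    ∃ r > 0, ∃ δ > 0, ∃ N' > 0, ∃ ξ', 0 < ξ' ∧ ξ' < 1 ∧ ∃ b > 0, ∀ D, 0 ≤ D → D ≤ δ →
      ∀ (p : ℕ → E) (n : ℕ), p 0 ∈ G Phase.ss → ‖p 0 - c Phase.ss‖ < r →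
        (∀ k < n, R D (phaseAt k) (p k) (p (k + 1))) →
        (∀ k ≤ n, p k ∈ G (phaseAt k).other ∧ ‖p k - c (phaseAt k).other‖ < r₁) ∧
        ∀ i, 2 * i ≤ n →
          ‖p (2 * i) - c Phase.ss‖ ≤ N' * ξ' ^ i * ‖p 0 - c Phase.ss‖ + b * D := by
  have mem : ∀ (D : ℝ) (p : ℕ → E) (n : ℕ), p 0 ∈ G Phase.ss →
      (∀ k < n, R D (phaseAt k) (p k) (p (k + 1))) → ∀ k ≤ n, p k ∈ G (phaseAt k).other := by
    intro D p n h0 h k hk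
    cases k with
    | zero => exact h0
    | succ k =>
      rw [phaseAt, Walker.other_other]
      exact hR _ _ _ _ (h k hk)
  have h2L : 1 ≤ 2 * L := by linarith
  -- growth of the distance of two runs over finitely many steps
  have growth : ∀ (D : ℝ) (p q : ℕ → E) (n : ℕ), 0 ≤ D → D ≤ δ₁ →
      p 0 ∈ G Phase.ss → q 0 ∈ G Phase.ss →
      (∀ k < n, R D (phaseAt k) (p k) (p (k + 1))) →
      (∀ k < n, R 0 (phaseAt k) (q k) (q (k + 1))) →
      (∀ k < n, ‖p k - c (phaseAt k).other‖ < r₁) →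
      (∀ k < n, ‖q k - c (phaseAt k).other‖ < r₁) →
      ∀ k ≤ n, ‖p k - q k‖ ≤ (2 * L) ^ k * (‖p 0 - q 0‖ + D) := by
    intro D p q n hD hDδ hp0 hq0 hp hq hpr hqr k
    induction k with
    | zero => intro _; simpa using hD
    | succ k ih =>
      intro hk
      have h1 := ih (by omega)
      have h2 := hLip (phaseAt k) D 0 (p k) (q k) _ _ hD hDδ le_rfl hδ₁.le
        (mem D p n hp0 hp k (by omega)) (hpr k hk) (mem 0 q n hq0 hq k (by omega)) (hqr k hk)
        (hp k hk) (hq k hk)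
      have h3 : (1 : ℝ) ≤ (2 * L) ^ k := one_le_pow₀ h2L
      have h4 : 0 ≤ ‖p 0 - q 0‖ := norm_nonneg _
      have h5 : D ≤ (2 * L) ^ k * (‖p 0 - q 0‖ + D) :=
        (by linarith : D ≤ ‖p 0 - q 0‖ + D).trans (le_mul_of_one_le_left (by linarith) h3)
      calc _ ≤ L * (‖p k - q k‖ + D + 0) := h2
        _ ≤ L * ((2 * L) ^ k * (‖p 0 - q 0‖ + D) + (2 * L) ^ k * (‖p 0 - q 0‖ + D)) :=
          mul_le_mul_of_nonneg_left (by linarith) (by linarith)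
        _ = _ := by ring
  -- the constant run
  have cstep : ∀ k, R 0 (phaseAt k) (c (phaseAt k).other) (c (phaseAt (k + 1)).other) := by
    intro k
    rw [phaseAt, Walker.other_other]
    exact hfix _
  -- runs that start close to the fixed point remain close to it for finitely many steps
  have close : ∀ (D : ℝ) (p : ℕ → E) (m n : ℕ), m ≤ n → 0 ≤ D → D ≤ δ₁ → p 0 ∈ G Phase.ss →
      (2 * L) ^ n * (‖p 0 - c Phase.ss‖ + D) < r₁ →
      (∀ k < m, R D (phaseAt k) (p k) (p (k + 1))) →
      ∀ k ≤ m, ‖p k - c (phaseAt k).other‖ ≤ (2 * L) ^ n * (‖p 0 - c Phase.ss‖ + D) := by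
    intro D p m n hmn hD hDδ hp0 hsmall hp k
    induction k using Nat.strong_induction_on with
    | _ k ih =>
      intro hk
      have h1 := growth D p (fun k => c (phaseAt k).other) k hD hDδ hp0 (hcG _)
        (fun j hj => hp j (by omega)) (fun j _ => cstep j)
        (fun j hj => (ih j hj (by omega)).trans_lt hsmall)
        (fun j _ => by simpa using hr₁) k le_rfl
      refine h1.trans (mul_le_mul_of_nonneg_right (pow_le_pow_right₀ h2L (hk.trans hmn)) ?_)
      have : 0 ≤ ‖p 0 - c (phaseAt 0).other‖ := norm_nonneg _
      linarith
  -- the transverse size over finitely many steps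
  have transverse : ∀ (D : ℝ) (p : ℕ → E) (n : ℕ), 0 ≤ D → D ≤ δ₁ → p 0 ∈ G Phase.ss →
      (∀ k < n, R D (phaseAt k) (p k) (p (k + 1))) →
      (∀ k < n, ‖p k - c (phaseAt k).other‖ < r₁) →
      ∀ k ≤ n, η (phaseAt k).other (p k) ≤ (1 / 2) ^ k * η Phase.ss (p 0) + 2 * L * D := by
    intro D p n hD hDδ hp0 hp hpr k
    induction k with
    | zero =>
      intro _
      have : 0 ≤ 2 * L * D := by positivity
      simpa [phaseAt, Phase.other] using this
    | succ k ih =>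
      intro hk
      have h1 := ih (by omega)
      have h2 := hη (phaseAt k) D (p k) _ hD hDδ (mem D p n hp0 hp k (by omega)) (hpr k hk)
        (hp k hk)
      rw [phaseAt, Walker.other_other, pow_succ]
      linarith
  -- the number of cycles after which the restricted map contracts by `1 / 4`
  obtain ⟨M₀, hM₀⟩ : ∃ M : ℕ, ξ ^ M < 1 / (4 * N) :=
    exists_pow_lt_of_lt_one (by positivity) hξ1
  set M := M₀ + 1 with hM
  have hMξ : N * ξ ^ M ≤ 1 / 4 := by
    have h1 : ξ ^ M ≤ ξ ^ M₀ := pow_le_pow_of_le_one hξ0.le hξ1.le (by omega)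
    have h2 : N * ξ ^ M ≤ N * (1 / (4 * N)) := mul_le_mul_of_nonneg_left (h1.trans hM₀.le) hN.le
    have h3 : N * (1 / (4 * N)) = 1 / 4 := by field_simp
    linarith
  have hM1 : 1 ≤ M := by omega
  set Λ := (2 * L) ^ (2 * M) with hΛ
  have hΛ1 : 1 ≤ Λ := one_le_pow₀ h2L
  set Wt := 4 * (Λ + 1) * K with hWt
  have hWt0 : 0 ≤ Wt := by positivity
  set B := Λ + 2 * L * Wt with hB
  have hB0 : 0 < B := by positivity
  set r₂ := min r₁ δ₁ / (4 * Λ * (1 + K * K)) with hr₂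
  have hm0 : 0 < min r₁ δ₁ := lt_min hr₁ hδ₁
  have hr₂0 : 0 < r₂ := by positivity
  have hr₂m : 4 * (Λ * (1 + K * K) * r₂) = min r₁ δ₁ := by rw [hr₂]; field_simp
  have hΛr : Λ * r₂ ≤ Λ * (1 + K * K) * r₂ := by
    have : 0 ≤ Λ * (K * K) * r₂ := by positivity
    linarith
  have hrΛ : r₂ ≤ Λ * r₂ := le_mul_of_one_le_left hr₂0.le hΛ1
  have hr₂r₁ : r₂ < r₁ := by linarith [min_le_left r₁ δ₁]
  have hr₂δ : r₂ < δ₁ := by linarith [min_le_right r₁ δ₁]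
  have small : ∀ D a, D ≤ r₂ → ‖a - c Phase.ss‖ < r₂ → Λ * (‖a - c Phase.ss‖ + D) < r₁ := by
    intro D a hD ha
    have : Λ * (‖a - c Phase.ss‖ + D) < Λ * (r₂ + r₂) :=
      mul_lt_mul_of_pos_left (by linarith) (by linarith)
    linarith [min_le_left r₁ δ₁]
  -- one block of `M` cycles
  have block : ∀ (D : ℝ) (p : ℕ → E), 0 ≤ D → D ≤ r₂ → p 0 ∈ G Phase.ss →
      ‖p 0 - c Phase.ss‖ < r₂ → (∀ k < 2 * M, R D (phaseAt k) (p k) (p (k + 1))) →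
      ‖p (2 * M) - c Phase.ss‖ + Wt * η Phase.ss (p (2 * M)) ≤
        (‖p 0 - c Phase.ss‖ + Wt * η Phase.ss (p 0)) / 2 + B * D := by
    intro D p hD hDr hp0 hpr hp
    have hDδ : D ≤ δ₁ := by linarith
    have hpclose := close D p (2 * M) (2 * M) le_rfl hD hDδ hp0 (small D _ hDr hpr) hp
    have hpr₁ : ∀ k < 2 * M, ‖p k - c (phaseAt k).other‖ < r₁ := fun k hk =>
      (hpclose k hk.le).trans_lt (small D _ hDr hpr)
    have e := phaseAt_other_two_mul M
    have t1 := transverse D p (2 * M) hD hDδ hp0 hp hpr₁ (2 * M) le_rfl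
    rw [e] at t1
    have hη0' := hη0 Phase.ss (p 0)
    have t2 : η Phase.ss (p (2 * M)) ≤ η Phase.ss (p 0) / 4 + 2 * L * D := by
      have h1 : ((1 : ℝ) / 2) ^ (2 * M) ≤ (1 / 2) ^ 2 :=
        pow_le_pow_of_le_one (by norm_num) (by norm_num) (by omega)
      have h2 := mul_le_mul_of_nonneg_right h1 hη0'
      linarith
    obtain ⟨a', haZ, haa'⟩ := hproj (p 0) hp0 (by linarith)
    have hηa := hηK (p 0) hp0 (by linarith)
    have ha'c : ‖a' - c Phase.ss‖ ≤ ‖p 0 - c Phase.ss‖ + K * η Phase.ss (p 0) := by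
      have := norm_sub_le_norm_sub_add_norm_sub a' (p 0) (c Phase.ss)
      rw [norm_sub_rev a' (p 0)] at this
      linarith
    have ha'c2 : ‖a' - c Phase.ss‖ ≤ (1 + K * K) * ‖p 0 - c Phase.ss‖ := by
      linarith [mul_le_mul_of_nonneg_left hηa hK]
    have hKK : 0 < 1 + K * K := by positivity
    have ha'r : Λ * (‖a' - c Phase.ss‖ + 0) < r₁ := by
      have h1 : Λ * (‖a' - c Phase.ss‖ + 0) ≤ Λ * ((1 + K * K) * r₂) := by
        apply mul_le_mul_of_nonneg_left _ (by linarith)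
        rw [add_zero]
        exact ha'c2.trans (mul_le_mul_of_nonneg_left hpr.le hKK.le)
      linarith [min_le_left r₁ δ₁]
    obtain ⟨q, hq0, hq, hqs⟩ := hstab a' haZ (by
      rw [add_zero] at ha'r
      exact (le_mul_of_one_le_left (norm_nonneg _) hΛ1).trans_lt ha'r)
    have hqclose := close 0 q (2 * M) (2 * M) le_rfl le_rfl hδ₁.le (hq0 ▸ hZG haZ)
      (by rw [hq0]; exact ha'r) (fun k _ => hq k)
    rw [hq0] at hqclose
    have g := growth D p q (2 * M) hD hDδ hp0 (hq0 ▸ hZG haZ) hp (fun k _ => hq k) hpr₁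
      (fun k hk => (hqclose k hk.le).trans_lt ha'r) (2 * M) le_rfl
    rw [hq0] at g
    have s := hqs M
    have s' : ‖q (2 * M) - c Phase.ss‖ ≤ 1 / 4 * (‖p 0 - c Phase.ss‖ + K * η Phase.ss (p 0)) :=
      s.trans (mul_le_mul hMξ ha'c (norm_nonneg _) (by norm_num))
    have u := norm_sub_le_norm_sub_add_norm_sub (p (2 * M)) (q (2 * M)) (c Phase.ss)
    have g' : ‖p (2 * M) - q (2 * M)‖ ≤ Λ * (K * η Phase.ss (p 0) + D) :=
      g.trans (mul_le_mul_of_nonneg_left (by linarith) (by linarith))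
    have w1 := mul_le_mul_of_nonneg_left t2 hWt0
    have w2 : Wt * η Phase.ss (p 0) = 4 * (Λ + 1) * (K * η Phase.ss (p 0)) := by rw [hWt]; ring
    have w3 : 0 ≤ K * η Phase.ss (p 0) := mul_nonneg hK hη0'
    have w4 : B * D = Λ * D + Wt * (2 * L * D) := by rw [hB]; ring
    have w5 := norm_nonneg (p 0 - c Phase.ss)
    rw [w4]
    linarith
  set V : E → ℝ := fun a => ‖a - c Phase.ss‖ + Wt * η Phase.ss a with hV
  have hVle : ∀ a, ‖a - c Phase.ss‖ ≤ V a := fun a => by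
    have := mul_nonneg hWt0 (hη0 Phase.ss a)
    simp only [hV]
    linarith
  have hV0 : ∀ a ∈ G Phase.ss, ‖a - c Phase.ss‖ < r₁ →
      V a ≤ (1 + Wt * K) * ‖a - c Phase.ss‖ := fun a ha har => by
    have := mul_le_mul_of_nonneg_left (hηK a ha har) hWt0
    simp only [hV]
    linarith
  have hWK : 0 < 1 + Wt * K := by positivity
  set r := r₂ / (2 * (1 + Wt * K)) with hr
  have hr0 : 0 < r := by positivity
  have hrr₂ : (1 + Wt * K) * r = r₂ / 2 := by rw [hr]; field_simp
  have hrle : r ≤ r₂ := by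
    have : 0 ≤ Wt * K * r := by positivity
    linarith
  set δ := min r₂ (r₂ / (4 * B)) with hδ
  have hδ0 : 0 < δ := lt_min hr₂0 (by positivity)
  set ξ' : ℝ := (1 / 2 : ℝ) ^ (1 / (M : ℝ)) with hξ'
  have hMpos : (0 : ℝ) < M := by exact_mod_cast hM1
  have hξ'0 : 0 < ξ' := Real.rpow_pos_of_pos (by norm_num) _
  have hξ'1 : ξ' < 1 := Real.rpow_lt_one (by norm_num) (by norm_num) (by positivity)
  have hξ'M : ξ' ^ M = 1 / 2 := by
    rw [hξ', ← Real.rpow_natCast, ← Real.rpow_mul (by norm_num), one_div_mul_cancel hMpos.ne',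
      Real.rpow_one]
  refine ⟨r, hr0, δ, hδ0, 2 * Λ * (1 + Wt * K), by positivity, ξ', hξ'0, hξ'1,
    Λ * (2 * B + 1), by positivity, ?_⟩
  intro D hD hDδ p n hp0 hpr hp
  have hDr₂ : D ≤ r₂ := hDδ.trans (min_le_left _ _)
  have hDB : 2 * B * D ≤ r₂ / 2 := by
    have h1 : D ≤ r₂ / (4 * B) := hDδ.trans (min_le_right _ _)
    rw [le_div_iff₀ (by positivity)] at h1
    linarith
  have hpr₂ : ‖p 0 - c Phase.ss‖ < r₂ := hpr.trans_le hrle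
  have hVp0 : V (p 0) ≤ (1 + Wt * K) * ‖p 0 - c Phase.ss‖ := hV0 _ hp0 (hpr₂.trans hr₂r₁)
  have hVp0' : V (p 0) < r₂ / 2 := by
    refine hVp0.trans_lt ?_
    rw [← hrr₂]
    exact mul_lt_mul_of_pos_left hpr hWK
  have hmem := mem D p n hp0 hp
  have shift : ∀ j, ∀ k < n - 2 * (M * j), 2 * (M * j) ≤ n →
      R D (phaseAt k) (p (2 * (M * j) + k)) (p (2 * (M * j) + (k + 1))) := by
    intro j k hk hj
    have h := hp (2 * (M * j) + k) (by omega)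
    rwa [phaseAt_two_mul_add] at h
  -- the values at the ends of the blocks
  have blocks : ∀ j, 2 * (M * j) ≤ n → p (2 * (M * j)) ∈ G Phase.ss ∧
      V (p (2 * (M * j))) ≤ (1 / 2) ^ j * V (p 0) + 2 * B * D ∧
      ‖p (2 * (M * j)) - c Phase.ss‖ < r₂ := by
    intro j
    induction j with
    | zero =>
      intro _
      refine ⟨hp0, ?_, hpr₂⟩
      have : 0 ≤ 2 * B * D := by positivity
      simpa using this
    | succ j ih =>
      intro hj
      have e1 : 2 * (M * (j + 1)) = 2 * (M * j) + 2 * M := by ring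
      rw [e1] at hj ⊢
      obtain ⟨i1, i2, i3⟩ := ih (by omega)
      have h1 := block D (fun k => p (2 * (M * j) + k)) hD hDr₂ i1 i3
        (fun k hk => shift j k (by omega) (by omega))
      have h2 : V (p (2 * (M * j) + 2 * M)) ≤ V (p (2 * (M * j))) / 2 + B * D := h1
      have h3 : V (p (2 * (M * j) + 2 * M)) ≤ (1 / 2) ^ (j + 1) * V (p 0) + 2 * B * D := by
        rw [pow_succ]
        linarith
      refine ⟨?_, h3, ?_⟩
      · have h4 := hmem (2 * (M * j) + 2 * M) hj
        rwa [← e1, phaseAt_other_two_mul, e1] at h4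
      · have h5 : ((1 : ℝ) / 2) ^ (j + 1) ≤ 1 := pow_le_one₀ (by norm_num) (by norm_num)
        have h6 : 0 ≤ V (p 0) := (norm_nonneg _).trans (hVle _)
        have h7 := hVle (p (2 * (M * j) + 2 * M))
        have h8 := mul_le_mul_of_nonneg_right h5 h6
        linarith
  -- all other values
  have all : ∀ k ≤ n, ‖p k - c (phaseAt k).other‖ ≤
      Λ * (‖p (2 * (M * (k / (2 * M)))) - c Phase.ss‖ + D) ∧
      ‖p k - c (phaseAt k).other‖ < r₁ := by
    intro k hk
    have hkd : 2 * (M * (k / (2 * M))) + k % (2 * M) = k := by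
      rw [← mul_assoc]; exact Nat.div_add_mod k (2 * M)
    have hkm : k % (2 * M) < 2 * M := Nat.mod_lt _ (by omega)
    set j := k / (2 * M) with hj
    set s := k % (2 * M) with hs
    obtain ⟨i1, -, i3⟩ := blocks j (by omega)
    have h1 := close D (fun k => p (2 * (M * j) + k)) s (2 * M) hkm.le hD (by linarith) i1
      (small D _ hDr₂ i3) (fun k hk => shift j k (by omega) (by omega)) s le_rfl
    simp only [add_zero] at h1
    rw [hkd] at h1
    have e : phaseAt s = phaseAt k := by rw [← hkd, phaseAt_two_mul_add]
    rw [e] at h1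
    exact ⟨h1, h1.trans_lt (small D _ hDr₂ i3)⟩
  refine ⟨fun k hk => ⟨hmem k hk, (all k hk).2⟩, fun i hi => ?_⟩
  have h1 := (all (2 * i) hi).1
  rw [phaseAt_other_two_mul, Nat.mul_div_mul_left _ _ two_pos] at h1
  have hij : M * (i / M) + i % M = i := Nat.div_add_mod i M
  have hjm : i % M < M := Nat.mod_lt _ hM1
  set j := i / M with hj
  obtain ⟨-, i2, -⟩ := blocks j (by
    have : 2 * (M * j) ≤ 2 * i := by omega
    omega)
  have h2 := hVle (p (2 * (M * j)))
  have h3 : ((1 : ℝ) / 2) ^ j ≤ 2 * ξ' ^ i := by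
    have e1 : ξ' ^ i = (1 / 2) ^ j * ξ' ^ (i % M) := by
      rw [← hξ'M, ← pow_mul, ← pow_add, hij]
    have e2 : 1 / 2 ≤ ξ' ^ (i % M) := by
      rw [← hξ'M]
      exact pow_le_pow_of_le_one hξ'0.le hξ'1.le hjm.le
    rw [e1]
    have e3 : (0 : ℝ) < (1 / 2) ^ j := by positivity
    linarith [mul_le_mul_of_nonneg_left e2 e3.le]
  have h4 : (1 / 2) ^ j * V (p 0) ≤ 2 * ξ' ^ i * ((1 + Wt * K) * ‖p 0 - c Phase.ss‖) :=
    mul_le_mul h3 hVp0 ((norm_nonneg _).trans (hVle _)) (by positivity)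
  calc _ ≤ Λ * (‖p (2 * (M * j)) - c Phase.ss‖ + D) := h1
    _ ≤ Λ * (2 * ξ' ^ i * ((1 + Wt * K) * ‖p 0 - c Phase.ss‖) + 2 * B * D + D) :=
      mul_le_mul_of_nonneg_left (by linarith) (by linarith)
    _ = _ := by ring

end Iteration

noncomputable section

namespace Walker

variable {W : Walker}

theorem aestronglyMeasurable_clm_apply {E F : Type*} [NormedAddCommGroup E] [NormedSpace ℝ E]
    [NormedAddCommGroup F] [NormedSpace ℝ F] {μ : Measure ℝ} {A : ℝ → E →L[ℝ] F} {u : ℝ → E}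
    (hA : AEStronglyMeasurable A μ) (hu : AEStronglyMeasurable u μ) :
    AEStronglyMeasurable (fun t => A t (u t)) μ :=
  isBoundedBilinearMap_apply.continuous.comp_aestronglyMeasurable (hA.prodMk hu)

/-! ### Trajectories of the walker as approximate trajectories -/

/-- A trajectory whose input deviates from the feedback linearizing law by at most `D` is an
approximate trajectory of the undisturbed closed loop. -/
theorem IsModel.isApproxTraj (hW : W.IsModel) {ε : ℝ} {v : Phase} {Z : Set W.X}
    (hZ : Z ⊆ W.dom v) {u : ℝ → W.X → Vec (W.m v)} {S D : ℝ} {x : ℝ → W.X}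
    (hx : W.IsTraj v Z u S x)
    (hm : AEStronglyMeasurable (fun s => u s (x s)) (volume.restrict (Icc 0 S)))
    (hb : ∀ᵐ t ∂(volume.restrict (Icc 0 S)), ‖u t (x t) - W.uFL ε v (x t)‖ ≤ D) :
    IsApproxTraj (W.closedLoop ε v) (fun y => ‖W.g v y‖) (W.dom v) D S x := by
  obtain ⟨hS, hxc, hxZ, hxi⟩ := hx
  have hxU : ∀ t ∈ Icc 0 S, x t ∈ W.dom v := fun t ht => hZ (hxZ t ht)
  have hgc : ContinuousOn (fun t => W.g v (x t)) (Icc 0 S) :=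
    ((hW.contDiffOn_g v).continuousOn.mono (hW.dom_subset v)).comp hxc hxU
  have huc : ContinuousOn (fun t => W.uFL ε v (x t)) (Icc 0 S) :=
    (hW.contDiffOn_uFL ε v).continuousOn.comp hxc hxU
  have hFc : ContinuousOn (fun t => W.closedLoop ε v (x t)) (Icc 0 S) :=
    (hW.contDiffOn_closedLoop ε v).continuousOn.comp hxc hxU
  set d : ℝ → W.X := fun t => W.g v (x t) (u t (x t) - W.uFL ε v (x t)) with hd
  have hdm : AEStronglyMeasurable d (volume.restrict (Icc 0 S)) := by
    have h1 := hgc.aestronglyMeasurable (μ := volume) measurableSet_Icc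
    have h2 := hm.sub (huc.aestronglyMeasurable (μ := volume) measurableSet_Icc)
    exact aestronglyMeasurable_clm_apply h1 h2
  have hdb : ∀ᵐ t ∂(volume.restrict (Icc 0 S)), ‖d t‖ ≤ D * ‖W.g v (x t)‖ := by
    filter_upwards [hb] with t ht
    refine ((W.g v (x t)).le_opNorm _).trans ?_
    rw [mul_comm]
    exact mul_le_mul_of_nonneg_right ht (norm_nonneg _)
  have hgI : IntegrableOn (fun t => D * ‖W.g v (x t)‖) (Icc 0 S) :=
    (continuousOn_const.mul hgc.norm).integrableOn_Icc
  have hdI : IntegrableOn d (Icc 0 S) := hgI.mono' hdm hdb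
  have hFI : IntegrableOn (fun t => W.closedLoop ε v (x t)) (Icc 0 S) := hFc.integrableOn_Icc
  have sub : ∀ {t₁ t₂ : ℝ}, 0 ≤ t₁ → t₁ ≤ t₂ → t₂ ≤ S → ∀ {q : ℝ → W.X},
      IntegrableOn q (Icc 0 S) → IntervalIntegrable q volume t₁ t₂ := by
    intro t₁ t₂ h1 h2 h3 q hq
    rw [intervalIntegrable_iff_integrableOn_Icc_of_le h2]
    exact hq.mono_set (Icc_subset_Icc h1 h3)
  have hsplit : ∀ t, W.f v (x t) + W.g v (x t) (u t (x t)) = W.closedLoop ε v (x t) + d t := by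
    intro t
    simp only [hd, closedLoop, map_sub]
    abel
  refine ⟨hS, hxc, hxU, fun t₁ t₂ h1 h2 h3 => ?_⟩
  have e1 := hxi t₁ ⟨h1, h2.trans h3⟩
  have e2 := hxi t₂ ⟨h1.trans h2, h3⟩
  simp only [hsplit] at e1 e2
  have i1 := sub le_rfl h1 (h2.trans h3) (hFI.add hdI)
  have i2 := sub h1 h2 h3 (hFI.add hdI)
  have e3 : x t₂ - x t₁ - ∫ s in t₁..t₂, W.closedLoop ε v (x s) = ∫ s in t₁..t₂, d s := by
    rw [e1, e2]
    have a1 := intervalIntegral.integral_add_adjacent_intervals i1 i2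
    have a2 := intervalIntegral.integral_add (sub h1 h2 h3 hFI) (sub h1 h2 h3 hdI)
    simp only [Pi.add_apply] at a1 a2
    rw [← a1, a2]
    abel
  rw [e3, ← intervalIntegral.integral_const_mul]
  apply intervalIntegral.norm_integral_le_of_norm_le h2
  · rw [ae_restrict_iff' measurableSet_Icc] at hdb
    filter_upwards [hdb] with t ht hts
    exact ht ⟨h1.trans hts.1.le, hts.2.trans h3⟩
  · rw [intervalIntegrable_iff_integrableOn_Icc_of_le h2]
    exact hgI.mono_set (Icc_subset_Icc h1 h3)

theorem IsModel.isApproxTraj_zero (hW : W.IsModel) {ε : ℝ} {v : Phase} {Z : Set W.X}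
    (hZ : Z ⊆ W.dom v) {S : ℝ} {x : ℝ → W.X} (hx : W.IsTraj v Z (fun _ => W.uFL ε v) S x) :
    IsApproxTraj (W.closedLoop ε v) (fun y => ‖W.g v y‖) (W.dom v) 0 S x := by
  refine hW.isApproxTraj hZ hx ?_ (by simp)
  exact ((hW.contDiffOn_uFL ε v).continuousOn.comp hx.2.1
    fun t ht => hZ (hx.2.2.1 t ht)).aestronglyMeasurable measurableSet_Icc

theorem PDLaw.continuousOn_uPD {v : Phase} (L : W.PDLaw v) :
    ContinuousOn (fun p : ℝ × W.X => L.uPD p.1 p.2) (Ici 0 ×ˢ W.dom v) := by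
  have h := L.continuousOn_xd
  have h1 : ContinuousOn (fun p : ℝ × W.X => L.Kp (p.2.1 - (L.xd p.1 p.2).1)) (Ici 0 ×ˢ W.dom v) :=
    L.Kp.continuous.comp_continuousOn (by fun_prop)
  have h2 : ContinuousOn (fun p : ℝ × W.X => L.Kd (p.2.2 - (L.xd p.1 p.2).2)) (Ici 0 ×ˢ W.dom v) :=
    L.Kd.continuous.comp_continuousOn (by fun_prop)
  exact h1.neg.sub h2

theorem PDLaw.aestronglyMeasurable {v : Phase} (L : W.PDLaw v) {w : ℝ → Vec (W.m v)}
    (hw : Measurable w) {A : Set ℝ} (hA : MeasurableSet A) (hA0 : A ⊆ Ici 0) {x : ℝ → W.X}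
    (hx : ContinuousOn x A) (hxU : ∀ t ∈ A, x t ∈ W.dom v) :
    AEStronglyMeasurable (fun s => L.uPD s (x s) + w s) (volume.restrict A) := by
  refine AEStronglyMeasurable.add ?_ hw.aestronglyMeasurable
  have h1 : ContinuousOn (fun s => (s, x s)) A := continuousOn_id.prodMk hx
  exact (L.continuousOn_uPD.comp h1 fun t ht => ⟨hA0 ht, hxU t ht⟩).aestronglyMeasurable hA

theorem PDLaw.exists_lipschitz {v : Phase} (L : W.PDLaw v) {K : Set W.X} (hK : IsCompact K)
    (hKU : K ⊆ W.dom v) (S : ℝ) : ∃ C ≥ 0, ∀ t ∈ Icc 0 S, ∀ x ∈ K, ∀ y ∈ K,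
      ‖L.uPD t x - L.uPD t y‖ ≤ C * ‖x - y‖ := by
  obtain ⟨M, hM⟩ := L.lipschitz_xd S K hKU hK
  refine ⟨(‖L.Kp‖ + ‖L.Kd‖) * (1 + M), by positivity, fun t ht x hx y hy => ?_⟩
  have h1 := (hM t ht).dist_le_mul x hx y hy
  rw [dist_eq_norm, dist_eq_norm] at h1
  have e : L.uPD t x - L.uPD t y = - L.Kp ((x - y).1 - (L.xd t x - L.xd t y).1)
      - L.Kd ((x - y).2 - (L.xd t x - L.xd t y).2) := by
    simp only [PDLaw.uPD, map_sub, Prod.fst_sub, Prod.snd_sub]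
    abel
  have b1 : ‖(x - y).1 - (L.xd t x - L.xd t y).1‖ ≤ (1 + M) * ‖x - y‖ := by
    refine (norm_sub_le _ _).trans ?_
    have := norm_fst_le (x - y)
    have := norm_fst_le (L.xd t x - L.xd t y)
    linarith
  have b2 : ‖(x - y).2 - (L.xd t x - L.xd t y).2‖ ≤ (1 + M) * ‖x - y‖ := by
    refine (norm_sub_le _ _).trans ?_
    have := norm_snd_le (x - y)
    have := norm_snd_le (L.xd t x - L.xd t y)
    linarith
  rw [e]
  refine (norm_sub_le _ _).trans ?_
  rw [norm_neg]
  have c1 := (L.Kp.le_opNorm ((x - y).1 - (L.xd t x - L.xd t y).1)).trans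
    (mul_le_mul_of_nonneg_left b1 (norm_nonneg _))
  have c2 := (L.Kd.le_opNorm ((x - y).2 - (L.xd t x - L.xd t y).2)).trans
    (mul_le_mul_of_nonneg_left b2 (norm_nonneg _))
  linarith

/-- Existence of trajectories of the closed loop under a time based PD law, for as long as they
remain in a compact set. -/
theorem IsModel.exists_traj_while_mem (hW : W.IsModel) {v : Phase} (L : W.PDLaw v)
    {w : ℝ → Vec (W.m v)} (hw : Measurable w) {Cw : ℝ} (hCw : ∀ t, ‖w t‖ ≤ Cw) {K : Set W.X}
    (hK : IsCompact K) {r : ℝ} (hr : 0 < r) (hKU : Metric.cthickening r K ⊆ W.dom v)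
    {S : ℝ} (hS : 0 ≤ S) {x₀ : W.X} (hx₀ : x₀ ∈ K) :
    ∃ x : ℝ → W.X, Continuous x ∧ x 0 = x₀ ∧ ∀ S' ∈ Icc 0 S, (∀ t ∈ Icc 0 S', x t ∈ K) →
      W.IsTraj v (W.dom v) (fun t y => L.uPD t y + w t) S' x := by
  have hK' : IsCompact (Metric.cthickening r K) := hK.cthickening
  have hs := hW.dom_subset v
  obtain ⟨Lf, hLf⟩ := ((((hW.contDiffOn_f v).mono hs).locallyLipschitzOn_of_isOpen
    (hW.isOpen_dom v)).mono hKU).exists_lipschitzOnWith_of_compact hK'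
  obtain ⟨Lg, hLg⟩ := ((((hW.contDiffOn_g v).mono hs).locallyLipschitzOn_of_isOpen
    (hW.isOpen_dom v)).mono hKU).exists_lipschitzOnWith_of_compact hK'
  obtain ⟨Bf, hBf⟩ := hK'.exists_bound_of_continuousOn
    (((hW.contDiffOn_f v).continuousOn.mono hs).mono hKU)
  obtain ⟨Bg, hBg⟩ := hK'.exists_bound_of_continuousOn
    (((hW.contDiffOn_g v).continuousOn.mono hs).mono hKU)
  obtain ⟨Lu, hLu0, hLu⟩ := L.exists_lipschitz hK' hKU S
  obtain ⟨Bu, hBu⟩ := (isCompact_Icc.prod hK').exists_bound_of_continuousOn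
    (L.continuousOn_uPD.mono (prod_mono (fun t (ht : t ∈ Icc 0 S) => ht.1) hKU))
  have hx₀' : x₀ ∈ Metric.cthickening r K := Metric.self_subset_cthickening K hx₀
  have hBf0 : 0 ≤ Bf := (norm_nonneg _).trans (hBf x₀ hx₀')
  have hBg0 : 0 ≤ Bg := (norm_nonneg _).trans (hBg x₀ hx₀')
  have hCw0 : 0 ≤ Cw := (norm_nonneg _).trans (hCw 0)
  have hBu0 : 0 ≤ Bu := (norm_nonneg _).trans (hBu (0, x₀) ⟨⟨le_rfl, hS⟩, hx₀'⟩)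
  have hub : ∀ t ∈ Icc 0 S, ∀ x ∈ Metric.cthickening r K, ‖L.uPD t x + w t‖ ≤ Bu + Cw :=
    fun t ht x hx => (norm_add_le _ _).trans (add_le_add (hBu (t, x) ⟨ht, hx⟩) (hCw t))
  obtain ⟨x, hxc, hx0, hx⟩ := exists_integral_curve_while_mem
    (R := fun t x => W.f v x + W.g v x (L.uPD t x + w t)) (S := S)
    (L := Lf + (Lg * (Bu + Cw) + Bg * Lu)) (B := Bf + Bg * (Bu + Cw)) hS hr (by positivity)
    (by positivity) (by
      intro t ht x hx y hy
      have h1 := hLf.dist_le_mul x hx y hy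
      have h2 := hLg.dist_le_mul x hx y hy
      rw [dist_eq_norm, dist_eq_norm] at h1 h2
      have h3 := hLu t ht x hx y hy
      have e : W.f v x + W.g v x (L.uPD t x + w t) - (W.f v y + W.g v y (L.uPD t y + w t)) =
          (W.f v x - W.f v y) + ((W.g v x - W.g v y) (L.uPD t x + w t) +
            W.g v y (L.uPD t x - L.uPD t y)) := by
        simp only [map_add, map_sub, _root_.sub_apply]
        abel
      rw [e]
      have k1 : ‖(W.g v x - W.g v y) (L.uPD t x + w t)‖ ≤ Lg * ‖x - y‖ * (Bu + Cw) :=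
        ((W.g v x - W.g v y).le_opNorm _).trans
          (mul_le_mul h2 (hub t ht x hx) (norm_nonneg _) (by positivity))
      have k2 : ‖W.g v y (L.uPD t x - L.uPD t y)‖ ≤ Bg * (Lu * ‖x - y‖) :=
        ((W.g v y).le_opNorm _).trans (mul_le_mul (hBg y hy) h3 (norm_nonneg _) hBg0)
      refine (norm_add_le _ _).trans ?_
      have := norm_add_le ((W.g v x - W.g v y) (L.uPD t x + w t))
        (W.g v y (L.uPD t x - L.uPD t y))
      linarith)
    (by
      intro t ht x hx
      refine (norm_add_le _ _).trans (add_le_add (hBf x hx) ?_)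
      exact ((W.g v x).le_opNorm _).trans
        (mul_le_mul (hBg x hx) (hub t ht x hx) (norm_nonneg _) hBg0))
    (by
      intro x hx
      have hA : MeasurableSet (Icc 0 S ∩ x ⁻¹' Metric.cthickening r K) :=
        measurableSet_Icc.inter (Metric.isClosed_cthickening.preimage hx).measurableSet
      have hxU : ∀ t ∈ Icc 0 S ∩ x ⁻¹' Metric.cthickening r K, x t ∈ W.dom v := fun t ht => hKU ht.2
      have m1 := ((((hW.contDiffOn_f v).continuousOn.mono hs).comp
        hx.continuousOn hxU).aestronglyMeasurable (μ := volume) hA)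
      have m2 := ((((hW.contDiffOn_g v).continuousOn.mono hs).comp
        hx.continuousOn hxU).aestronglyMeasurable (μ := volume) hA)
      have m3 := L.aestronglyMeasurable hw hA (fun t ht => ht.1.1) hx.continuousOn hxU
      exact m1.add (aestronglyMeasurable_clm_apply m2 m3))
    x₀ hx₀
  refine ⟨x, hxc, hx0, fun S' hS' hK'' => ⟨hS'.1, hxc.continuousOn, fun t ht =>
    hKU (Metric.self_subset_cthickening K (hK'' t ht)), fun t ht => ?_⟩⟩
  rw [hx0]
  exact hx S' hS' hK'' t ht

/-! ### Post-impact states -/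

theorem coordNorm_add_le {v : Phase} (p q : W.Coord v) :
    W.coordNorm (p + q) ≤ 2 * (W.coordNorm p + W.coordNorm q) := by
  have h1 := coordNorm_le (p + q)
  have h2 := norm_add_le p q
  have h3 := norm_le_coordNorm p
  have h4 := norm_le_coordNorm q
  linarith

/-- Post-impact states with a small disturbance: they exist, and are close to the undisturbed
ones. -/
theorem IsModel.exists_initial (hW : W.IsModel) (v : Phase) {c : W.X} (hc : c ∈ W.guard v.other)
    {ω : ℝ} (hω : 0 < ω) :
    ∃ r > 0, ∃ δ > 0, ∃ C ≥ 1,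
      (∀ a ∈ W.guard v.other, ‖a - c‖ < r → W.reset v.other a ∈ W.dom v ∧
        ‖W.reset v.other a - W.reset v.other c‖ ≤ ω) ∧
      (∀ a ∈ W.guard v.other, ‖a - c‖ < r → ∀ b ∈ W.guard v.other, ‖b - c‖ < r →
        ‖W.reset v.other a - W.reset v.other b‖ ≤ C * ‖a - b‖) ∧
      ∀ a ∈ W.guard v.other, ‖a - c‖ < r → ∀ D ≤ δ, ∀ e : W.Coord v, W.coordNorm e ≤ D →
        (∃ x₀ ∈ W.dom v, W.Phi v x₀ = W.Phi v (W.reset v.other a) + e) ∧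
        ∀ x₀ ∈ W.dom v, W.Phi v x₀ = W.Phi v (W.reset v.other a) + e →
          ‖x₀ - W.reset v.other a‖ ≤ C * D ∧ ‖x₀ - W.reset v.other c‖ ≤ ω := by
  have hmem : ∀ a ∈ W.guard v.other, W.reset v.other a ∈ W.dom v := fun a ha => by
    have := hW.reset_mem v.other a ha
    rwa [other_other] at this
  set c₀ := W.reset v.other c with hc₀
  have hc₀U : c₀ ∈ W.dom v := hmem c hc
  obtain ⟨Ce, hCe, re, hre, hreU, heq⟩ := hW.exists_cdist_equiv v hc₀U
  obtain ⟨ρ, hρ, hinv⟩ := hW.exists_Phi_eq v hc₀U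
    (Metric.ball_mem_nhds c₀ (lt_min hre hω))
  have hr1 : ContDiffAt ℝ 1 (W.reset v.other) c :=
    (hW.contDiffOn_reset v.other).contDiffAt ((hW.isOpen_act v.other).mem_nhds hc.1)
  obtain ⟨Lr, V, hV, hLr⟩ := hr1.exists_lipschitzOnWith
  have hCe0 : 0 < Ce := by linarith
  set s := min (min re ω) (ρ / (8 * Ce)) with hs
  have hs0 : 0 < s := lt_min (lt_min hre hω) (by positivity)
  have hpre : W.reset v.other ⁻¹' Metric.ball c₀ s ∈ 𝓝 c :=
    hr1.continuousAt.preimage_mem_nhds (Metric.ball_mem_nhds c₀ hs0)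
  obtain ⟨r, hr, hball⟩ := Metric.mem_nhds_iff.1 (inter_mem hV hpre)
  have hball' : ∀ a, ‖a - c‖ < r → a ∈ V ∧ ‖W.reset v.other a - c₀‖ < s := fun a ha => by
    have h := hball (show a ∈ Metric.ball c r by rwa [Metric.mem_ball, dist_eq_norm])
    refine ⟨h.1, ?_⟩
    have h2 := h.2
    rwa [mem_preimage, Metric.mem_ball, dist_eq_norm] at h2
  refine ⟨r, hr, ρ / 8, by positivity, max Ce Lr, hCe.trans (le_max_left _ _), ?_, ?_, ?_⟩
  · intro a ha hac
    exact ⟨hmem a ha, (hball' a hac).2.le.trans ((min_le_left _ _).trans (min_le_right _ _))⟩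
  · intro a _ hac b _ hbc
    have h := hLr.dist_le_mul a (hball' a hac).1 b (hball' b hbc).1
    rw [dist_eq_norm, dist_eq_norm] at h
    exact h.trans (mul_le_mul_of_nonneg_right (le_max_right _ _) (norm_nonneg _))
  · intro a ha hac D hD e he
    have h1 := (hball' a hac).2
    have hain : W.reset v.other a ∈ Metric.ball c₀ re := by
      rw [Metric.mem_ball, dist_eq_norm]
      exact h1.trans_le ((min_le_left _ _).trans (min_le_left _ _))
    have hd : W.cdist v (W.reset v.other a) c₀ < ρ / 8 := by
      have h2 := (heq _ hain c₀ (Metric.mem_ball_self hre)).1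
      have h3 : Ce * ‖W.reset v.other a - c₀‖ < Ce * (ρ / (8 * Ce)) :=
        mul_lt_mul_of_pos_left (h1.trans_le (min_le_right _ _)) hCe0
      have h4 : Ce * (ρ / (8 * Ce)) = ρ / 8 := by field_simp
      linarith
    have hlt : W.coordNorm (W.Phi v (W.reset v.other a) + e - W.Phi v c₀) < ρ := by
      have e1 : W.Phi v (W.reset v.other a) + e - W.Phi v c₀ =
        (W.Phi v (W.reset v.other a) - W.Phi v c₀) + e := add_sub_right_comm _ _ _
      have h2 := coordNorm_add_le (W.Phi v (W.reset v.other a) - W.Phi v c₀) e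
      rw [e1]
      rw [cdist] at hd
      linarith
    obtain ⟨x, hxb, hxU, hxe⟩ := hinv _ hlt
    refine ⟨⟨x, hxU, hxe⟩, fun x₀ hx₀ hx₀e => ?_⟩
    obtain rfl : x = x₀ := hW.injOn_Phi v hxU hx₀ (hxe.trans hx₀e.symm)
    rw [Metric.mem_ball, dist_eq_norm] at hxb
    refine ⟨?_, (hxb.trans_le (min_le_right _ _)).le⟩
    have hxin : x ∈ Metric.ball c₀ re := by
      rw [Metric.mem_ball, dist_eq_norm]
      exact hxb.trans_le (min_le_left _ _)
    have h2 := (heq x hxin _ hain).2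
    have h3 : W.cdist v x (W.reset v.other a) = W.coordNorm e := by
      rw [cdist, hxe, add_sub_cancel_left]
    rw [h3] at h2
    have hD0 : 0 ≤ D := (coordNorm_nonneg e).trans he
    calc _ ≤ Ce * W.coordNorm e := h2
      _ ≤ Ce * D := mul_le_mul_of_nonneg_left he hCe0.le
      _ ≤ _ := mul_le_mul_of_nonneg_right (le_max_left _ _) hD0

/-! ### Estimates for one phase -/

/-- Phase `v` can lead from the point `a` of the preceding guard to the point `b` of its own guard,
under an impact disturbance and a deviation of the input from `uFL` that are bounded by `D`. -/
def PhaseStep (W : Walker) (ε : ℝ) (O : W.Orbit) (ρ D : ℝ) (v : Phase) (a b : W.X) : Prop :=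
  ∃ (u : ℝ → W.X → Vec (W.m v)) (e : W.Coord v) (T : ℝ) (x : ℝ → W.X),
    W.IsArc v (W.dom v) u e (O.pt v) ρ a T x ∧ x T ∈ W.guardBall v (O.pt v) ρ ∧ b = x T ∧
      W.coordNorm e ≤ D ∧
      AEStronglyMeasurable (fun s => u s (x s)) (volume.restrict (Icc 0 T)) ∧
      ∀ᵐ t ∂(volume.restrict (Icc 0 T)), ‖u t (x t) - W.uFL ε v (x t)‖ ≤ D

theorem PhaseStep.mem_guard {ε : ℝ} {O : W.Orbit} {ρ D : ℝ} {v : Phase} {a b : W.X}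
    (h : W.PhaseStep ε O ρ D v a b) : b ∈ W.guardBall v (O.pt v) ρ := by
  obtain ⟨u, e, T, x, -, h2, rfl, -⟩ := h
  exact h2

/-- Estimates for a single phase near a periodic orbit: impact points depend in a Lipschitz way on
the previous ones and on the disturbance, transverse coordinates are halved up to a multiple of the
disturbance, and under PD laws the next impact takes place. -/
theorem IsModel.exists_phase_estimates (hW : W.IsModel) {ε : ℝ} (hε : 0 ≤ ε) {O : W.Orbit}
    (hO : W.IsOrbitPZ ε O) (v : Phase) {T₀ κ K : ℝ} (hT₀ : T₀ ≤ O.T v)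
    (hgain : ∀ t ≥ T₀ / 2, Real.exp (-(ε * t)) * (1 + t * (1 + ε) ^ 2) ≤ κ) (hκ : 0 ≤ κ)
    (hκK : κ * K ≤ 1 / 2)
    (hreset : ∃ r > 0, ∀ a ∈ W.guard v.other, ‖a - O.pt v.other‖ < r →
      ‖W.eta₂ v (W.reset v.other a)‖ ≤ K * ‖W.eta₂ v.other a‖) :
    ∃ ρ₀ > 0, ∀ ρ, 0 < ρ → ρ ≤ ρ₀ → ∃ L ≥ 1, ∃ δ > 0, ∃ r > 0,
      (∀ D D' a a' b b', 0 ≤ D → D ≤ δ → 0 ≤ D' → D' ≤ δ →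
        a ∈ W.guard v.other → ‖a - O.pt v.other‖ < r →
        a' ∈ W.guard v.other → ‖a' - O.pt v.other‖ < r →
        W.PhaseStep ε O ρ D v a b → W.PhaseStep ε O ρ D' v a' b' →
        ‖b - b'‖ ≤ L * (‖a - a'‖ + D + D')) ∧
      (∀ D a b, 0 ≤ D → D ≤ δ → a ∈ W.guard v.other → ‖a - O.pt v.other‖ < r →
        W.PhaseStep ε O ρ D v a b →
        ‖W.eta₂ v b‖ ≤ ‖W.eta₂ v.other a‖ / 2 + L * D) ∧
      ∀ (P : W.PDLaw v) (w : ℝ → Vec (W.m v)) (e : W.Coord v) (D : ℝ) (a : W.X), Measurable w →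
        (∃ C, ∀ t, ‖w t‖ ≤ C) → D ≤ δ → W.coordNorm e ≤ D →
        a ∈ W.guard v.other → ‖a - O.pt v.other‖ < r →
        (∀ S x, W.IsArc v (W.dom v) (fun t y => P.uPD t y + w t) e (O.pt v) ρ a S x →
          ∀ᵐ t ∂(volume.restrict (Icc 0 S)), ‖P.uPD t (x t) + w t - W.uFL ε v (x t)‖ ≤ D) →
        ∃ T x, W.IsArc v (W.dom v) (fun t y => P.uPD t y + w t) e (O.pt v) ρ a T x ∧
          x T ∈ W.guardBall v (O.pt v) ρ := by
  set F := W.closedLoop ε v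
  set wt : W.X → ℝ := fun y => ‖W.g v y‖
  have hU := hW.isOpen_dom v
  have hF : LocallyLipschitzOn (W.dom v) F :=
    (hW.contDiffOn_closedLoop ε v).locallyLipschitzOn_of_isOpen hU
  have hwt : ContinuousOn wt (W.dom v) :=
    ((hW.contDiffOn_g v).continuousOn.mono (hW.dom_subset v)).norm
  have hγ₀ : IsApproxTraj F wt (W.dom v) 0 (O.T v) (O.γ v) :=
    hW.isApproxTraj_zero (fun _ hx => hx.1) (hO.traj v)
  obtain ⟨S₀, hTS, γ, hγ, hγeq⟩ := hγ₀.exists_extension hU hF hwt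
  have hTpos := hO.pos_T v
  have hS₀ : 0 ≤ S₀ := hγ.nonneg
  have hγT : γ (O.T v) = O.pt v := hγeq ⟨hTpos.le, le_rfl⟩
  have hγ0 : γ 0 = W.reset v.other (O.pt v.other) :=
    (hγeq ⟨le_rfl, hTpos.le⟩).trans (hO.start v)
  have hcg := hO.guard v
  have hcU : O.pt v ∈ W.dom v := hW.act_subset v hcg.1
  have hcomp : IsCompact (γ '' Icc 0 S₀) := isCompact_Icc.image_of_continuousOn hγ.continuousOn
  obtain ⟨r₀, hr₀, hr₀U⟩ := hcomp.exists_cthickening_subset_open hU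
    (by rintro _ ⟨t, ht, rfl⟩; exact hγ.mem t ht)
  have hr2 : 0 < r₀ / 2 := by positivity
  set Kc := Metric.cthickening (r₀ / 2) (γ '' Icc 0 S₀) with hKc
  have hKcc : IsCompact Kc := hcomp.cthickening
  have hKthick : Metric.cthickening (r₀ / 2) Kc ⊆ W.dom v := by
    have := Metric.cthickening_cthickening_subset hr2.le hr2.le (γ '' Icc 0 S₀)
    rw [add_halves] at this
    exact this.trans hr₀U
  have hKU : Kc ⊆ W.dom v := (Metric.self_subset_cthickening Kc).trans hKthick
  have memK : ∀ t ∈ Icc 0 S₀, ∀ y, ‖y - γ t‖ ≤ r₀ / 2 → y ∈ Kc := by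
    intro t ht y hy
    refine Metric.mem_cthickening_of_dist_le _ (γ t) _ _ ⟨t, ht, rfl⟩ ?_
    rwa [dist_eq_norm]
  have hstrict : HasStrictFDerivAt (W.h v) (fderiv ℝ (W.h v) (γ (O.T v))) (γ (O.T v)) := by
    rw [hγT]
    exact hW.hasStrictFDerivAt_h v hcg.1
  obtain ⟨ρ₀, hρ₀, himp⟩ := exists_impact_estimates hU hF hwt hγ hTpos hTS (hW.isOpen_act v)
    (hW.act_subset v) (ϑ := fun y => W.cdist v y (O.pt v)) (hW.contDiffOn_h v).continuousOn
    (by rw [hγT]; exact hcg.1) (by rw [hγT]; exact hcg.2) hstrict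
    (by rw [hγT]; exact hO.transversal v)
    (fun t ht => by rw [hγeq ⟨ht.1, ht.2.le⟩]; exact hO.not_guard v t ht)
    (hW.continuousOn_cdist v _) (by rw [hγT]; exact cdist_self v _)
    (fun V hV => by rw [hγT] at hV; exact hW.exists_mem_of_cdist_lt v hcU hV) hr2 hKc hKU
  refine ⟨ρ₀, hρ₀, fun ρ hρ hρρ₀ => ?_⟩
  obtain ⟨C₁, hC₁, ω₁, hω₁, htime, hlip, hhit⟩ := himp ρ hρ hρρ₀ (O.T v / 2) (by positivity)
  obtain ⟨C₂, hC₂, ω₂, hω₂, -, htube, hpair⟩ := exists_tube hF hwt hγ hr2 hKU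
  obtain ⟨ω₃, hω₃, hsol⟩ := exists_isApproxTraj_zero hU hF hwt hγ
  obtain ⟨Lη, hLη⟩ := (((hW.contDiffOn_eta₂ v).locallyLipschitzOn_of_isOpen hU).mono
    hKU).exists_lipschitzOnWith_of_compact hKcc
  obtain ⟨ra, hra, hres⟩ := hreset
  set ω := min (min ω₁ ω₂) (min ω₃ (r₀ / 2))
  have hω : 0 < ω := lt_min (lt_min hω₁ hω₂) (lt_min hω₃ hr2)
  have o1 : ω ≤ ω₁ := (min_le_left _ _).trans (min_le_left _ _)
  have o2 : ω ≤ ω₂ := (min_le_left _ _).trans (min_le_right _ _)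
  have o3 : ω ≤ ω₃ := (min_le_right _ _).trans (min_le_left _ _)
  have o4 : ω ≤ r₀ / 2 := (min_le_right _ _).trans (min_le_right _ _)
  obtain ⟨ri, hri, δi, hδi, Ci, hCi, hin1, hin2, hin3⟩ :=
    hW.exists_initial v (hO.guard v.other) hω
  rw [← hγ0] at hin1 hin3
  set δ := min δi ω
  have hδ : 0 < δ := lt_min hδi hω
  have d1 : δ ≤ δi := min_le_left _ _
  have d2 : δ ≤ ω := min_le_right _ _
  -- what a step provides
  have unpack : ∀ D a b, D ≤ δ → a ∈ W.guard v.other → ‖a - O.pt v.other‖ < ri →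
      W.PhaseStep ε O ρ D v a b → ∃ T x, IsApproxTraj F wt (W.dom v) D T x ∧
        (∀ t ∈ Ico 0 T, x t ∉ W.guardBall v (O.pt v) ρ) ∧ x T ∈ W.guardBall v (O.pt v) ρ ∧
        b = x T ∧ ‖x 0 - W.reset v.other a‖ ≤ Ci * D ∧ ‖x 0 - γ 0‖ ≤ ω := by
    rintro D a b hD ha har ⟨u, e, T, x, ⟨hx, hx0, hno⟩, hxT, rfl, he, hm, hb⟩
    have happ := hW.isApproxTraj subset_rfl hx hm hb
    obtain ⟨h1, h2⟩ := (hin3 a ha har D (hD.trans d1) e he).2 (x 0)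
      (happ.mem 0 ⟨le_rfl, happ.nonneg⟩) hx0
    exact ⟨T, x, happ, hno, hxT, rfl, h1, h2⟩
  have hC₁0 : 0 < C₁ := by linarith
  have hC₂0 : 0 < C₂ := by linarith
  have hCi0 : 0 < Ci := by linarith
  set L := C₁ * (Ci + 1) + Lη * (C₂ * (Ci + 1)) with hL
  have hL1 : C₁ * (Ci + 1) ≤ L := by
    have : 0 ≤ Lη * (C₂ * (Ci + 1)) := by positivity
    linarith
  have hL2 : Lη * (C₂ * (Ci + 1)) ≤ L := by
    have : 0 ≤ C₁ * (Ci + 1) := by positivity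
    linarith
  have hL0 : 1 ≤ L := (one_le_mul_of_one_le_of_one_le hC₁ (by linarith)).trans hL1
  refine ⟨L, hL0, δ, hδ, min ri ra, lt_min hri hra, ?_, ?_, ?_⟩
  · intro D D' a a' b b' hD hDδ hD' hDδ' ha har ha' har' hs hs'
    have har1 := har.trans_le (min_le_left _ _)
    have har1' := har'.trans_le (min_le_left _ _)
    obtain ⟨T, x, hx, hno, hxT, rfl, h1, h2⟩ := unpack D a b hDδ ha har1 hs
    obtain ⟨T', x', hx', hno', hxT', rfl, h1', h2'⟩ := unpack D' a' b' hDδ' ha' har1' hs'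
    have k1 := hlip D D' T T' x x' hD (hDδ.trans (d2.trans o1)) (h2.trans o1) hx hno hxT
      hD' (hDδ'.trans (d2.trans o1)) (h2'.trans o1) hx' hno' hxT'
    have k2 := hin2 a ha har1 a' ha' har1'
    have k3 : ‖x 0 - x' 0‖ ≤ Ci * D + Ci * ‖a - a'‖ + Ci * D' := by
      have e : x 0 - x' 0 = (x 0 - W.reset v.other a) +
        (W.reset v.other a - W.reset v.other a') - (x' 0 - W.reset v.other a') := by abel
      rw [e]
      have := norm_add_le (x 0 - W.reset v.other a) (W.reset v.other a - W.reset v.other a')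
      refine (norm_sub_le _ _).trans ?_
      linarith
    have k4 : 0 ≤ ‖a - a'‖ := norm_nonneg _
    calc _ ≤ C₁ * (‖x 0 - x' 0‖ + D + D') := k1
      _ ≤ C₁ * ((Ci + 1) * (‖a - a'‖ + D + D')) :=
        mul_le_mul_of_nonneg_left (by linarith) hC₁0.le
      _ = C₁ * (Ci + 1) * (‖a - a'‖ + D + D') := by ring
      _ ≤ _ := mul_le_mul_of_nonneg_right hL1 (by positivity)
  · intro D a b hD hDδ ha har hs
    have har1 := har.trans_le (min_le_left _ _)
    obtain ⟨T, x, hx, hno, hxT, rfl, h1, h2⟩ := unpack D a b hDδ ha har1 hs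
    obtain ⟨t1, t2⟩ := htime D T x hD (hDδ.trans (d2.trans o1)) (h2.trans o1) hx hno hxT
    have hy0 := (hin1 a ha har1).2
    -- the undisturbed trajectory from the undisturbed post-impact state
    obtain ⟨y, hy0e, hy⟩ := hsol (W.reset v.other a) (hy0.trans o3)
    have hT : T ∈ Icc 0 T := ⟨hx.nonneg, le_rfl⟩
    have hTS₀ : T ∈ Icc 0 S₀ := ⟨hx.nonneg, t2.le⟩
    have k1 := hpair D 0 T x y hD (hDδ.trans (d2.trans o2)) le_rfl hω₂.le t2.le hx
      (hy.mono hx.nonneg t2.le) (h2.trans o2) (by rw [hy0e]; exact hy0.trans o2) T hT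
    rw [hy0e] at k1
    have m1 := memK T hTS₀ (x T) (htube D T x hD (hDδ.trans (d2.trans o2)) t2.le hx
      (h2.trans o2) T hT).le
    have m2 := memK T hTS₀ (y T) (htube 0 S₀ y le_rfl hω₂.le le_rfl hy
      (by rw [hy0e]; exact hy0.trans o2) T hTS₀).le
    have k2 := hLη.dist_le_mul _ m1 _ m2
    rw [dist_eq_norm, dist_eq_norm] at k2
    have k3 := hW.norm_eta₂_le hε v hy hTS₀
    rw [hy0e] at k3
    have k4 := hgain T (by linarith)
    have k5 := hres a ha (har.trans_le (min_le_right _ _))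
    have k6 : ‖W.eta₂ v (y T)‖ ≤ ‖W.eta₂ v.other a‖ / 2 := by
      calc _ ≤ κ * ‖W.eta₂ v (W.reset v.other a)‖ :=
            k3.trans (mul_le_mul_of_nonneg_right k4 (norm_nonneg _))
        _ ≤ κ * (K * ‖W.eta₂ v.other a‖) := mul_le_mul_of_nonneg_left k5 hκ
        _ = κ * K * ‖W.eta₂ v.other a‖ := by ring
        _ ≤ 1 / 2 * ‖W.eta₂ v.other a‖ := mul_le_mul_of_nonneg_right hκK (norm_nonneg _)
        _ = _ := by ring
    have k7 := norm_le_norm_add_norm_sub' (W.eta₂ v (x T)) (W.eta₂ v (y T))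
    have k8 : ‖W.eta₂ v (x T) - W.eta₂ v (y T)‖ ≤ L * D := by
      calc _ ≤ Lη * ‖x T - y T‖ := k2
        _ ≤ Lη * (C₂ * ((Ci + 1) * D)) := by
          apply mul_le_mul_of_nonneg_left _ Lη.coe_nonneg
          exact k1.trans (mul_le_mul_of_nonneg_left (by linarith) hC₂0.le)
        _ = Lη * (C₂ * (Ci + 1)) * D := by ring
        _ ≤ L * D := mul_le_mul_of_nonneg_right hL2 hD
    linarith
  · intro P w e D a hw hwb hDδ he ha har hbd
    obtain ⟨Cw, hCw⟩ := hwb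
    have hD : 0 ≤ D := (coordNorm_nonneg e).trans he
    have har1 := har.trans_le (min_le_left _ _)
    obtain ⟨⟨x₀, hx₀U, hx₀e⟩, hx₀⟩ := hin3 a ha har1 D (hDδ.trans d1) e he
    have hx₀γ := (hx₀ x₀ hx₀U hx₀e).2
    obtain ⟨x, hxc, hx0, hxt⟩ := hW.exists_traj_while_mem P hw hCw hKcc hr2 hKthick hS₀
      (memK 0 ⟨le_rfl, hS₀⟩ x₀ (hx₀γ.trans o4))
    have arc : ∀ S ∈ Icc 0 S₀, (∀ t ∈ Icc 0 S, x t ∈ Kc) →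
        (∀ t ∈ Ico 0 S, x t ∉ W.guardBall v (O.pt v) ρ) →
        W.IsArc v (W.dom v) (fun t y => P.uPD t y + w t) e (O.pt v) ρ a S x :=
      fun S hS hK hno => ⟨hxt S hS hK, by rw [hx0]; exact hx₀e, hno⟩
    obtain ⟨T, hT, hTK, hno, hxT⟩ := hhit D x hD (hDδ.trans (d2.trans o1))
      (by rw [hx0]; exact hx₀γ.trans o1) hxc.continuousOn (by
        intro S hS hK hno
        refine hW.isApproxTraj subset_rfl (hxt S hS hK) ?_ (hbd S x (arc S hS hK hno))
        exact P.aestronglyMeasurable hw measurableSet_Icc (fun t ht => ht.1) hxc.continuousOn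
          (fun t ht => hKU (hK t ht)))
    exact ⟨T, x, arc T hT hTK hno, hxT⟩

end Walker

end

noncomputable section

namespace Walker

variable {W : Walker}

/-! ### Runs -/

theorem isRun_mono {Z : Phase → Set W.X} {u : ∀ k : ℕ, ℝ → W.X → Vec (W.m (phaseAt k))}
    {e : ∀ k : ℕ, W.Coord (phaseAt k)} {c : Phase → W.X} {ρ : ℝ} {K K' : ℕ} {p : ℕ → W.X}
    (h : W.IsRun Z u e c ρ K p) (hK : K' ≤ K) : W.IsRun Z u e c ρ K' p :=
  fun k hk => h k (hk.trans_le hK)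

/-- The undisturbed runs on the zero dynamics surfaces consist of steps without disturbance. -/
theorem IsModel.phaseStep_of_isRunPZ (hW : W.IsModel) {ε : ℝ} {O : W.Orbit} {ρ : ℝ} {K : ℕ}
    {p : ℕ → W.X} (h : W.IsRunPZ ε O ρ K p) {k : ℕ} (hk : k < K) :
    W.PhaseStep ε O ρ 0 (phaseAt k) (p k) (p (k + 1)) := by
  obtain ⟨T, x, ⟨⟨h0, h1, h2, h3⟩, hx0, hno⟩, hxT, hp⟩ := h k hk
  have hU : ∀ t ∈ Icc 0 T, x t ∈ W.dom (phaseAt k) := fun t ht => (h2 t ht).1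
  refine ⟨_, 0, T, x, ⟨⟨h0, h1, hU, h3⟩, hx0, hno⟩, hxT, hp, by simp [coordNorm], ?_, by simp⟩
  exact ((hW.contDiffOn_uFL ε _).continuousOn.comp h1 hU).aestronglyMeasurable measurableSet_Icc

/-- The arcs of a periodic orbit are steps without disturbance. -/
theorem IsModel.phaseStep_orbit (hW : W.IsModel) {ε : ℝ} {O : W.Orbit} (hO : W.IsOrbitPZ ε O)
    {ρ : ℝ} (hρ : 0 < ρ) (v : Phase) : W.PhaseStep ε O ρ 0 v (O.pt v.other) (O.pt v) := by
  obtain ⟨h0, h1, h2, h3⟩ := hO.traj v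
  have hU : ∀ t ∈ Icc 0 (O.T v), O.γ v t ∈ W.dom v := fun t ht => (h2 t ht).1
  refine ⟨fun _ => W.uFL ε v, 0, O.T v, O.γ v, ⟨⟨h0, h1, hU, h3⟩, by rw [hO.start v, add_zero],
    fun t ht hg => hO.not_guard v t ht hg.1⟩, ⟨hO.guard v, ?_⟩, rfl, by simp [coordNorm], ?_,
    by simp⟩
  · exact (cdist_self v (O.pt v)).trans_lt hρ
  · exact ((hW.contDiffOn_uFL ε _).continuousOn.comp h1 hU).aestronglyMeasurable measurableSet_Icc

/-- Under a bound on the disturbance, the runs under PD laws consist of steps with that bound. -/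
theorem DistBound.phaseStep {ε : ℝ} {L : ∀ v : Phase, W.PDLaw v}
    {w : ∀ k : ℕ, ℝ → Vec (W.m (phaseAt k))} {e : ∀ k : ℕ, W.Coord (phaseAt k)} {O : W.Orbit}
    {ρ D : ℝ} {p : ℕ → W.X} (hw : ∀ k, Measurable (w k))
    (hD : W.DistBound ε L w e O ρ (p 0) D) {K : ℕ} (h : W.IsRunPD L w e O ρ K p) {k : ℕ}
    (hk : k < K) : W.PhaseStep ε O ρ D (phaseAt k) (p k) (p (k + 1)) := by
  obtain ⟨T, x, hx, hxT, hp⟩ := h k hk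
  refine ⟨_, e k, T, x, hx, hxT, hp, hD.1 k, ?_, hD.2 k p rfl (isRun_mono h hk.le) T x hx⟩
  exact (L (phaseAt k)).aestronglyMeasurable (hw k) measurableSet_Icc (fun t ht => ht.1)
    hx.1.2.1 hx.1.2.2.1

end Walker

end

theorem theorem1 (W : Walker) (hW : W.IsModel)
    (C : Phase → Set W.X) (hC : ∀ v, IsCompact (C v)) (hCg : ∀ v, C v ⊆ W.guardPZ v)
    (T₀ : ℝ) (hT₀ : 0 < T₀) :
    ∃ ε₀ > 0, ∀ ε ≥ ε₀, ∀ O : W.Orbit, W.IsOrbitPZ ε O →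
      (∀ v, O.pt v ∈ C v) → (∀ v, T₀ ≤ O.T v) → W.IsExpStablePZ ε O →
        ∃ ρ₀ > 0, ∀ ρ, 0 < ρ → ρ ≤ ρ₀ → ∃ r > 0, ∃ δ > 0, W.IsEISS ε O ρ r δ := by
  obtain ⟨Kd, hKd, hresd⟩ := hW.exists_reset_bound Phase.ds (hC Phase.ds) (hCg Phase.ds)
  obtain ⟨Ks, hKs, hress⟩ := hW.exists_reset_bound Phase.ss (hC Phase.ss) (hCg Phase.ss)
  -- the gain for which a phase of duration `T₀ / 2` outweighs the switching maps
  set κ := 1 / (2 * (Kd + Ks + 1)) with hκ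
  have hKpos : 0 < Kd + Ks + 1 := by linarith
  have hκ0 : 0 < κ := by positivity
  have hκK : κ * (Kd + Ks + 1) = 1 / 2 := by rw [hκ]; field_simp
  obtain ⟨ε₀, hε₀, hgain⟩ := Walker.exists_gain hκ0 (half_pos hT₀)
  refine ⟨ε₀, by linarith, fun ε hε O hO hOC hOT hstab => ?_⟩
  have hε0 : 0 ≤ ε := by linarith
  have hgd := hW.exists_phase_estimates hε0 hO Phase.ds (hOT _) (hgain ε hε) hκ0.le
    (K := Ks) (by nlinarith) (hress _ (hOC Phase.ss))
  have hgs := hW.exists_phase_estimates hε0 hO Phase.ss (hOT _) (hgain ε hε) hκ0.le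
    (K := Kd) (by nlinarith) (hresd _ (hOC Phase.ds))
  obtain ⟨ρd, hρd, hgd⟩ := hgd
  obtain ⟨ρs, hρs, hgs⟩ := hgs
  obtain ⟨ρe, hρe, hstab⟩ := hstab
  set c := O.pt Phase.ss with hc
  have hcg : c ∈ W.guardPZ Phase.ss := hCg _ (hOC Phase.ss)
  have hcU : c ∈ W.dom Phase.ss := hcg.2.1.1
  obtain ⟨Ce, hCe, re, hre, hreU, heq⟩ := hW.exists_cdist_equiv Phase.ss hcU
  have hCe0 : 0 < Ce := by linarith
  obtain ⟨ρq, hρq, hq⟩ := hW.exists_mem_of_cdist_lt Phase.ss hcU (Metric.ball_mem_nhds c hre)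
  have hcre : c ∈ Metric.ball c re := Metric.mem_ball_self hre
  refine ⟨min (min ρd ρs) (min ρe ρq), lt_min (lt_min hρd hρs) (lt_min hρe hρq),
    fun ρ hρ hρle => ?_⟩
  obtain ⟨Ld, hLd, δd, hδd, rd, hrd, lipd, etad, exd⟩ := hgd ρ hρ
    (hρle.trans ((min_le_left _ _).trans (min_le_left _ _)))
  obtain ⟨Ls, hLs, δs, hδs, rs, hrs, lips, etas, exs⟩ := hgs ρ hρ
    (hρle.trans ((min_le_left _ _).trans (min_le_right _ _)))
  obtain ⟨rZ, hrZ, N, hN, ξ, hξ0, hξ1, hst⟩ := hstab ρ hρ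
    (hρle.trans ((min_le_right _ _).trans (min_le_left _ _)))
  have hρq' : ρ ≤ ρq := hρle.trans ((min_le_right _ _).trans (min_le_right _ _))
  obtain ⟨Kp, hKp, rp, hrp, hproj⟩ := hW.exists_projection Phase.ss hcg Filter.univ_mem
  obtain ⟨Lη, Vη, hVη, hLη⟩ := (hW.hasStrictFDerivAt_eta₂ Phase.ss hcU).exists_lipschitzOnWith
  obtain ⟨rη, hrη, hballη⟩ := Metric.mem_nhds_iff.1 hVη
  -- constants common to both phases
  set r₁ := min (min (min rd rs) (min rp rη)) (min re (rZ / Ce)) with hr₁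
  have hr₁0 : 0 < r₁ := lt_min (lt_min (lt_min hrd hrs) (lt_min hrp hrη))
    (lt_min hre (by positivity))
  have q1 : r₁ ≤ rd := (min_le_left _ _).trans ((min_le_left _ _).trans (min_le_left _ _))
  have q2 : r₁ ≤ rs := (min_le_left _ _).trans ((min_le_left _ _).trans (min_le_right _ _))
  have q3 : r₁ ≤ rp := (min_le_left _ _).trans ((min_le_right _ _).trans (min_le_left _ _))
  have q4 : r₁ ≤ rη := (min_le_left _ _).trans ((min_le_right _ _).trans (min_le_right _ _))
  have q5 : r₁ ≤ re := (min_le_right _ _).trans (min_le_left _ _)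
  have q6 : r₁ ≤ rZ / Ce := (min_le_right _ _).trans (min_le_right _ _)
  set δ₁ := min δd δs
  have hδ₁ : 0 < δ₁ := lt_min hδd hδs
  have s1 : δ₁ ≤ δd := min_le_left _ _
  have s2 : δ₁ ≤ δs := min_le_right _ _
  set L := max Ld Ls
  have hL : 1 ≤ L := hLd.trans (le_max_left _ _)
  have memball : ∀ a, ‖a - c‖ < r₁ → a ∈ Metric.ball c re := fun a ha => by
    rw [Metric.mem_ball, dist_eq_norm]
    exact ha.trans_le q5
  obtain ⟨r, hr, δ, hδ, N', hN', ξ', hξ'0, hξ'1, b, hb, hiss⟩ :=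
    exists_iss_of_transverse_contraction (R := W.PhaseStep ε O ρ) (G := W.guard)
      (Z := W.guard Phase.ss ∩ W.PZ Phase.ss) (c := O.pt) (η := fun v a => ‖W.eta₂ v a‖)
      (r₁ := r₁) (δ₁ := δ₁) (L := L) (K := max Kp Lη) (N := Ce ^ 2 * N) (ξ := ξ) hr₁0 hδ₁ hL
      (hKp.trans (le_max_left _ _)) (by positivity) hξ0 hξ1 (fun _ _ => norm_nonneg _)
      (fun D v a b h => h.mem_guard.1) hO.guard (fun v => hW.phaseStep_orbit hO hρ v)
      (by
        intro v D D' a a' b b' hD hDδ hD' hDδ' ha har ha' har' hs hs'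
        have hsum : 0 ≤ ‖a - a'‖ + D + D' := by positivity
        cases v with
        | ds =>
          have h1 := lipd D D' a a' b b' hD (hDδ.trans s1) hD' (hDδ'.trans s1) ha
            (har.trans_le q1) ha' (har'.trans_le q1) hs hs'
          exact h1.trans (mul_le_mul_of_nonneg_right (le_max_left _ _) hsum)
        | ss =>
          have h1 := lips D D' a a' b b' hD (hDδ.trans s2) hD' (hDδ'.trans s2) ha
            (har.trans_le q2) ha' (har'.trans_le q2) hs hs'
          exact h1.trans (mul_le_mul_of_nonneg_right (le_max_right _ _) hsum))
      (by
        intro v D a b hD hDδ ha har hs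
        cases v with
        | ds =>
          have h1 := etad D a b hD (hDδ.trans s1) ha (har.trans_le q1) hs
          exact h1.trans (add_le_add le_rfl (mul_le_mul_of_nonneg_right (le_max_left _ _) hD))
        | ss =>
          have h1 := etas D a b hD (hDδ.trans s2) ha (har.trans_le q2) hs
          exact h1.trans (add_le_add le_rfl (mul_le_mul_of_nonneg_right (le_max_right _ _) hD)))
      inter_subset_left
      (by
        intro a ha har
        obtain ⟨a', -, hg, hz, haa⟩ := hproj a ha (har.trans_le q3)
        refine ⟨a', ⟨hg, hz⟩, ?_⟩
        rw [norm_sub_rev]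
        exact haa.trans (mul_le_mul_of_nonneg_right (le_max_left _ _) (norm_nonneg _)))
      (by
        intro a ha har
        have h1 := hLη.dist_le_mul a (hballη (by
          rw [Metric.mem_ball, dist_eq_norm]; exact har.trans_le q4)) c
          (hballη (Metric.mem_ball_self hrη))
        rw [Walker.eta₂_eq_zero hcg.2.1, dist_zero_right, dist_eq_norm] at h1
        exact h1.trans (mul_le_mul_of_nonneg_right (le_max_right _ _) (norm_nonneg _)))
      (by
        rintro a ⟨hag, haz⟩ har
        have haB := memball a har
        have hac := (heq a haB c hcre).1
        have hlt : W.cdist Phase.ss a c < rZ := by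
          have h1 : Ce * ‖a - c‖ < Ce * (rZ / Ce) :=
            mul_lt_mul_of_pos_left (har.trans_le q6) hCe0
          rw [mul_div_cancel₀ _ hCe0.ne'] at h1
          exact hac.trans_lt h1
        obtain ⟨⟨p, hp0, hp⟩, hconv⟩ := hst a ⟨⟨hag, hlt⟩, haz⟩
        have hstep : ∀ k, W.PhaseStep ε O ρ 0 (phaseAt k) (p k) (p (k + 1)) := fun k =>
          hW.phaseStep_of_isRunPZ (hp (k + 1)) (Nat.lt_succ_self k)
        refine ⟨p, hp0, hstep, fun i => ?_⟩
        have hpB : p (2 * i) ∈ Metric.ball c re := by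
          rcases Nat.eq_zero_or_pos i with rfl | hi
          · rw [mul_zero, hp0]; exact haB
          · obtain ⟨k, rfl⟩ : ∃ k, i = k + 1 := ⟨i - 1, by omega⟩
            have h1 := (hstep (2 * k + 1)).mem_guard
            have e1 : phaseAt (2 * k + 1) = Phase.ss := phaseAt_two_mul_add k 1
            rw [e1] at h1
            exact hq _ (hW.act_subset _ h1.1.1) (h1.2.trans_le hρq')
        have h1 := hconv i p hp0 (hp (2 * i))
        have h2 := (heq _ hpB c hcre).2
        have h3 : 0 ≤ N * ξ ^ i := by positivity
        calc _ ≤ Ce * W.cdist Phase.ss (p (2 * i)) c := h2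
          _ ≤ Ce * (N * ξ ^ i * (Ce * ‖a - c‖)) :=
            mul_le_mul_of_nonneg_left (h1.trans (mul_le_mul_of_nonneg_left hac h3)) hCe0.le
          _ = _ := by ring)
  -- back to the distance in the coordinates `(η, z)`
  obtain ⟨r', hr', hrq⟩ := hW.exists_mem_of_cdist_lt Phase.ss hcU
    (Metric.ball_mem_nhds c (lt_min hr hr₁0))
  refine ⟨r', hr', min δ δ₁, lt_min hδ hδ₁, Ce ^ 2 * N', by positivity, ξ', hξ'0, hξ'1,
    fun D => Ce * b * D, ⟨by fun_prop, ?_, by simp, ?_⟩, ?_⟩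
  · intro x _ y _ hxy
    exact mul_lt_mul_of_pos_left hxy (by positivity)
  · exact Filter.tendsto_id.const_mul_atTop (by positivity)
  intro P w e hwm hwb x₀ hx₀ D hDδ hbound
  have hD0 : 0 ≤ D := (Walker.coordNorm_nonneg (e 0)).trans (hbound.1 0)
  have hDδ' : D ≤ δ := hDδ.trans (min_le_left _ _)
  have hx₀b : ‖x₀ - c‖ < min r r₁ := by
    have h1 := hrq x₀ (hW.act_subset _ hx₀.1.1) hx₀.2
    rwa [Metric.mem_ball, dist_eq_norm] at h1
  have hx₀r : ‖x₀ - c‖ < r := hx₀b.trans_le (min_le_left _ _)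
  -- the estimates apply to every run
  have est : ∀ (p : ℕ → W.X) (n : ℕ), p 0 = x₀ → W.IsRunPD P w e O ρ n p →
      (∀ k ≤ n, p k ∈ W.guard (phaseAt k).other ∧ ‖p k - O.pt (phaseAt k).other‖ < r₁) ∧
        ∀ i, 2 * i ≤ n →
          ‖p (2 * i) - c‖ ≤ N' * ξ' ^ i * ‖p 0 - c‖ + b * D := by
    intro p n hp0 hp
    exact hiss D hD0 hDδ' p n (by rw [hp0]; exact hx₀.1) (by rw [hp0]; exact hx₀r)
      fun k hk => Walker.DistBound.phaseStep hwm (by rw [hp0]; exact hbound) hp hk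
  refine ⟨?_, fun i p hp0 hp => ?_⟩
  · -- the run is built impact by impact
    classical
    let Q : ℕ → W.X → W.X → Prop := fun k a b => ∃ (T : ℝ) (x : ℝ → W.X),
      W.IsArc (phaseAt k) (W.dom (phaseAt k)) (W.appliedInput P w k) (e k) (O.pt (phaseAt k)) ρ
        a T x ∧ x T ∈ W.guardBall (phaseAt k) (O.pt (phaseAt k)) ρ ∧ b = x T
    let p : ℕ → W.X := fun n => Nat.rec x₀ (fun k a => if h : ∃ b, Q k a b then h.choose else a) n
    have hpsucc : ∀ k, (∃ b, Q k (p k) b) → Q k (p k) (p (k + 1)) := by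
      intro k h
      have e1 : p (k + 1) = if h : ∃ b, Q k (p k) b then h.choose else p k := rfl
      rw [e1, dif_pos h]
      exact h.choose_spec
    have next : ∀ (v : Phase), ∀ (P : W.PDLaw v) (w : ℝ → Vec (W.m v)) (e : W.Coord v) (a : W.X),
        Measurable w → (∃ C, ∀ t, ‖w t‖ ≤ C) → W.coordNorm e ≤ D →
        a ∈ W.guard v.other → ‖a - O.pt v.other‖ < r₁ →
        (∀ S x, W.IsArc v (W.dom v) (fun t y => P.uPD t y + w t) e (O.pt v) ρ a S x →
          ∀ᵐ t ∂(volume.restrict (Icc 0 S)), ‖P.uPD t (x t) + w t - W.uFL ε v (x t)‖ ≤ D) →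
        ∃ T x, W.IsArc v (W.dom v) (fun t y => P.uPD t y + w t) e (O.pt v) ρ a T x ∧
          x T ∈ W.guardBall v (O.pt v) ρ := by
      intro v P w e a hw hwb he ha har hbd
      have hDδ₁ : D ≤ δ₁ := hDδ.trans (min_le_right _ _)
      cases v with
      | ds => exact exd P w e D a hw hwb (hDδ₁.trans s1) he ha (har.trans_le q1) hbd
      | ss => exact exs P w e D a hw hwb (hDδ₁.trans s2) he ha (har.trans_le q2) hbd
    refine ⟨p, rfl, fun n => ?_⟩
    induction n with
    | zero => exact fun k hk => absurd hk (Nat.not_lt_zero k)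
    | succ n ih =>
      obtain ⟨hg, hnear⟩ := (est p n rfl ih).1 n le_rfl
      obtain ⟨T, x, hx, hxT⟩ := next (phaseAt n) (P _) (w n) (e n) (p n) (hwm n) (hwb n)
        (hbound.1 n) hg hnear (fun S x hx => hbound.2 n p rfl ih S x hx)
      intro k hk
      rcases Nat.lt_succ_iff_lt_or_eq.1 hk with hk | rfl
      · exact ih k hk
      · exact hpsucc k ⟨x T, T, x, hx, hxT, rfl⟩
  · obtain ⟨h1, h2⟩ := est p (2 * i) hp0 hp
    have h3 := (h1 (2 * i) le_rfl).2
    rw [phaseAt_other_two_mul] at h3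
    have h4 := (heq _ (memball _ h3) c hcre).1
    have h5 := (heq x₀ (memball _ (hx₀b.trans_le (min_le_right _ _))) c hcre).2
    have h6 := h2 i le_rfl
    rw [hp0] at h6
    have h7 : 0 ≤ N' * ξ' ^ i := by positivity
    calc _ ≤ Ce * ‖p (2 * i) - c‖ := h4
      _ ≤ Ce * (N' * ξ' ^ i * (Ce * W.cdist Phase.ss x₀ c) + b * D) :=
        mul_le_mul_of_nonneg_left
          (h6.trans (add_le_add (mul_le_mul_of_nonneg_left h5 h7) le_rfl)) hCe0.le
      _ = _ := by ring
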